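/- Let $X$ be the line $\mathbb R$ or the circle $\mathbb T=\mathbb R/\mathbb Z$ (total mass $1$), let $\mu\in\{+1,-1\}$, and let $L^2=L^2(X;\mathbb R)$. Put $\ell(\kappa)=1$ on $\mathbb R$ and $\ell(\kappa)=\tanh(\kappa/2)$ on $\mathbb T$. For $\delta>0$ and $\kappa\ge 1$ let $B_{\delta,\kappa}=\{q\in L^2:\kappa^{-1/2}\|q\|_{L^2}\le\delta\}$, and let $$A(\kappa,q)=\mu\,\ell(\kappa)\sum_{m=1}^{\infty}\frac{(-\mu)^{m-1}}{m}\,\mathrm{tr}\Big\{\big[(\kappa-\partial)^{-1}q(\kappa+\partial)^{-1}q\big]^m\Big\}.$$ Let $L_q(\kappa)=\begin{bmatrix}\kappa-\partial & q\\ -\mu q&\kappa+\partial\end{bmatrix}$ on $L^2\times L^2$ with domain $H^1\times H^1$. When $L_q(\kappa)$ is invertible and $L_q(\kappa)^{-1}$ has an integral kernel $G(x,y;\kappa)$ such that $G-G_0$ is continuous on $X\times X$, where $G_0$ is the (diagonal) kernel of $L_0(\kappa)^{-1}$, put $r(x;\kappa)=\ell(\kappa)\,[G_{21}(x,x;\kappa)-\mu\,G_{12}(x,x;\kappa)]$.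 Let $M(q)=\frac12\int q^2\,dx$, $H_{\mathrm{mKdV}}(q)=\frac12\int \big((q')^2+\mu q^4\big)\,dx$, and $\{F,G\}=\int\frac{\delta F}{\delta q}\big(\frac{\delta G}{\delta q}\big)'dx$, where $dF|_q(f)=\int \frac{\delta F}{\delta q}f\,dx$. **Proposition 3.1.** There exists $\delta>0$ such that the following hold. 1. For all $\kappa\ge1$, $q\in B_{\delta,\kappa}$ and $m\ge1$ the operator $[(\kappa-\partial)^{-1}q(\kappa+\partial)^{-1}q]^m$ is trace class on $L^2$. The series $A(\kappa,q)$ converges absolutely, and its partial sums converge uniformly over all $\kappa\ge1$ and $q\in B_{\delta,\kappa}$. 2. For all $\kappa\ge1$ and $q\in B_{\delta,\kappa}$, the kernel $G$ above exists, and $A(\kappa,\cdot)$ is (Fréchet) differentiable at $q$ as a functional on $L^2$, with $\frac{\delta A}{\delta q}=r(\kappa)\in L^2$. 3. For every $q\in\mathcal S$ (Schwartz functions on $\mathbb R$, $C^\infty$ functions on $\mathbb T$) there is a constant $C$ depending only on $q$ (and on $X,\mu,\delta$) such that, for all $\kappa\ge1$ with $q\in B_{\delta,\kappa}$, $$\Big|A(\kappa,q)-\frac{\mu}{\kappa}M(q)+\frac{\mu}{4\kappa^3}H_{\mathrm{mKdV}}(q)\Big|\le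 C\kappa^{-5}.$$ 4. For all $\kappa,\varkappa\ge1$ and $q\in B_{\delta,\kappa}\cap B_{\delta,\varkappa}$, the bracket exists (with the derivative in it taken weakly) and $\{A(\kappa),A(\varkappa)\}(q)=0$. -/

import Mathlib

open MeasureTheory Filter Topology
open scoped ENNReal ContDiff Matrix

noncomputable section

namespace MKdV

/-! ## The two geometries: the line `ℝ` and the circle `𝕋 = ℝ / ℤ` -/

/-- The data in which the line and the circle differ.  The only instances are the two below. -/
class Geometry (X : Type) where
  /-- the covering map `ℝ → X`, used to differentiate functions on `X` -/
  proj : ℝ → X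
  /-- the convolution kernel of `(κ - ∂)⁻¹` -/
  kerMinus : ℝ → X → ℝ
  /-- the convolution kernel of `(κ + ∂)⁻¹` -/
  kerPlus : ℝ → X → ℝ
  /-- the normalizing factor `ℓ(κ)` -/
  ell : ℝ → ℝ
  /-- the class `𝓢` of Schwartz functions -/
  IsSchwartz : (X → ℝ) → Prop

/-- The line.  The kernels are `e^{-κ|z|} 1_{z < 0}` and `e^{-κ|z|} 1_{z > 0}`, with `z = x - y`. -/
instance : Geometry ℝ where
  proj t := t
  kerMinus κ z := if z < 0 then Real.exp (-κ * |z|) else 0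
  kerPlus κ z := if 0 < z then Real.exp (-κ * |z|) else 0
  ell _ := 1
  IsSchwartz φ := ∃ f : SchwartzMap ℝ ℝ, ∀ x, φ x = f x

theorem periodic_kerMinus (κ : ℝ) :
    Function.Periodic (fun t : ℝ => Real.exp (κ * (t - ⌈t⌉)) / (1 - Real.exp (-κ))) 1 := by
  intro t
  simp [Int.ceil_add_one]

theorem periodic_kerPlus (κ : ℝ) :
    Function.Periodic (fun t : ℝ => Real.exp (-κ * (t - ⌊t⌋)) / (1 - Real.exp (-κ))) 1 := by
  intro t
  simp [Int.floor_add_one]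

/-- The circle `ℝ / ℤ`, with its Haar probability measure.  Smooth functions are those
whose `1`-periodic lift to `ℝ` is `C^∞`. -/
instance : Geometry UnitAddCircle where
  proj t := (t : UnitAddCircle)
  kerMinus κ := (periodic_kerMinus κ).lift
  kerPlus κ := (periodic_kerPlus κ).lift
  ell κ := Real.tanh (κ / 2)
  IsSchwartz φ := ContDiff ℝ ∞ (fun t : ℝ => φ (t : UnitAddCircle))

/-! ## Hilbert–Schmidt and trace class operators on a real Hilbert space -/

section Trace

variable {H : Type} [NormedAddCommGroup H] [InnerProductSpace ℝ H] [CompleteSpace H]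

/-- `T` is Hilbert–Schmidt: `∑ ‖T eᵢ‖² < ∞` for every orthonormal (Hilbert) basis `e`. -/
def IsHilbertSchmidt (T : H →L[ℝ] H) : Prop :=
  ∀ (ι : Type) (e : HilbertBasis ι ℝ H), Summable fun i => ‖T (e i)‖ ^ 2

/-- `T` is trace class: it is the product of two Hilbert–Schmidt operators. -/
def IsTraceClass (T : H →L[ℝ] H) : Prop :=
  ∃ A B : H →L[ℝ] H, IsHilbertSchmidt A ∧ IsHilbertSchmidt B ∧ T = A.comp B

variable (H) in
/-- The index set of a fixed orthonormal basis of `H`. -/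
def basisIndex : Set H := (exists_hilbertBasis ℝ H).choose

variable (H) in
/-- A fixed orthonormal basis of `H`. -/
def basis : HilbertBasis (basisIndex H) ℝ H := (exists_hilbertBasis ℝ H).choose_spec.choose

/-- The trace `∑ ⟨eᵢ, T eᵢ⟩`; for trace class `T` the sum converges absolutely and does
not depend on the orthonormal basis. -/
def opTrace (T : H →L[ℝ] H) : ℝ :=
  ∑' i, inner ℝ (basis H i) (T (basis H i))

end Trace

/-! ## Integral operators on `L²(X)` -/

/-- The real Hilbert space `L²(X)`. -/
abbrev L2 (X : Type) [MeasureSpace X] : Type := Lp ℝ 2 (volume : Measure X)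

section IntegralOperator

variable {X : Type} [MeasureSpace X] [SFinite (volume : Measure X)]

theorem eLpNorm_intOp_le {K : X → X → ℝ}
    (hK : AEStronglyMeasurable (Function.uncurry K) ((volume : Measure X).prod volume))
    (f : X → ℝ) (hf : AEStronglyMeasurable f volume) :
    eLpNorm (fun x => ∫ y, K x y * f y) 2 volume ≤
      eLpNorm (Function.uncurry K) 2 ((volume : Measure X).prod volume) * eLpNorm f 2 volume := by
  have two : (2 : ℝ≥0∞) ≠ 0 := by norm_num
  have twot : (2 : ℝ≥0∞) ≠ ⊤ := by norm_num
  simp only [eLpNorm_eq_lintegral_rpow_enorm_toReal two twot, ENNReal.toReal_ofNat]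
  rw [← ENNReal.mul_rpow_of_nonneg _ _ (by norm_num : (0:ℝ) ≤ 1 / 2)]
  gcongr
  rw [lintegral_prod _ (by fun_prop)]
  have hm : AEMeasurable (fun z => ‖Function.uncurry K z‖ₑ ^ (2:ℝ))
      ((volume : Measure X).prod volume) := by fun_prop
  rw [← lintegral_mul_const'' _ hm.lintegral_prod_right']
  apply lintegral_mono_ae
  filter_upwards [hK.prodMk_left] with x hx
  have h1 : ‖∫ y, K x y * f y‖ₑ ≤ ∫⁻ y, ‖K x y‖ₑ * ‖f y‖ₑ := by
    refine (enorm_integral_le_lintegral_enorm _).trans (le_of_eq ?_)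
    simp only [enorm_mul]
  have h2 := ENNReal.lintegral_mul_le_Lp_mul_Lq (volume : Measure X) (p := 2) (q := 2)
    Real.HolderConjugate.two_two hx.enorm hf.enorm
  calc ‖∫ y, K x y * f y‖ₑ ^ (2:ℝ)
      ≤ ((∫⁻ y, ‖K x y‖ₑ ^ (2:ℝ)) ^ (1 / (2:ℝ)) *
          (∫⁻ y, ‖f y‖ₑ ^ (2:ℝ)) ^ (1 / (2:ℝ))) ^ (2:ℝ) := by
        gcongr; exact h1.trans h2
    _ = _ := by
        rw [← ENNReal.mul_rpow_of_nonneg _ _ (by norm_num : (0:ℝ) ≤ 1 / 2), ← ENNReal.rpow_mul]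
        norm_num [Function.uncurry]

theorem memLp_intOp {K : X → X → ℝ}
    (hK : MemLp (Function.uncurry K) 2 ((volume : Measure X).prod volume)) (f : L2 X) :
    MemLp (fun x => ∫ y, K x y * f y) 2 volume := by
  have hf := Lp.memLp f
  refine ⟨?_, (eLpNorm_intOp_le hK.1 f hf.1).trans_lt (ENNReal.mul_lt_top hK.2 hf.2)⟩
  exact AEStronglyMeasurable.integral_prod_right'
    (f := fun z : X × X => Function.uncurry K z * f z.2) (hK.1.mul hf.1.comp_snd)

theorem ae_integrable_intOp {K : X → X → ℝ}
    (hK : MemLp (Function.uncurry K) 2 ((volume : Measure X).prod volume)) :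
    ∀ᵐ x : X, ∀ f : L2 X, Integrable (fun y => K x y * f y) volume := by
  have two : (2 : ℝ≥0∞) ≠ 0 := by norm_num
  have twot : (2 : ℝ≥0∞) ≠ ⊤ := by norm_num
  have h := (eLpNorm_lt_top_iff_lintegral_rpow_enorm_lt_top two twot).1 hK.2
  have hm : AEMeasurable (fun z => ‖Function.uncurry K z‖ₑ ^ (2 : ℝ≥0∞).toReal)
      ((volume : Measure X).prod volume) := hK.1.enorm.pow_const _
  rw [lintegral_prod _ hm] at h
  filter_upwards [ae_lt_top' hm.lintegral_prod_right' h.ne, hK.1.prodMk_left] with x hx hx' f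
  exact MemLp.integrable_mul
    ⟨hx', (eLpNorm_lt_top_iff_lintegral_rpow_enorm_lt_top two twot).2 hx⟩ (Lp.memLp f)

/-- The Hilbert–Schmidt integral operator `f ↦ ∫ K(·, y) f(y) dy` on `L²(X)` for
`K ∈ L²(X × X)`. -/
def intOpOfMemLp (K : X → X → ℝ)
    (hK : MemLp (Function.uncurry K) 2 ((volume : Measure X).prod volume)) : L2 X →L[ℝ] L2 X :=
  LinearMap.mkContinuous
    { toFun := fun f => (memLp_intOp hK f).toLp _
      map_add' := by
        intro f g
        refine Lp.ext ?_
        refine (MemLp.coeFn_toLp _).trans ?_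
        refine EventuallyEq.trans ?_ (Lp.coeFn_add _ _).symm
        filter_upwards [ae_integrable_intOp hK, (memLp_intOp hK f).coeFn_toLp,
          (memLp_intOp hK g).coeFn_toLp] with x hx hf hg
        rw [Pi.add_apply, hf, hg, ← integral_add (hx f) (hx g)]
        refine integral_congr_ae ?_
        filter_upwards [Lp.coeFn_add f g] with y hy
        rw [hy, Pi.add_apply, mul_add]
      map_smul' := by
        intro c f
        refine Lp.ext ?_
        refine (MemLp.coeFn_toLp _).trans ?_
        refine EventuallyEq.trans ?_ (Lp.coeFn_smul _ _).symm
        filter_upwards [(memLp_intOp hK f).coeFn_toLp] with x hf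
        rw [Pi.smul_apply, RingHom.id_apply, hf, smul_eq_mul, ← integral_const_mul]
        refine integral_congr_ae ?_
        filter_upwards [Lp.coeFn_smul c f] with y hy
        rw [hy, Pi.smul_apply, smul_eq_mul]
        ring }
    (eLpNorm (Function.uncurry K) 2 ((volume : Measure X).prod volume)).toReal
    (by
      intro f
      change ‖(memLp_intOp hK f).toLp _‖ ≤ _
      rw [Lp.norm_toLp, Lp.norm_def, ← ENNReal.toReal_mul]
      exact ENNReal.toReal_mono (ENNReal.mul_lt_top hK.2 (Lp.memLp f).2).ne
        (eLpNorm_intOp_le hK.1 f (Lp.memLp f).1))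

open Classical in
/-- The integral operator with kernel `K`; the value `0` for a kernel outside `L²(X × X)` is
never used for `κ > 0`, see `memLp_resolventKernel_line` and `memLp_resolventKernel_circle`. -/
def intOp (K : X → X → ℝ) : L2 X →L[ℝ] L2 X :=
  if hK : MemLp (Function.uncurry K) 2 ((volume : Measure X).prod volume) then
    intOpOfMemLp K hK
  else 0

theorem memLp_convKernel [AddCommGroup X] [MeasurableAdd₂ X] [MeasurableNeg X]
    [(volume : Measure X).IsAddRightInvariant] {k : X → ℝ} (hk : MemLp k 2 volume) (q : L2 X) :
    MemLp (Function.uncurry fun x y => k (x - y) * q y) 2 ((volume : Measure X).prod volume) := by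
  have hq := Lp.memLp q
  have h : MemLp (fun z : X × X => k z.1 * q z.2) 2 ((volume : Measure X).prod volume) := by
    refine (memLp_two_iff_integrable_sq
      (f := fun z : X × X => k z.1 * q z.2) (hk.1.comp_fst.mul hq.1.comp_snd)).2 ?_
    simpa only [mul_pow] using hk.integrable_sq.mul_prod hq.integrable_sq
  exact h.comp_measurePreserving (measurePreserving_sub_prod volume volume)

end IntegralOperator

/-! ## The functional `A(κ, q)` -/

section LogDet

variable {X : Type} [AddCommGroup X] [MeasureSpace X] [SFinite (volume : Measure X)] [Geometry X]

/-- The operator `(κ - ∂)⁻¹ q` (multiply by `q`, then apply the resolvent). -/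
def minusOp (κ : ℝ) (q : L2 X) : L2 X →L[ℝ] L2 X :=
  intOp fun x y => Geometry.kerMinus κ (x - y) * q y

/-- The operator `(κ + ∂)⁻¹ q`. -/
def plusOp (κ : ℝ) (q : L2 X) : L2 X →L[ℝ] L2 X :=
  intOp fun x y => Geometry.kerPlus κ (x - y) * q y

/-- The operator `(κ - ∂)⁻¹ q (κ + ∂)⁻¹ q`. -/
def lambdaOp (κ : ℝ) (q : L2 X) : L2 X →L[ℝ] L2 X :=
  (minusOp κ q).comp (plusOp κ q)

/-- The summand of index `m = n + 1` of the series defining `A(κ, q)`. -/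
def seriesTerm (μ κ : ℝ) (q : L2 X) (n : ℕ) : ℝ :=
  μ * Geometry.ell X κ * ((-μ) ^ n / (n + 1) * opTrace (lambdaOp κ q ^ (n + 1)))

/-- `A(κ, q) = μ ℓ(κ) ∑_{m ≥ 1} (-μ)^{m-1} / m · tr {[(κ - ∂)⁻¹ q (κ + ∂)⁻¹ q]^m}`. -/
def logDet (μ κ : ℝ) (q : L2 X) : ℝ := ∑' n, seriesTerm μ κ q n

end LogDet

theorem memLp_resolventKernel_line {κ : ℝ} (hκ : 0 < κ) (q : L2 ℝ) :
    MemLp (Function.uncurry fun x y : ℝ => Geometry.kerMinus κ (x - y) * q y) 2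
        ((volume : Measure ℝ).prod volume) ∧
      MemLp (Function.uncurry fun x y : ℝ => Geometry.kerPlus κ (x - y) * q y) 2
        ((volume : Measure ℝ).prod volume) := by
  have e1 : (Geometry.kerMinus κ : ℝ → ℝ) =
      (Set.Iio 0).indicator fun z : ℝ => Real.exp (-κ * |z|) := by
    funext z
    simp [Geometry.kerMinus, Set.indicator_apply]
  have e2 : (Geometry.kerPlus κ : ℝ → ℝ) =
      (Set.Ioi 0).indicator fun z : ℝ => Real.exp (-κ * |z|) := by
    funext z
    simp [Geometry.kerPlus, Set.indicator_apply]
  have h : MemLp (fun z : ℝ => Real.exp (-κ * |z|)) 2 volume := by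
    rw [memLp_two_iff_integrable_sq (by fun_prop)]
    have h2 : (fun z : ℝ => Real.exp (-κ * |z|) ^ 2) = fun z => Real.exp (-(2 * κ) * |z|) := by
      funext z
      rw [← Real.exp_nat_mul]
      congr 1
      push_cast
      ring
    rw [h2]
    rw [← integrableOn_univ, ← Set.Iic_union_Ioi (a := (0 : ℝ))]
    refine IntegrableOn.union ?_ ?_
    · refine (integrableOn_exp_mul_Iic (a := 2 * κ) (by positivity) 0).congr_fun ?_
        measurableSet_Iic
      intro z hz
      simp [abs_of_nonpos (Set.mem_Iic.1 hz)]
    · refine (integrableOn_exp_mul_Ioi (a := -(2 * κ)) (by linarith) 0).congr_fun ?_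
        measurableSet_Ioi
      intro z hz
      simp [abs_of_pos (Set.mem_Ioi.1 hz)]
  refine ⟨memLp_convKernel ?_ q, memLp_convKernel ?_ q⟩
  · rw [e1]; exact h.indicator measurableSet_Iio
  · rw [e2]; exact h.indicator measurableSet_Ioi

theorem memLp_resolventKernel_circle {κ : ℝ} (hκ : 0 < κ) (q : L2 UnitAddCircle) :
    MemLp (Function.uncurry fun x y : UnitAddCircle => Geometry.kerMinus κ (x - y) * q y) 2
        ((volume : Measure UnitAddCircle).prod volume) ∧
      MemLp (Function.uncurry fun x y : UnitAddCircle => Geometry.kerPlus κ (x - y) * q y) 2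
        ((volume : Measure UnitAddCircle).prod volume) := by
  have key : ∀ f : ℝ → ℝ, (hf : Function.Periodic f 1) → Measurable f → (∃ C, ∀ t, |f t| ≤ C) →
      MemLp (hf.lift : UnitAddCircle → ℝ) 2 volume := by
    intro f hf hm ⟨C, hC⟩
    have hm' : Measurable (hf.lift : UnitAddCircle → ℝ) := by
      have : (hf.lift : UnitAddCircle → ℝ) =
          fun x => f (AddCircle.measurableEquivIco 1 0 x : ℝ) := by
        funext x
        conv_lhs => rw [← (AddCircle.equivIco 1 0).symm_apply_apply x]
        rfl
      rw [this]
      exact hm.comp (measurable_subtype_coe.comp (AddCircle.measurableEquivIco 1 0).measurable)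
    refine MemLp.of_bound hm'.aestronglyMeasurable C (Eventually.of_forall fun x => ?_)
    induction x using QuotientAddGroup.induction_on with
    | H t => exact hC t
  have hpos : 0 < 1 - Real.exp (-κ) := by
    have : Real.exp (-κ) < 1 := by rw [Real.exp_lt_one_iff]; linarith
    linarith
  have bound : ∀ s : ℝ, s ≤ 0 → |Real.exp s / (1 - Real.exp (-κ))| ≤ 1 / (1 - Real.exp (-κ)) := by
    intro s hs
    rw [abs_of_nonneg (by positivity)]
    gcongr
    exact Real.exp_le_one_iff.2 hs
  refine ⟨memLp_convKernel ?_ q, memLp_convKernel ?_ q⟩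
  · refine key _ (periodic_kerMinus κ) (by fun_prop) ⟨_, fun t => bound _ ?_⟩
    nlinarith [Int.le_ceil t]
  · refine key _ (periodic_kerPlus κ) (by fun_prop) ⟨_, fun t => bound _ ?_⟩
    nlinarith [Int.floor_le t]

/-- The set `B_{δ,κ} = {q ∈ L² : κ^{-1/2} ‖q‖_{L²} ≤ δ}`. -/
def smallBall (X : Type) [MeasureSpace X] (δ κ : ℝ) : Set (L2 X) :=
  {q | κ ^ (-(1 / 2) : ℝ) * ‖q‖ ≤ δ}

/-! ## Derivatives, mass and energy -/

section Calculus

variable {X : Type} [AddCommGroup X] [TopologicalSpace X] [MeasureSpace X] [Geometry X]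

/-- The classical derivative of a function on `X`. -/
def xDeriv (φ : X → ℝ) (x : X) : ℝ := deriv (fun t : ℝ => φ (x + Geometry.proj t)) 0

/-- Test functions: `C^∞` functions of compact support (a void condition on the circle). -/
def IsTest (φ : X → ℝ) : Prop :=
  ContDiff ℝ ∞ (fun t : ℝ => φ (Geometry.proj t)) ∧ HasCompactSupport φ

/-- `u ∈ H¹(X)` with weak derivative `v`, that is `u, v ∈ L²` and `∫ u φ' = - ∫ v φ` for all test
functions `φ`. -/
def HasWeakDeriv (u v : X → ℝ) : Prop :=
  MemLp u 2 volume ∧ MemLp v 2 volume ∧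
    ∀ φ : X → ℝ, IsTest φ → ∫ x, u x * xDeriv φ x = -∫ x, v x * φ x

/-- The mass `M(q) = ½ ∫ q²`. -/
def mass (φ : X → ℝ) : ℝ := 1 / 2 * ∫ x, φ x ^ 2

/-- The energy `H_mKdV(q) = ½ ∫ (q')² + μ q⁴`. -/
def energy (μ : ℝ) (φ : X → ℝ) : ℝ := 1 / 2 * ∫ x, (xDeriv φ x ^ 2 + μ * φ x ^ 4)

/-- `φ = δF/δq` at `q`: the functional `F` is (Fréchet) differentiable at `q ∈ L²`, and
`dF|_q(f) = ∫ φ f` for all `f ∈ L²`, where `φ ∈ L²`.  This determines `φ` almost everywhere. -/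
def HasFunctionalDeriv (F : L2 X → ℝ) (φ : X → ℝ) (q : L2 X) : Prop :=
  MemLp φ 2 volume ∧ ∃ D : L2 X →L[ℝ] ℝ, HasFDerivAt F D q ∧ ∀ f : L2 X, D f = ∫ x, φ x * f x

/-- The Poisson bracket `{F, G}(q) = ∫ (δF/δq) (δG/δq)' dx` exists and is equal to `c`: both
functional derivatives exist, `δG/δq` lies in `H¹`, and the integral is `c`. -/
def HasPoissonBracket (F G : L2 X → ℝ) (q : L2 X) (c : ℝ) : Prop :=
  ∃ φ ψ ψ' : X → ℝ, HasFunctionalDeriv F φ q ∧ HasFunctionalDeriv G ψ q ∧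
    HasWeakDeriv ψ ψ' ∧ ∫ x, φ x * ψ' x = c

/-! ## The Lax operator, its Green's function, and `r(κ)` -/

/-- `u ∈ H¹ × H¹` and `L_q(κ) u = f`, where `L_q(κ)` is the matrix operator with rows
`(κ - ∂, q)` and `(-μ q, κ + ∂)`, an unbounded operator on `L² × L²` with domain `H¹ × H¹`. -/
def LaxEquation (μ κ : ℝ) (q : L2 X) (u f : Fin 2 → L2 X) : Prop :=
  ∃ u' : Fin 2 → X → ℝ, (∀ i, HasWeakDeriv (u i) (u' i)) ∧
    (∀ᵐ x, f 0 x = κ * u 0 x - u' 0 x + q x * u 1 x) ∧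
    (∀ᵐ x, f 1 x = -μ * q x * u 0 x + κ * u 1 x + u' 1 x)

/-- The Green's function `G₀(x, y; κ)` of the free operator `L₀(κ)`. -/
def freeGreen (κ : ℝ) (x y : X) : Matrix (Fin 2) (Fin 2) ℝ :=
  !![Geometry.kerMinus κ (x - y), 0; 0, Geometry.kerPlus κ (x - y)]

/-- `G` is the Green's function of `L_q(κ)`: the operator `L_q(κ) : H¹ × H¹ → L² × L²` is
bijective, its inverse is the integral operator with the matrix kernel `G(x, y)`, and `G` is
normalized by the continuity of `G - G₀`.  There is at most one such `G`. -/
structure IsGreenFunction (μ κ : ℝ) (q : L2 X) (G : X → X → Matrix (Fin 2) (Fin 2) ℝ) :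
    Prop where
  continuous_sub : ∀ i j, Continuous fun z : X × X => G z.1 z.2 i j - freeGreen κ z.1 z.2 i j
  surjective : ∀ f : Fin 2 → L2 X, ∃ u, LaxEquation μ κ q u f
  kernel : ∀ u f : Fin 2 → L2 X, LaxEquation μ κ q u f → ∀ i, ∀ᵐ x,
    (∀ j, Integrable (fun y => G x y i j * f j y)) ∧ u i x = ∑ j, ∫ y, G x y i j * f j y

/-- `r(x; κ) = ℓ(κ) [G₂₁(x, x; κ) - μ G₁₂(x, x; κ)]`. -/
def rVar (μ κ : ℝ) (G : X → X → Matrix (Fin 2) (Fin 2) ℝ) (x : X) : ℝ :=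
  Geometry.ell X κ * (G x x 1 0 - μ * G x x 0 1)

end Calculus

end MKdV

end

open MKdV

/-! Write `D = (κ+∂)⁻¹`, `D' = (κ-∂)⁻¹`, `P = D q`, `P' = D' q`, `Λ = P'P`, so that `A` is formally
`ℓ log det(1 + μΛ)`. Let `R = (1 + μP'P)⁻¹` and `S = (1 + μPP')⁻¹`, let `k`, `k'` be the kernels of
`D`, `D'`, and put `v_x = k(x - ·)`, `v'_x = k'(x - ·)`. Then `Pf(x) = ⟨q v_x, f⟩`, and `x ↦ q v_x`
is continuous into `L²` with `∫ ‖q v_x‖² dx ≤ (2/κ)‖q‖²`. Hence `P` and `P'` are Hilbert–Schmidt,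
`‖Λ‖ ≤ (2/κ)‖q‖²`, and for `δ = 1/4` all the series are dominated by geometric ones.

Derivative. Parseval under the integral sign gives `tr(D'q₁ D q₂ T) = ∫ q₁(x) ⟨q₂ v_x, T v_x⟩ dx`
(`opTrace_eq`), a bounded trilinear expression. By cyclicity the derivative of `tr Λ^m / m` in the
direction `f` is `tr(dΛ(f) Λ^(m-1))`, and summation yields `μℓ tr(dΛ(f) R)`. Eliminating one
component of `L_q u = f` expresses the Green's function through `R` and `S` (`isGreenFunction`); on
the diagonal `G₂₁ = μ⟨q v_x, R v_x⟩` and `G₁₂ = -⟨q v'_x, S v'_x⟩`, which are the two halves of the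
gradient.

Commutation. Put `t = ℓ⟨q v_x, R v_x⟩`, `t' = ℓ⟨q v'_x, S v'_x⟩`, `u = ℓ⟨q v'_x, P R v_x⟩`. These
satisfy the closed system `∂t = q(1 - 2μu) - 2κt`, `∂t' = -q(1 - 2μu) + 2κt'`, `∂u = q(t' - t)`
(`prim_diagT`, `prim_diagU`). The factor `ℓ` enters because `ℓk²` is the resolvent kernel at `2κ`.
Put `r = μ(t + t')` and `s = μ(t - t')`, and let a tilde mark the same functions for a second
parameter `ϰ`. The derivatives of `r r̃` and of `s s̃ + 2u + 2ũ - 4μuũ` are then combinations of `s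
r̃` and `r s̃` alone. Integration gives a homogeneous 2×2 linear system for `∫ s r̃` and `∫ r s̃`,
with determinant `±(κ² - ϰ²)`; for `κ = ϰ` the first identity suffices.

Expansion. For bounded `q` one has `‖Λ‖ ≤ B²/κ²`, so the terms `m ≥ 3` are `O(κ⁻⁵)`. The first trace
is `∫ q (2κ+∂)⁻¹ q`, expanded by iterating the resolvent equation. For the second, the differential
equations give `ℓ tr Λ² = 2∫ w q u₁`, where `w = (2κ-∂)⁻¹q` and `u₁` is `u` with `R = 1`.
Multiplicativity of the exponential gives `u₁ = w · (2κ+∂)⁻¹q` exactly on the line and up to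
`O(κ⁻⁴)` on the circle; the leading term is then `∫ q⁴`, and the next order is a total derivative.

The line and the circle are treated together: their kernels are the images of `e^{-κt} dt` on a
half-line under the covering map. Derivatives are encoded by integrated identities (`Prim`), since
`q` is only in `L²`. -/

noncomputable section

set_option linter.unusedSectionVars false

namespace MKdV

/-! ## Primitives of locally integrable functions -/

section Prim

/-- `u` is a primitive of the locally integrable function `v`. -/
def Prim (u v : ℝ → ℝ) : Prop :=
  ∀ a b, IntervalIntegrable v volume a b ∧ u b - u a = ∫ s in a..b, v s

theorem Prim.intervalIntegrable {u v : ℝ → ℝ} (h : Prim u v) (a b : ℝ) :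
    IntervalIntegrable v volume a b := (h a b).1

theorem Prim.sub_eq {u v : ℝ → ℝ} (h : Prim u v) (a b : ℝ) : u b - u a = ∫ s in a..b, v s :=
  (h a b).2

theorem Prim.of_le {u v : ℝ → ℝ}
    (h : ∀ a b, a ≤ b → IntervalIntegrable v volume a b ∧ u b - u a = ∫ s in a..b, v s) :
    Prim u v := by
  intro a b
  rcases le_total a b with hab | hab
  · exact h a b hab
  · obtain ⟨h1, h2⟩ := h b a hab
    refine ⟨h1.symm, ?_⟩
    rw [intervalIntegral.integral_symm, ← h2]
    ring

theorem Prim.continuous {u v : ℝ → ℝ} (h : Prim u v) : Continuous u := by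
  have : u = fun b => u 0 + ∫ s in (0 : ℝ)..b, v s := by
    funext b
    rw [← (h 0 b).2]
    ring
  rw [this]
  exact continuous_const.add
    (intervalIntegral.continuous_primitive (fun a b => (h a b).1) 0)

theorem Prim.of_hasDerivAt {u v : ℝ → ℝ} (h : ∀ x, HasDerivAt u (v x) x) (hv : Continuous v) :
    Prim u v := fun a b =>
  ⟨hv.intervalIntegrable a b,
    (intervalIntegral.integral_eq_sub_of_hasDerivAt (fun x _ => h x)
      (hv.intervalIntegrable a b)).symm⟩

theorem Prim.add {u v u' v' : ℝ → ℝ} (h : Prim u v) (h' : Prim u' v') :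
    Prim (fun s => u s + u' s) (fun s => v s + v' s) := fun a b =>
  ⟨(h a b).1.add (h' a b).1, by
    rw [intervalIntegral.integral_add (h a b).1 (h' a b).1, ← (h a b).2, ← (h' a b).2]; ring⟩

theorem Prim.const_mul {u v : ℝ → ℝ} (h : Prim u v) (c : ℝ) :
    Prim (fun s => c * u s) (fun s => c * v s) := fun a b =>
  ⟨(h a b).1.const_mul c, by
    rw [intervalIntegral.integral_const_mul, ← (h a b).2]; ring⟩

theorem Prim.congr {u v u' v' : ℝ → ℝ} (h : Prim u v) (hu : ∀ s, u' s = u s)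
    (hv : ∀ s, v' s = v s) : Prim u' v' := by
  rwa [show u' = u from funext hu, show v' = v from funext hv]

theorem Prim.comp_neg {u v : ℝ → ℝ} (h : Prim u v) :
    Prim (fun s => u (-s)) (fun s => -v (-s)) := fun a b => by
  refine ⟨?_, ?_⟩
  · have := ((h (-a) (-b)).1).comp_sub_left 0
    rw [zero_sub, zero_sub, neg_neg, neg_neg] at this
    simp only [zero_sub] at this
    exact this.neg
  · rw [intervalIntegral.integral_neg, intervalIntegral.integral_comp_neg,
      intervalIntegral.integral_symm, ← (h _ _).2]
    ring

/-- A function whose increments are infinitesimal with respect to an integrable density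
is constant. -/
theorem eq_of_abs_sub_le_integral {F g : ℝ → ℝ} {a b : ℝ} (hab : a ≤ b)
    (hg : ∀ s t, IntervalIntegrable g volume s t)
    (h : ∀ ε > 0, ∃ η > 0, ∀ s t, a ≤ s → s ≤ t → t ≤ b → t - s < η →
      |F t - F s| ≤ ε * ∫ x in s..t, g x) : F b = F a := by
  have key : ∀ ε > 0, |F b - F a| ≤ ε * ∫ x in a..b, g x := by
    intro ε hε
    obtain ⟨η, hη, H⟩ := h ε hε
    obtain ⟨N, hN⟩ := exists_nat_gt ((b - a) / η)
    have hN0 : (0 : ℝ) < N := lt_of_le_of_lt (div_nonneg (by linarith) hη.le) hN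
    have hstep : (b - a) / N < η := by
      rw [div_lt_iff₀ hN0]
      rw [div_lt_iff₀ hη] at hN
      linarith
    have hd : 0 ≤ (b - a) / N := div_nonneg (by linarith) hN0.le
    let x : ℕ → ℝ := fun i => a + i * ((b - a) / N)
    have hx0 : x 0 = a := by simp [x]
    have hxN : x N = b := by simp only [x]; field_simp; ring
    have hle : ∀ i, x i ≤ x (i + 1) := fun i => by
      simp only [x]; push_cast; nlinarith
    have hmono : Monotone x := monotone_nat_of_le_succ hle
    have e1 : F b - F a = ∑ i ∈ Finset.range N, (F (x (i + 1)) - F (x i)) := by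
      rw [Finset.sum_range_sub (fun i => F (x i)), hx0, hxN]
    have e2 : ∫ x in a..b, g x = ∑ i ∈ Finset.range N, ∫ y in x i..x (i + 1), g y := by
      rw [intervalIntegral.sum_integral_adjacent_intervals (fun k _ => hg _ _), hx0, hxN]
    rw [e1, e2, Finset.mul_sum]
    refine (Finset.abs_sum_le_sum_abs _ _).trans (Finset.sum_le_sum fun i hi => ?_)
    have hi' : i + 1 ≤ N := Finset.mem_range.1 hi
    refine H _ _ ?_ (hle i) ?_ ?_
    · rw [← hx0]; exact hmono (Nat.zero_le _)
    · rw [← hxN]; exact hmono hi'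
    · have : x (i + 1) - x i = (b - a) / N := by simp only [x]; push_cast; ring
      rw [this]; exact hstep
  have h0 : |F b - F a| ≤ 0 := by
    refine le_of_forall_pos_le_add fun δ hδ => ?_
    have hpos : 0 < |∫ x in a..b, g x| + 1 := by positivity
    -- The added `1` keeps the denominator positive when the integral vanishes.
    have := key (δ / (|∫ x in a..b, g x| + 1)) (by positivity)
    refine this.trans ?_
    rw [zero_add, div_mul_eq_mul_div, div_le_iff₀ hpos]
    nlinarith [le_abs_self (∫ x in a..b, g x)]
  have := abs_nonpos_iff.1 h0
  linarith

theorem exists_modulus {A : ℝ → ℝ → ℝ} (hA : Continuous fun z : ℝ × ℝ => A z.1 z.2) (a b : ℝ)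
    {ε : ℝ} (hε : 0 < ε) : ∃ η > 0, ∀ s t s' t', s ∈ Set.Icc a b → t ∈ Set.Icc a b →
      s' ∈ Set.Icc a b → t' ∈ Set.Icc a b → |s - s'| < η → |t - t'| < η →
      |A s t - A s' t'| ≤ ε := by
  have hK : IsCompact (Set.Icc a b ×ˢ Set.Icc a b) := isCompact_Icc.prod isCompact_Icc
  have hu := hK.uniformContinuousOn_of_continuous hA.continuousOn
  obtain ⟨η, hη, H⟩ := Metric.uniformContinuousOn_iff.1 hu ε hε
  refine ⟨η, hη, fun s t s' t' hs ht hs' ht' h1 h2 => ?_⟩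
  have := H (s, t) ⟨hs, ht⟩ (s', t') ⟨hs', ht'⟩ (by
    rw [Prod.dist_eq, max_lt_iff, Real.dist_eq, Real.dist_eq]; exact ⟨h1, h2⟩)
  rw [Real.dist_eq] at this
  exact this.le

theorem continuous_diag {A : ℝ → ℝ → ℝ} (hA : Continuous fun z : ℝ × ℝ => A z.1 z.2) :
    Continuous fun s => A s s := hA.comp (continuous_id.prodMk continuous_id)

/-- The derivative of `Φ` along the diagonal is the sum of its partial derivatives, if these
are continuous up to locally integrable factors. -/
theorem Prim.diag {Φ A B A' B' : ℝ → ℝ → ℝ} {c c' : ℝ → ℝ}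
    (hc : ∀ a b, IntervalIntegrable c volume a b) (hc' : ∀ a b, IntervalIntegrable c' volume a b)
    (hA : Continuous fun z : ℝ × ℝ => A z.1 z.2) (hB : Continuous fun z : ℝ × ℝ => B z.1 z.2)
    (hA' : Continuous fun z : ℝ × ℝ => A' z.1 z.2) (hB' : Continuous fun z : ℝ × ℝ => B' z.1 z.2)
    (h1 : ∀ x, Prim (fun y => Φ y x) fun y => c y * A y x + B y x)
    (h2 : ∀ y, Prim (fun x => Φ y x) fun x => c' x * A' y x + B' y x) :
    Prim (fun x => Φ x x) fun x => (c x * A x x + B x x) + (c' x * A' x x + B' x x) := by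
  have hmul : ∀ {f g : ℝ → ℝ}, (∀ a b, IntervalIntegrable f volume a b) → Continuous g →
      ∀ a b, IntervalIntegrable (fun x => f x * g x) volume a b :=
    fun hf hg a b => (hf a b).mul_continuousOn hg.continuousOn
  have hd : ∀ a b, IntervalIntegrable
      (fun x => (c x * A x x + B x x) + (c' x * A' x x + B' x x)) volume a b := fun a b =>
    ((hmul hc (continuous_diag hA) a b).add ((continuous_diag hB).intervalIntegrable a b)).add
      ((hmul hc' (continuous_diag hA') a b).add ((continuous_diag hB').intervalIntegrable a b))
  refine Prim.of_le fun a b hab => ⟨hd a b, ?_⟩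
  set d : ℝ → ℝ := fun x => (c x * A x x + B x x) + (c' x * A' x x + B' x x) with hd_def
  let F : ℝ → ℝ := fun t => Φ t t - ∫ s in a..t, d s
  -- The density dominating the errors: `|c|` and `|c'|` weigh the oscillations of `A` and `A'`, the
  -- constants `1` those of `B` and `B'`.
  let g : ℝ → ℝ := fun s => (|c s| + 1) + (|c' s| + 1)
  have hg : ∀ s t, IntervalIntegrable g volume s t := fun s t =>
    ((hc s t).abs.add intervalIntegrable_const).add ((hc' s t).abs.add intervalIntegrable_const)
  suffices h : F b = F a by
    simp only [F, intervalIntegral.integral_same] at h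
    linarith
  refine eq_of_abs_sub_le_integral hab hg fun ε hε => ?_
  obtain ⟨η1, hη1, H1⟩ := exists_modulus hA a b hε
  obtain ⟨η2, hη2, H2⟩ := exists_modulus hB a b hε
  obtain ⟨η3, hη3, H3⟩ := exists_modulus hA' a b hε
  obtain ⟨η4, hη4, H4⟩ := exists_modulus hB' a b hε
  refine ⟨min (min η1 η2) (min η3 η4), by positivity, fun s t has hst htb hlt => ?_⟩
  simp only [lt_min_iff] at hlt
  obtain ⟨⟨l1, l2⟩, l3, l4⟩ := hlt
  -- Pass from `(s, s)` to `(t, t)` along two sides of a square, first in the second variable and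
  -- then in the first. The integrands differ from the diagonal one by increments of the
  -- coefficients over a distance at most `t - s`.
  have e : F t - F s = ∫ x in s..t, ((c x * (A x t - A x x) + (B x t - B x x)) +
      (c' x * (A' s x - A' x x) + (B' s x - B' x x))) := by
    have i1 := (h1 t s t)
    have i2 := (h2 s s t)
    have : F t - F s = (Φ t t - Φ s t) + (Φ s t - Φ s s) - ∫ x in s..t, d x := by
      have := intervalIntegral.integral_add_adjacent_intervals (hd a s) (hd s t)
      simp only [F]
      linarith
    rw [this, i1.2, i2.2, ← intervalIntegral.integral_add i1.1 i2.1,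
      ← intervalIntegral.integral_sub (i1.1.add i2.1) (hd s t)]
    congr 1
    funext x
    simp only [hd_def]
    ring
  rw [e, ← intervalIntegral.integral_const_mul, ← Real.norm_eq_abs]
  refine intervalIntegral.norm_integral_le_of_norm_le hst ?_ ((hg s t).const_mul ε)
  refine Eventually.of_forall fun x hx => ?_
  have hxI : x ∈ Set.Icc a b := ⟨by linarith [hx.1], by linarith [hx.2]⟩
  have hsI : s ∈ Set.Icc a b := ⟨has, hst.trans htb⟩
  have htI : t ∈ Set.Icc a b := ⟨has.trans hst, htb⟩
  have d1 : |t - x| ≤ t - s := by rw [abs_of_nonneg (by linarith [hx.2])]; linarith [hx.1]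
  have d2 : |s - x| ≤ t - s := by
    rw [abs_sub_comm, abs_of_nonneg (by linarith [hx.1])]; linarith [hx.2]
  have d0 : ∀ η > (0 : ℝ), |x - x| < η := fun η hη => by simpa using hη
  have b1 := H1 x t x x hxI htI hxI hxI (d0 _ hη1) (d1.trans_lt l1)
  have b2 := H2 x t x x hxI htI hxI hxI (d0 _ hη2) (d1.trans_lt l2)
  have b3 := H3 s x x x hsI hxI hxI hxI (d2.trans_lt l3) (d0 _ hη3)
  have b4 := H4 s x x x hsI hxI hxI hxI (d2.trans_lt l4) (d0 _ hη4)
  rw [Real.norm_eq_abs]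
  refine (abs_add_le _ _).trans ?_
  refine (add_le_add (abs_add_le _ _) (abs_add_le _ _)).trans ?_
  rw [abs_mul, abs_mul]
  have m1 := mul_le_mul_of_nonneg_left b1 (abs_nonneg (c x))
  have m2 := mul_le_mul_of_nonneg_left b3 (abs_nonneg (c' x))
  simp only [g]
  linarith

/-- The diagonal rule for `Φ y x = u y * u' x`; no differentiability at points is needed. -/
theorem Prim.mul {u v u' v' : ℝ → ℝ} (h : Prim u v) (h' : Prim u' v') :
    Prim (fun s => u s * u' s) (fun s => v s * u' s + v' s * u s) := by
  refine (Prim.diag (Φ := fun y x => u y * u' x) (c := v) (c' := v') (A := fun _ x => u' x)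
    (A' := fun y _ => u y) (B := fun _ _ => 0) (B' := fun _ _ => 0)
    h.intervalIntegrable h'.intervalIntegrable (h'.continuous.comp continuous_snd)
    continuous_const (h.continuous.comp continuous_fst) continuous_const ?_ ?_).congr
    (fun _ => rfl) (fun _ => by ring)
  · exact fun x => (h.const_mul (u' x)).congr (fun _ => by ring) fun _ => by ring
  · exact fun y => (h'.const_mul (u y)).congr (fun _ => by ring) fun _ => by ring

theorem prim_exp (c : ℝ) : Prim (fun s => Real.exp (c * s)) (fun s => c * Real.exp (c * s)) := by
  refine Prim.of_hasDerivAt (fun x => ?_) (by fun_prop)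
  have := ((hasDerivAt_id x).const_mul c).exp
  simpa [mul_comm] using this

/-- A bounded solution of `w' = c w`, `c ≠ 0`, vanishes. -/
theorem Prim.eq_zero_of_bounded {w : ℝ → ℝ} {c C : ℝ} (h : Prim w fun s => c * w s) (hc : c ≠ 0)
    (hb : ∀ s, |w s| ≤ C) (s : ℝ) : w s = 0 := by
  have hp : ∀ t, Real.exp (-c * t) * w t = Real.exp (-c * s) * w s := by
    intro t
    have := (((prim_exp (-c)).mul h) s t).2
    refine (sub_eq_iff_eq_add.1 this).trans ?_
    have : ∀ x : ℝ, -c * Real.exp (-c * x) * w x + c * w x * Real.exp (-c * x) = 0 :=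
      fun x => by ring
    simp only [this]
    simp
  set K := Real.exp (-c * s) * w s with hK
  have hw : ∀ t, |K| ≤ Real.exp (-c * t) * C := fun t => by
    rw [← hp t, abs_mul, abs_of_pos (Real.exp_pos _)]
    exact mul_le_mul_of_nonneg_left (hb t) (Real.exp_pos _).le
  have hlim : Tendsto (fun r : ℝ => Real.exp (-r) * C) atTop (𝓝 0) := by
    simpa using (Real.tendsto_exp_neg_atTop_nhds_zero).mul_const C
  have hK0 : |K| ≤ 0 := by
    refine ge_of_tendsto' hlim fun r => ?_
    -- Moving along `r / c` makes the factor equal to `e^{-r}` for either sign of `c`.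
    have := hw (r / c)
    rwa [show -c * (r / c) = -r by field_simp] at this
  have hK1 : K = 0 := abs_nonpos_iff.1 hK0
  rw [hK] at hK1
  exact (mul_eq_zero.1 hK1).resolve_left (Real.exp_pos _).ne'

/-- The bounded solution of `u' + κ u = φ`. -/
theorem prim_halfLine {φ : ℝ → ℝ} {κ : ℝ}
    (h : ∀ s, IntegrableOn (fun t => Real.exp (-κ * t) * φ (s - t)) (Set.Ioi 0)) :
    Prim (fun s => ∫ t in Set.Ioi 0, Real.exp (-κ * t) * φ (s - t))
      (fun s => φ s - κ * ∫ t in Set.Ioi 0, Real.exp (-κ * t) * φ (s - t)) := by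
  -- After `τ = s - t` the integral is `e^{-κs}` times the primitive of `ψ` from `-∞`, so the
  -- product rule applies.
  let ψ : ℝ → ℝ := fun τ => Real.exp (κ * τ) * φ τ
  have hpre : ∀ s : ℝ, (fun x : ℝ => s - x) ⁻¹' Set.Iio s = Set.Ioi 0 := fun s => by
    ext x; simp
  have e0 : ∀ s t, Real.exp (-κ * t) * φ (s - t) = Real.exp (-κ * s) * ψ (s - t) := by
    intro s t
    simp only [ψ]
    rw [← mul_assoc, ← Real.exp_add]
    congr 2
    ring
  have hmp : ∀ s : ℝ, MeasurePreserving (fun x : ℝ => s - x) volume volume :=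
    fun s => Measure.measurePreserving_sub_left volume s
  have hme : ∀ s : ℝ, MeasurableEmbedding (fun x : ℝ => s - x) :=
    fun s => (MeasurableEquiv.subLeft s).measurableEmbedding
  have hψ : ∀ s, IntegrableOn ψ (Set.Iic s) := by
    intro s
    rw [integrableOn_Iic_iff_integrableOn_Iio, ← (hmp s).integrableOn_comp_preimage (hme s),
      hpre s]
    have := (h s).const_mul (Real.exp (κ * s))
    refine IntegrableOn.congr_fun this (fun t _ => ?_) measurableSet_Ioi
    simp only [Function.comp]
    rw [e0, ← mul_assoc, ← Real.exp_add]
    simp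
  have hu : ∀ s, ∫ t in Set.Ioi 0, Real.exp (-κ * t) * φ (s - t) =
      Real.exp (-κ * s) * ∫ τ in Set.Iic s, ψ τ := by
    intro s
    simp_rw [e0 s]
    rw [integral_const_mul, integral_Iic_eq_integral_Iio,
      ← (hmp s).setIntegral_preimage_emb (hme s) ψ (Set.Iio s), hpre s]
  have hW : Prim (fun s => ∫ τ in Set.Iic s, ψ τ) ψ := by
    refine Prim.of_le fun a b hab => ⟨?_, ?_⟩
    · exact (intervalIntegrable_iff_integrableOn_Ioc_of_le hab).2
        ((hψ b).mono_set Set.Ioc_subset_Iic_self)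
    · exact intervalIntegral.integral_Iic_sub_Iic (hψ a) (hψ b)
  refine ((prim_exp (-κ)).mul hW).congr hu fun s => ?_
  rw [hu]
  simp only [ψ]
  have : Real.exp (κ * s) * Real.exp (-κ * s) = 1 := by rw [← Real.exp_add]; simp
  linear_combination (-φ s) * this

end Prim

/-! ## Resolvent kernels -/

section Kernel

variable {X : Type} [AddCommGroup X] [TopologicalSpace X] [MeasureSpace X] [Geometry X]

/-- `k` is the convolution kernel of `(κ + ε ∂)⁻¹`, where `ε = ±1`. -/
structure IsResolventKernel (κ ε : ℝ) (k : X → ℝ) : Prop where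
  one_le : 1 ≤ κ
  eps : ε = 1 ∨ ε = -1
  measurable : Measurable k
  nonneg : ∀ z, 0 ≤ k z
  le_two : ∀ z, k z ≤ 2
  continuousAt : ∀ z, z ≠ 0 → ContinuousAt k z
  lintegral_mul : ∀ h : X → ℝ≥0∞, Measurable h → ∫⁻ z, ENNReal.ofReal (k z) * h z =
    ∫⁻ t in Set.Ioi (0 : ℝ), ENNReal.ofReal (Real.exp (-κ * t)) * h (Geometry.proj (ε * t))

variable (X) in
/-- The properties of the line and of the circle on which the argument rests. -/
class RegularGeometry : Prop where
  proj_add : ∀ s t : ℝ, (Geometry.proj (s + t) : X) = Geometry.proj s + Geometry.proj t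
  continuous_proj : Continuous (Geometry.proj : ℝ → X)
  continuous_of_comp_proj : ∀ φ : X → ℝ,
    Continuous (fun t : ℝ => φ (Geometry.proj t)) → Continuous φ
  surjective_proj : Function.Surjective (Geometry.proj : ℝ → X)
  volume_zero : (volume : Measure X) {0} = 0
  kerMinus_eq : ∀ (κ : ℝ) (z : X), Geometry.kerMinus κ z = Geometry.kerPlus κ (-z)
  kerPlus : ∀ κ : ℝ, 1 ≤ κ → IsResolventKernel κ 1 (Geometry.kerPlus κ : X → ℝ)
  ell_mul_sq : ∀ κ : ℝ, 1 ≤ κ → ∀ z : X,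
    Geometry.ell X κ * Geometry.kerPlus κ z ^ 2 = Geometry.kerPlus (2 * κ) z
  ell_mem : ∀ κ : ℝ, 1 ≤ κ → Geometry.ell X κ ∈ Set.Icc (1 / 4 : ℝ) 1
  kerPlus_add : ∃ C : ℝ, ∀ κ : ℝ, 1 ≤ κ → ∀ u v : X,
    |Geometry.kerPlus κ u * Geometry.kerPlus κ v * (Geometry.kerPlus κ (u + v) -
      Geometry.ell X κ * Geometry.kerPlus κ u * Geometry.kerPlus κ v)| ≤ C / κ ^ 4
  ae_eq_zero_of_test : ∀ v : X → ℝ, MemLp v 2 volume →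
    (∀ φ, IsTest φ → ∫ x, v x * φ x = 0) → v =ᵐ[volume] 0
  contDiff_of_isSchwartz : ∀ φ : X → ℝ, Geometry.IsSchwartz φ →
    ContDiff ℝ ∞ fun t : ℝ => φ (Geometry.proj t)
  integrable_of_isSchwartz : ∀ φ : X → ℝ, Geometry.IsSchwartz φ → Integrable φ
  bounded_of_isSchwartz : ∀ φ : X → ℝ, Geometry.IsSchwartz φ → ∃ C, ∀ x, |φ x| ≤ C
  isSchwartz_xDeriv : ∀ φ : X → ℝ, Geometry.IsSchwartz φ → Geometry.IsSchwartz (xDeriv φ)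
  isSchwartz_mul : ∀ φ ψ : X → ℝ, Geometry.IsSchwartz φ → Geometry.IsSchwartz ψ →
    Geometry.IsSchwartz fun x => φ x * ψ x

end Kernel

section

variable {X : Type} [AddCommGroup X] [TopologicalSpace X] [IsTopologicalAddGroup X]
  [T2Space X] [LocallyCompactSpace X] [SecondCountableTopology X] [MeasureSpace X] [BorelSpace X]
  [(volume : Measure X).IsAddHaarMeasure] [Geometry X] [RegularGeometry X]

theorem proj_zero : (Geometry.proj 0 : X) = 0 := by
  have := RegularGeometry.proj_add (X := X) 0 0
  simpa using this

theorem proj_neg (t : ℝ) : (Geometry.proj (-t) : X) = -Geometry.proj t := by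
  have := RegularGeometry.proj_add (X := X) (-t) t
  rw [neg_add_cancel, proj_zero] at this
  exact eq_neg_of_add_eq_zero_left this.symm

theorem proj_sub (s t : ℝ) : (Geometry.proj (s - t) : X) = Geometry.proj s - Geometry.proj t := by
  rw [sub_eq_add_neg, RegularGeometry.proj_add, proj_neg, sub_eq_add_neg]

/-- Convolution with the kernel `k`. -/
def conv (k f : X → ℝ) (x : X) : ℝ := ∫ z, k (x - z) * f z

end

section
variable {X : Type} [AddCommGroup X] [TopologicalSpace X] [IsTopologicalAddGroup X]
  [T2Space X] [LocallyCompactSpace X] [SecondCountableTopology X] [MeasureSpace X] [BorelSpace X]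
  [(volume : Measure X).IsAddHaarMeasure] [Geometry X] [RegularGeometry X]

/-! ### Kernel vectors in `L²` and their continuity -/

namespace IsResolventKernel

variable {κ ε : ℝ} {k : X → ℝ}

theorem pos (hk : IsResolventKernel κ ε k) : 0 < κ := lt_of_lt_of_le one_pos hk.one_le

theorem eps_sq (hk : IsResolventKernel κ ε k) : ε * ε = 1 := by
  rcases hk.eps with h | h <;> simp [h]

theorem eps_ne_zero (hk : IsResolventKernel κ ε k) : ε ≠ 0 := by
  rcases hk.eps with h | h <;> simp [h]

/-- The reflected kernel. -/
theorem neg (hk : IsResolventKernel κ ε k) : IsResolventKernel κ (-ε) fun z => k (-z) where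
  one_le := hk.one_le
  eps := by rcases hk.eps with h | h <;> simp [h]
  measurable := hk.measurable.comp measurable_neg
  nonneg z := hk.nonneg _
  le_two z := hk.le_two _
  continuousAt z hz := ContinuousAt.comp (f := fun z : X => -z) (hk.continuousAt (-z)
    (neg_ne_zero.2 hz)) continuous_neg.continuousAt
  lintegral_mul h hh := by
    have := hk.lintegral_mul (fun z => h (-z)) (hh.comp measurable_neg)
    rw [← lintegral_neg_eq_self] at this
    simp only [neg_neg] at this
    rw [this]
    congr 1
    funext t
    rw [neg_mul ε t, proj_neg]

/-- The measure `k(z) dz` is the push-forward of `e^{-κt} dt` on the half-line. Integrals and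
integrability therefore transfer together, with the windings around the circle already summed. -/
theorem map_withDensity (hk : IsResolventKernel κ ε k) :
    (volume : Measure X).withDensity (fun z => ENNReal.ofReal (k z)) =
      ((volume.restrict (Set.Ioi (0 : ℝ))).withDensity
        fun t => ENNReal.ofReal (Real.exp (-κ * t))).map fun t => Geometry.proj (ε * t) := by
  have hm : Measurable fun t : ℝ => (Geometry.proj (ε * t) : X) :=
    (RegularGeometry.continuous_proj.comp (by fun_prop)).measurable
  ext s hs
  rw [Measure.map_apply hm hs, withDensity_apply _ hs, withDensity_apply _ (hm hs),
    ← lintegral_indicator hs, ← lintegral_indicator (hm hs)]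
  have := hk.lintegral_mul (s.indicator 1) (measurable_one.indicator hs)
  refine Eq.trans (lintegral_congr fun z => ?_) (this.trans (lintegral_congr fun t => ?_))
  · by_cases hz : z ∈ s <;> simp [hz]
  · by_cases ht : (Geometry.proj (ε * t) : X) ∈ s <;> simp [ht]

theorem measurable_projMul (ε : ℝ) : Measurable fun t : ℝ => (Geometry.proj (ε * t) : X) :=
  (RegularGeometry.continuous_proj.comp (by fun_prop)).measurable

theorem integral_mul (hk : IsResolventKernel κ ε k) {f : X → ℝ} (hf : Measurable f) :
    ∫ z, k z * f z =
      ∫ t in Set.Ioi (0 : ℝ), Real.exp (-κ * t) * f (Geometry.proj (ε * t)) := by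
  have h1 : ∫ z, f z ∂((volume : Measure X).withDensity fun z => ENNReal.ofReal (k z)) =
      ∫ z, k z * f z := by
    rw [integral_withDensity_eq_integral_toReal_smul hk.measurable.ennreal_ofReal
      (Eventually.of_forall fun _ => ENNReal.ofReal_lt_top)]
    simp [ENNReal.toReal_ofReal (hk.nonneg _)]
  rw [← h1, hk.map_withDensity, integral_map (measurable_projMul ε).aemeasurable
    hf.aestronglyMeasurable, integral_withDensity_eq_integral_toReal_smul (by fun_prop)
      (Eventually.of_forall fun _ => ENNReal.ofReal_lt_top)]
  simp [ENNReal.toReal_ofReal (Real.exp_nonneg _)]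

theorem integrable_mul_iff (hk : IsResolventKernel κ ε k) {f : X → ℝ} (hf : Measurable f) :
    Integrable (fun z => k z * f z) ↔
      IntegrableOn (fun t => Real.exp (-κ * t) * f (Geometry.proj (ε * t))) (Set.Ioi (0 : ℝ)) := by
  have h1 : Integrable f ((volume : Measure X).withDensity fun z => ENNReal.ofReal (k z)) ↔
      Integrable fun z => k z * f z := by
    rw [integrable_withDensity_iff_integrable_smul' hk.measurable.ennreal_ofReal
      (Eventually.of_forall fun _ => ENNReal.ofReal_lt_top)]
    simp [ENNReal.toReal_ofReal (hk.nonneg _)]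
  rw [← h1, hk.map_withDensity, integrable_map_measure hf.aestronglyMeasurable
    (measurable_projMul ε).aemeasurable,
    integrable_withDensity_iff_integrable_smul' (by fun_prop)
      (Eventually.of_forall fun _ => ENNReal.ofReal_lt_top)]
  simp [ENNReal.toReal_ofReal (Real.exp_nonneg _), IntegrableOn]

theorem integrable (hk : IsResolventKernel κ ε k) : Integrable k := by
  have := (hk.integrable_mul_iff (f := fun _ => 1) measurable_const).2 (by
    simpa using integrableOn_exp_mul_Ioi (a := -κ) (by linarith [hk.pos]) 0)
  simpa using this

theorem integral_eq (hk : IsResolventKernel κ ε k) : ∫ z, k z = 1 / κ := by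
  have := hk.integral_mul (f := fun _ => 1) measurable_const
  simp only [mul_one] at this
  rw [this, integral_exp_mul_Ioi (by linarith [hk.pos])]
  simp

theorem integrable_sub (hk : IsResolventKernel κ ε k) (x : X) : Integrable fun z => k (x - z) :=
  hk.integrable.comp_sub_left x

theorem integral_sub (hk : IsResolventKernel κ ε k) (x : X) : ∫ z, k (x - z) = 1 / κ := by
  rw [integral_sub_left_eq_self k volume x, hk.integral_eq]

theorem integral_sub_right (hk : IsResolventKernel κ ε k) (z : X) : ∫ x, k (x - z) = 1 / κ := by
  rw [integral_sub_right_eq_self k, hk.integral_eq]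

theorem abs_le_two (hk : IsResolventKernel κ ε k) (z : X) : |k z| ≤ 2 := by
  rw [abs_of_nonneg (hk.nonneg z)]; exact hk.le_two z

theorem measurable_sub (hk : IsResolventKernel κ ε k) (x : X) : Measurable fun z => k (x - z) :=
  hk.measurable.comp (measurable_const.sub measurable_id)

theorem memLp (hk : IsResolventKernel κ ε k) : MemLp k 2 volume := by
  refine (memLp_two_iff_integrable_sq hk.measurable.aestronglyMeasurable).2 ?_
  refine (hk.integrable.const_mul 2).mono' (hk.measurable.pow_const 2).aestronglyMeasurable ?_
  refine Eventually.of_forall fun z => ?_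
  rw [Real.norm_eq_abs, abs_of_nonneg (by positivity), sq]
  exact mul_le_mul_of_nonneg_right (hk.le_two z) (hk.nonneg z)

theorem integral_sq_le (hk : IsResolventKernel κ ε k) : ∫ z, k z ^ 2 ≤ 2 / κ := by
  calc ∫ z, k z ^ 2 ≤ ∫ z, 2 * k z := by
        refine integral_mono hk.memLp.integrable_sq (hk.integrable.const_mul 2) fun z => ?_
        simp only [sq]
        exact mul_le_mul_of_nonneg_right (hk.le_two z) (hk.nonneg z)
    _ = 2 / κ := by rw [integral_const_mul, hk.integral_eq]; ring

theorem memLp_sub (hk : IsResolventKernel κ ε k) (x : X) :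
    MemLp (fun z => k (x - z)) 2 volume :=
  hk.memLp.comp_measurePreserving (Measure.measurePreserving_sub_left volume x)

theorem memLp_mul (hk : IsResolventKernel κ ε k) {f : X → ℝ} {p : ℝ≥0∞} (hf : MemLp f p volume)
    (x : X) : MemLp (fun z => f z * k (x - z)) p volume := by
  refine (hf.const_mul 2).mono (hf.1.mul (hk.measurable_sub x).aestronglyMeasurable)
    (Eventually.of_forall fun z => ?_)
  rw [norm_mul, norm_mul, mul_comm]
  refine mul_le_mul_of_nonneg_right ?_ (norm_nonneg _)
  simpa using hk.abs_le_two (x - z)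

/-- The function `z ↦ k (x - z)`. -/
def vec (hk : IsResolventKernel κ ε k) (x : X) : L2 X := (hk.memLp_sub x).toLp _

/-- The function `z ↦ q z * k (x - z)`. -/
def mulVec (hk : IsResolventKernel κ ε k) (q : L2 X) (x : X) : L2 X :=
  (hk.memLp_mul (Lp.memLp q) x).toLp _

theorem coeFn_vec (hk : IsResolventKernel κ ε k) (x : X) :
    hk.vec x =ᵐ[volume] fun z => k (x - z) := MemLp.coeFn_toLp _

theorem coeFn_mulVec (hk : IsResolventKernel κ ε k) (q : L2 X) (x : X) :
    hk.mulVec q x =ᵐ[volume] fun z => q z * k (x - z) := MemLp.coeFn_toLp _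

theorem _root_.MKdV.inner_L2 (f g : L2 X) : inner ℝ f g = ∫ z, f z * g z := by
  rw [L2.inner_def]
  refine integral_congr_ae (Eventually.of_forall fun z => ?_)
  simp [mul_comm]

/-- Point values become inner products with a vector of `L²`. This selects a representative defined
at every point, continuous in `x` by `continuous_vec`. -/
theorem inner_vec (hk : IsResolventKernel κ ε k) (x : X) (f : L2 X) :
    inner ℝ (hk.vec x) f = conv k f x := by
  rw [inner_L2]
  refine integral_congr_ae ?_
  filter_upwards [hk.coeFn_vec x] with z hz
  rw [hz]

theorem inner_mulVec (hk : IsResolventKernel κ ε k) (q : L2 X) (x : X) (f : L2 X) :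
    inner ℝ (hk.mulVec q x) f = conv k (fun z => q z * f z) x := by
  rw [inner_L2]
  refine integral_congr_ae ?_
  filter_upwards [hk.coeFn_mulVec q x] with z hz
  rw [hz]
  ring

theorem mulVec_add (hk : IsResolventKernel κ ε k) (q q' : L2 X) (x : X) :
    hk.mulVec (q + q') x = hk.mulVec q x + hk.mulVec q' x := by
  refine Lp.ext ?_
  filter_upwards [hk.coeFn_mulVec (q + q') x, hk.coeFn_mulVec q x, hk.coeFn_mulVec q' x,
    Lp.coeFn_add q q', Lp.coeFn_add (hk.mulVec q x) (hk.mulVec q' x)] with z h1 h2 h3 h4 h5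
  rw [h1, h5, Pi.add_apply, h2, h3, h4, Pi.add_apply]
  ring

theorem mulVec_smul (hk : IsResolventKernel κ ε k) (c : ℝ) (q : L2 X) (x : X) :
    hk.mulVec (c • q) x = c • hk.mulVec q x := by
  refine Lp.ext ?_
  filter_upwards [hk.coeFn_mulVec (c • q) x, hk.coeFn_mulVec q x,
    Lp.coeFn_smul c q, Lp.coeFn_smul c (hk.mulVec q x)] with z h1 h2 h4 h5
  rw [h1, h5, Pi.smul_apply, h2, h4, Pi.smul_apply, smul_eq_mul, smul_eq_mul]
  ring

theorem norm_sq_L2 (f : L2 X) : ‖f‖ ^ 2 = ∫ z, f z ^ 2 := by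
  rw [← real_inner_self_eq_norm_sq, inner_L2]
  simp [sq]

theorem norm_vec_sq_le (hk : IsResolventKernel κ ε k) (x : X) : ‖hk.vec x‖ ^ 2 ≤ 2 / κ := by
  rw [norm_sq_L2]
  calc ∫ z, hk.vec x z ^ 2 = ∫ z, k (x - z) ^ 2 := by
        refine integral_congr_ae ?_
        filter_upwards [hk.coeFn_vec x] with z hz
        rw [hz]
    _ ≤ 2 / κ := by
        rw [integral_sub_left_eq_self (fun z => k z ^ 2) volume x]; exact hk.integral_sq_le

theorem norm_mulVec_sq (hk : IsResolventKernel κ ε k) (q : L2 X) (x : X) :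
    ‖hk.mulVec q x‖ ^ 2 = ∫ z, (k (x - z) * q z) ^ 2 := by
  rw [norm_sq_L2]
  refine integral_congr_ae ?_
  filter_upwards [hk.coeFn_mulVec q x] with z hz
  rw [hz]
  ring

theorem integrable_norm_mulVec_sq (hk : IsResolventKernel κ ε k) (q : L2 X) :
    Integrable fun x => ‖hk.mulVec q x‖ ^ 2 := by
  simp_rw [hk.norm_mulVec_sq q]
  exact (memLp_convKernel hk.memLp q).integrable_sq.integral_prod_left

/-- Fubini separates `‖q‖²` from `∫ k² ≤ 2/κ`. The left side is the squared Hilbert–Schmidt norm of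
the operator with kernel `k(x - z) q(z)`; the operator bounds, the square integrability of the
diagonal functions and the trace formula all rest on it. -/
theorem integral_norm_mulVec_sq_le (hk : IsResolventKernel κ ε k) (q : L2 X) :
    ∫ x, ‖hk.mulVec q x‖ ^ 2 ≤ 2 / κ * ‖q‖ ^ 2 := by
  simp_rw [hk.norm_mulVec_sq q]
  rw [integral_integral_swap (f := fun x z => (k (x - z) * q z) ^ 2)
    (memLp_convKernel hk.memLp q).integrable_sq]
  simp_rw [mul_pow, integral_mul_const]
  have : ∀ z : X, ∫ x, k (x - z) ^ 2 = ∫ x, k x ^ 2 := fun z =>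
    integral_sub_right_eq_self (fun x => k x ^ 2) z
  simp_rw [this, integral_const_mul]
  rw [← norm_sq_L2]
  exact mul_le_mul_of_nonneg_right hk.integral_sq_le (by positivity)

theorem norm_mulVec_le (hk : IsResolventKernel κ ε k) (q : L2 X) (x : X) :
    ‖hk.mulVec q x‖ ≤ 2 * ‖q‖ := by
  refine Lp.norm_le_mul_norm_of_ae_le_mul ?_
  filter_upwards [hk.coeFn_mulVec q x] with z hz
  rw [hz, norm_mul, mul_comm]
  exact mul_le_mul_of_nonneg_right (hk.abs_le_two _) (norm_nonneg _)

theorem continuous_vec (hk : IsResolventKernel κ ε k) : Continuous hk.vec := by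
  have : Fact ((2 : ℝ≥0∞) ≠ ⊤) := ⟨by norm_num⟩
  -- The vectors are translates of one function, and translation is strongly continuous on `L²`; the
  -- jump of `k` at `0` does no harm.
  have h : hk.vec = fun x : X => DomAddAct.mk (-x) +ᵥ hk.neg.memLp.toLp (fun z => k (-z)) := by
    funext x
    rw [DomAddAct.mk_vadd_toLp]
    refine MemLp.toLp_congr _ _ (Eventually.of_forall fun z => ?_)
    simp [sub_eq_add_neg, add_comm]
  rw [h]
  exact Continuous.vadd (DomAddAct.continuous_mk.comp continuous_neg) continuous_const

/-- The factor `q` stays fixed, so this is not a translation. Dominated convergence applies with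
majorant `4q²`: values of `k` lie in `[0, 2]`, and `k` is continuous off `0`, a single point of
measure zero. -/
theorem continuous_mulVec (hk : IsResolventKernel κ ε k) (q : L2 X) :
    Continuous (hk.mulVec q) := by
  rw [continuous_iff_continuousAt]
  intro x₀
  rw [ContinuousAt, tendsto_iff_norm_sub_tendsto_zero]
  have hsq : Tendsto (fun x => ‖hk.mulVec q x - hk.mulVec q x₀‖ ^ 2) (𝓝 x₀) (𝓝 0) := by
    have e : ∀ x, ‖hk.mulVec q x - hk.mulVec q x₀‖ ^ 2 =
        ∫ z, (q z * (k (x - z) - k (x₀ - z))) ^ 2 := by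
      intro x
      rw [norm_sq_L2]
      refine integral_congr_ae ?_
      filter_upwards [hk.coeFn_mulVec q x, hk.coeFn_mulVec q x₀,
        Lp.coeFn_sub (hk.mulVec q x) (hk.mulVec q x₀)] with z h1 h2 h3
      rw [h3, Pi.sub_apply, h1, h2, mul_sub]
    simp_rw [e]
    have := tendsto_integral_filter_of_dominated_convergence (μ := (volume : Measure X))
      (l := 𝓝 x₀) (F := fun x z => (q z * (k (x - z) - k (x₀ - z))) ^ 2) (f := fun _ => (0 : ℝ))
      (fun z => 4 * q z ^ 2) ?_ ?_ ?_ ?_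
    · simpa using this
    · refine Eventually.of_forall fun x => ?_
      exact (((Lp.aestronglyMeasurable q).mul ((hk.measurable_sub x).sub
        (hk.measurable_sub x₀)).aestronglyMeasurable).pow 2)
    · refine Eventually.of_forall fun x => Eventually.of_forall fun z => ?_
      rw [Real.norm_eq_abs, abs_of_nonneg (by positivity), mul_pow, mul_comm]
      refine mul_le_mul_of_nonneg_right ?_ (by positivity)
      have h1 := hk.nonneg (x - z); have h2 := hk.le_two (x - z)
      have h3 := hk.nonneg (x₀ - z); have h4 := hk.le_two (x₀ - z)
      nlinarith
    · exact (Lp.memLp q).integrable_sq.const_mul 4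
    · have hne : ∀ᵐ z : X, z ≠ x₀ := by
        have h0 : (volume : Measure X) {x₀} = 0 := by
          have := measure_preimage_add_right (volume : Measure X) (-x₀) {0}
          rw [RegularGeometry.volume_zero] at this
          convert this using 2
          ext z
          simp
        exact measure_eq_zero_iff_ae_notMem.1 h0
      filter_upwards [hne] with z hz
      have hc : ContinuousAt (fun x => k (x - z)) x₀ :=
        ContinuousAt.comp (f := fun x : X => x - z)
          (hk.continuousAt (x₀ - z) (sub_ne_zero.2 hz.symm)) (by fun_prop)
      have : Tendsto (fun x => (q z * (k (x - z) - k (x₀ - z))) ^ 2) (𝓝 x₀)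
          (𝓝 ((q z * (k (x₀ - z) - k (x₀ - z))) ^ 2)) :=
        ((hc.tendsto.sub_const _).const_mul _).pow 2
      simpa using this
  have := hsq.sqrt
  simpa using this

end IsResolventKernel
end

section
variable {X : Type} [AddCommGroup X] [TopologicalSpace X] [IsTopologicalAddGroup X]
  [T2Space X] [LocallyCompactSpace X] [SecondCountableTopology X] [MeasureSpace X] [BorelSpace X]
  [(volume : Measure X).IsAddHaarMeasure] [Geometry X] [RegularGeometry X]

namespace IsResolventKernel

variable {κ ε : ℝ} {k : X → ℝ}

/-! ### Convolution -/

theorem conv_eq (hk : IsResolventKernel κ ε k) {f : X → ℝ} (hf : Measurable f) (x : X) :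
    conv k f x = ∫ t in Set.Ioi (0 : ℝ), Real.exp (-κ * t) * f (x - Geometry.proj (ε * t)) := by
  rw [← hk.integral_mul (f := fun z => f (x - z)) (hf.comp (measurable_const.sub measurable_id)),
    ← integral_sub_left_eq_self (fun z => k z * f (x - z)) volume x]
  simp [conv]

theorem integrable_conv_iff (hk : IsResolventKernel κ ε k) {f : X → ℝ} (hf : Measurable f)
    (x : X) : Integrable (fun z => k (x - z) * f z) ↔ IntegrableOn
      (fun t => Real.exp (-κ * t) * f (x - Geometry.proj (ε * t))) (Set.Ioi (0 : ℝ)) := by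
  rw [← hk.integrable_mul_iff (f := fun z => f (x - z))
    (hf.comp (measurable_const.sub measurable_id)),
    ← integrable_comp_sub_left (fun z => k z * f (x - z)) x]
  simp

/-- `conv k f` solves `κ u + ε u' = f`. -/
theorem prim_conv (hk : IsResolventKernel κ ε k) {f : X → ℝ} (hf : Measurable f)
    (hi : ∀ x, Integrable fun z => k (x - z) * f z) :
    Prim (fun s => conv k f (Geometry.proj s))
      (fun s => ε * (f (Geometry.proj s) - κ * conv k f (Geometry.proj s))) := by
  rcases hk.eps with rfl | rfl
  · have e : ∀ s : ℝ, conv k f (Geometry.proj s) =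
        ∫ t in Set.Ioi (0 : ℝ), Real.exp (-κ * t) * f (Geometry.proj (s - t)) := fun s => by
      rw [hk.conv_eq hf]
      simp_rw [one_mul, proj_sub]
    refine (prim_halfLine (κ := κ) (φ := fun s => f (Geometry.proj s)) fun s => ?_).congr e
      fun s => by rw [one_mul, e s]
    have := (hk.integrable_conv_iff hf (Geometry.proj s)).1 (hi _)
    simpa only [one_mul, proj_sub] using this
  -- The case `ε = -1` is the forward half-line formula read along the reflected covering `s ↦ proj
  -- (-s)`.
  · have e : ∀ s : ℝ, conv k f (Geometry.proj s) =
        ∫ t in Set.Ioi (0 : ℝ), Real.exp (-κ * t) * f (Geometry.proj (-(-s - t))) := fun s => by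
      rw [hk.conv_eq hf]
      refine integral_congr_ae (Eventually.of_forall fun t => ?_)
      simp only
      rw [← proj_sub]
      congr 3
      ring
    refine (prim_halfLine (κ := κ) (φ := fun s => f (Geometry.proj (-s)))
      fun s => ?_).comp_neg.congr e fun s => by rw [e s, neg_neg]; ring
    have := (hk.integrable_conv_iff hf (Geometry.proj (-s))).1 (hi _)
    refine this.congr_fun (fun t _ => ?_) measurableSet_Ioi
    simp only
    rw [← proj_sub]
    congr 3
    ring

theorem abs_conv_le (hk : IsResolventKernel κ ε k) {f : X → ℝ} {C : ℝ}
    (hC : ∀ x, |f x| ≤ C) (x : X) : |conv k f x| ≤ C / κ := by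
  have : ‖conv k f x‖ ≤ ∫ z, k (x - z) * C := by
    refine norm_integral_le_of_norm_le ((hk.integrable_sub x).mul_const C)
      (Eventually.of_forall fun z => ?_)
    rw [norm_mul, Real.norm_eq_abs, abs_of_nonneg (hk.nonneg _)]
    exact mul_le_mul_of_nonneg_left (hC z) (hk.nonneg _)
  rwa [integral_mul_const, hk.integral_sub, one_div_mul_eq_div] at this

theorem integrable_prod (hk : IsResolventKernel κ ε k) {f : X → ℝ} (hf : Integrable f) :
    Integrable (fun z : X × X => k (z.1 - z.2) * f z.2) ((volume : Measure X).prod volume) :=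
  (measurePreserving_sub_prod volume volume).integrable_comp_of_integrable
    (hk.integrable.mul_prod hf)

theorem integrable_mul_of_integrable (hk : IsResolventKernel κ ε k) {f : X → ℝ}
    (hf : Integrable f) (x : X) : Integrable fun z => k (x - z) * f z := by
  refine hf.bdd_mul (c := 2) (hk.measurable_sub x).aestronglyMeasurable ?_
  exact Eventually.of_forall fun z => by simpa using hk.abs_le_two (x - z)

theorem integrable_mul_of_memLp (hk : IsResolventKernel κ ε k) {f : X → ℝ}
    (hf : MemLp f 2 volume) (x : X) : Integrable fun z => k (x - z) * f z :=
  (hk.memLp_sub x).integrable_mul hf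

/-- Cauchy–Schwarz for the measure `k(x - z) dz` of mass `1/κ`: expand the variance of `f` about its
mean `κI`. -/
theorem conv_sq_le (hk : IsResolventKernel κ ε k) {f : X → ℝ} (hf : MemLp f 2 volume) (x : X) :
    conv k f x ^ 2 ≤ 1 / κ * conv k (fun z => f z ^ 2) x := by
  have hκ := hk.pos
  have i1 := hk.integrable_mul_of_memLp hf x
  have i2 := hk.integrable_mul_of_integrable hf.integrable_sq x
  set I := conv k f x with hI
  set J := conv k (fun z => f z ^ 2) x with hJ
  have h0 : 0 ≤ ∫ z, k (x - z) * (f z - κ * I) ^ 2 :=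
    integral_nonneg fun z => mul_nonneg (hk.nonneg _) (sq_nonneg _)
  have e : ∫ z, k (x - z) * (f z - κ * I) ^ 2 = J - 2 * κ * I * I + (κ * I) ^ 2 * (1 / κ) := by
    have : ∀ z, k (x - z) * (f z - κ * I) ^ 2 = k (x - z) * f z ^ 2 -
        2 * κ * I * (k (x - z) * f z) + (κ * I) ^ 2 * k (x - z) := fun z => by ring
    simp_rw [this]
    have i3 := i1.const_mul (2 * κ * I)
    rw [integral_add, MeasureTheory.integral_sub i2 i3, integral_const_mul, integral_const_mul,
      hk.integral_sub]
    · rfl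
    · exact i2.sub i3
    · exact (hk.integrable_sub x).const_mul _
  rw [e] at h0
  have e2 : (κ * I) ^ 2 * (1 / κ) = κ * I ^ 2 := by field_simp
  rw [e2] at h0
  rw [one_div_mul_eq_div, le_div_iff₀ hκ]
  nlinarith

theorem conv_eq_inner (hk : IsResolventKernel κ ε k) {f : X → ℝ} (hf : MemLp f 2 volume)
    (x : X) : conv k f x = inner ℝ (hk.vec x) (hf.toLp f) := by
  rw [hk.inner_vec]
  refine integral_congr_ae ?_
  filter_upwards [hf.coeFn_toLp] with z hz
  rw [hz]

theorem continuous_conv (hk : IsResolventKernel κ ε k) {f : X → ℝ} (hf : MemLp f 2 volume) :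
    Continuous (conv k f) := by
  rw [show conv k f = fun x => inner ℝ (hk.vec x) (hf.toLp f) from funext (hk.conv_eq_inner hf)]
  exact hk.continuous_vec.inner continuous_const

theorem memLp_conv (hk : IsResolventKernel κ ε k) {f : X → ℝ} (hf : MemLp f 2 volume) :
    MemLp (conv k f) 2 volume := by
  refine (memLp_two_iff_integrable_sq (hk.continuous_conv hf).aestronglyMeasurable).2 ?_
  refine ((hk.integrable_prod hf.integrable_sq).integral_prod_left.const_mul (1 / κ)).mono'
    ((hk.continuous_conv hf).pow 2).aestronglyMeasurable (Eventually.of_forall fun x => ?_)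
  rw [Real.norm_eq_abs, abs_of_nonneg (sq_nonneg _)]
  exact hk.conv_sq_le hf x

theorem integral_conv_sq_le (hk : IsResolventKernel κ ε k) {f : X → ℝ} (hf : MemLp f 2 volume) :
    ∫ x, conv k f x ^ 2 ≤ (1 / κ) ^ 2 * ∫ x, f x ^ 2 := by
  have hp := hk.integrable_prod hf.integrable_sq
  calc ∫ x, conv k f x ^ 2 ≤ ∫ x, 1 / κ * conv k (fun z => f z ^ 2) x :=
        integral_mono (hk.memLp_conv hf).integrable_sq (hp.integral_prod_left.const_mul _)
          fun x => hk.conv_sq_le hf x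
    _ = 1 / κ * ∫ x, ∫ z, k (x - z) * f z ^ 2 := integral_const_mul _ _
    _ = (1 / κ) ^ 2 * ∫ x, f x ^ 2 := by
        rw [integral_integral_swap (f := fun x z => k (x - z) * f z ^ 2) hp]
        simp_rw [integral_mul_const, hk.integral_sub_right, integral_const_mul]
        ring

/-- The resolvent `(κ + ε ∂)⁻¹` on `L²`. -/
def res (hk : IsResolventKernel κ ε k) : L2 X →L[ℝ] L2 X :=
  LinearMap.mkContinuous
    { toFun := fun f => (hk.memLp_conv (Lp.memLp f)).toLp _
      map_add' := by
        intro f g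
        rw [← MemLp.toLp_add]
        refine MemLp.toLp_congr _ _ (Eventually.of_forall fun x => ?_)
        rw [Pi.add_apply, ← hk.inner_vec, ← hk.inner_vec, ← hk.inner_vec, inner_add_right]
      map_smul' := by
        intro c f
        rw [RingHom.id_apply, ← MemLp.toLp_const_smul]
        refine MemLp.toLp_congr _ _ (Eventually.of_forall fun x => ?_)
        rw [Pi.smul_apply, ← hk.inner_vec, ← hk.inner_vec, inner_smul_right, smul_eq_mul] }
    (1 / κ) (by
      intro f
      have hκ : 0 < 1 / κ := one_div_pos.2 hk.pos
      refine (sq_le_sq₀ (norm_nonneg _) (by positivity)).1 ?_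
      rw [mul_pow, norm_sq_L2, norm_sq_L2]
      refine le_trans (le_of_eq ?_) (hk.integral_conv_sq_le (Lp.memLp f))
      refine integral_congr_ae ?_
      filter_upwards [(hk.memLp_conv (Lp.memLp f)).coeFn_toLp] with x hx
      simp only [LinearMap.coe_mk, AddHom.coe_mk]
      rw [hx])

theorem coeFn_res (hk : IsResolventKernel κ ε k) (f : L2 X) :
    hk.res f =ᵐ[volume] fun x => inner ℝ (hk.vec x) f := by
  simp_rw [hk.inner_vec]
  exact (hk.memLp_conv (Lp.memLp f)).coeFn_toLp

theorem norm_res_le (hk : IsResolventKernel κ ε k) : ‖hk.res‖ ≤ 1 / κ :=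
  LinearMap.mkContinuous_norm_le _ (one_div_nonneg.2 hk.pos.le) _

theorem inner_res (hk : IsResolventKernel κ ε k) (f g : L2 X) :
    inner ℝ (hk.res f) g = inner ℝ f (hk.neg.res g) := by
  have e1 : inner ℝ (hk.res f) g = ∫ x, ∫ z, k (x - z) * f z * g x := by
    rw [inner_L2]
    refine integral_congr_ae ?_
    filter_upwards [hk.coeFn_res f] with x hx
    rw [hx, hk.inner_vec, conv, ← integral_mul_const]
  have e2 : inner ℝ f (hk.neg.res g) = ∫ z, ∫ x, k (x - z) * f z * g x := by
    rw [inner_L2]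
    refine integral_congr_ae ?_
    filter_upwards [hk.neg.coeFn_res g] with z hz
    rw [hz, hk.neg.inner_vec, conv, ← integral_const_mul]
    refine integral_congr_ae (Eventually.of_forall fun x => ?_)
    simp only [neg_sub]
    ring
  rw [e1, e2]
  refine integral_integral_swap ?_
  have hm : AEStronglyMeasurable (Function.uncurry fun x z => k (x - z) * f z * g x)
      ((volume : Measure X).prod volume) :=
    (((hk.measurable.comp (measurable_fst.sub measurable_snd)).aestronglyMeasurable).mul
      (Lp.aestronglyMeasurable f).comp_snd).mul (Lp.aestronglyMeasurable g).comp_fst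
  refine (integrable_prod_iff hm).2 ⟨?_, ?_⟩
  · exact Eventually.of_forall fun x =>
      (hk.integrable_mul_of_memLp (Lp.memLp f) x).mul_const (g x)
  · have := (hk.memLp_conv (Lp.memLp f).abs).integrable_mul (Lp.memLp g).abs
    refine this.congr (Eventually.of_forall fun x => ?_)
    simp only [Pi.mul_apply, conv, Function.uncurry_apply_pair]
    rw [← integral_mul_const]
    refine integral_congr_ae (Eventually.of_forall fun z => ?_)
    simp only [norm_mul, Real.norm_eq_abs, abs_of_nonneg (hk.nonneg _), Pi.abs_apply]

theorem prim_vec (hk : IsResolventKernel κ ε k) (f : L2 X) :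
    Prim (fun s => inner ℝ (hk.vec (Geometry.proj s)) f)
      (fun s => ε * (f (Geometry.proj s) - κ * inner ℝ (hk.vec (Geometry.proj s)) f)) := by
  simp_rw [hk.inner_vec]
  exact hk.prim_conv (Lp.stronglyMeasurable f).measurable
    (hk.integrable_mul_of_memLp (Lp.memLp f))

/-- Only the class of `f` matters on the left, so any measurable representative may appear in the
derivative. In the applications `g` is continuous, as `Prim.diag` requires of the function
multiplying `q`. -/
theorem prim_mulVec (hk : IsResolventKernel κ ε k) (q f : L2 X) {g : X → ℝ} (hg : Measurable g)
    (h : f =ᵐ[volume] g) :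
    Prim (fun s => inner ℝ (hk.mulVec q (Geometry.proj s)) f)
      (fun s => ε * (q (Geometry.proj s) * g (Geometry.proj s) -
        κ * inner ℝ (hk.mulVec q (Geometry.proj s)) f)) := by
  have e : ∀ x, inner ℝ (hk.mulVec q x) f = conv k (fun z => q z * g z) x := by
    intro x
    rw [hk.inner_mulVec]
    refine integral_congr_ae ?_
    filter_upwards [h] with z hz
    rw [hz]
  simp_rw [e]
  refine hk.prim_conv ((Lp.stronglyMeasurable q).measurable.mul hg) fun x => ?_
  have hi : Integrable fun z => q z * g z := by
    refine ((Lp.memLp q).integrable_mul (Lp.memLp f)).congr ?_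
    filter_upwards [h] with z hz
    rw [Pi.mul_apply, hz]
  exact hk.integrable_mul_of_integrable hi x

/-! ### The operators `(κ + ε ∂)⁻¹ q` -/

/-- The operator `(κ + ε ∂)⁻¹ q`. -/
def op (_hk : IsResolventKernel κ ε k) (q : L2 X) : L2 X →L[ℝ] L2 X :=
  intOp fun x y => k (x - y) * q y

theorem coeFn_op (hk : IsResolventKernel κ ε k) (q f : L2 X) :
    hk.op q f =ᵐ[volume] fun x => inner ℝ (hk.mulVec q x) f := by
  have hK := memLp_convKernel hk.memLp q
  have : hk.op q f = (memLp_intOp hK f).toLp _ := by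
    rw [op, intOp, dif_pos hK]; rfl
  rw [this]
  refine (MemLp.coeFn_toLp _).trans (Eventually.of_forall fun x => ?_)
  simp only [hk.inner_mulVec, conv, mul_assoc]

theorem op_add (hk : IsResolventKernel κ ε k) (q q' : L2 X) :
    hk.op (q + q') = hk.op q + hk.op q' := by
  ext1 f
  refine Lp.ext ?_
  rw [add_apply]
  filter_upwards [hk.coeFn_op (q + q') f, hk.coeFn_op q f, hk.coeFn_op q' f,
    Lp.coeFn_add (hk.op q f) (hk.op q' f)] with x h1 h2 h3 h4
  rw [h1, h4, Pi.add_apply, h2, h3, hk.mulVec_add, inner_add_left]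

theorem op_smul (hk : IsResolventKernel κ ε k) (c : ℝ) (q : L2 X) :
    hk.op (c • q) = c • hk.op q := by
  ext1 f
  refine Lp.ext ?_
  rw [smul_apply]
  filter_upwards [hk.coeFn_op (c • q) f, hk.coeFn_op q f,
    Lp.coeFn_smul c (hk.op q f)] with x h1 h2 h4
  rw [h1, h4, Pi.smul_apply, h2, hk.mulVec_smul, inner_smul_left]
  simp

theorem norm_op_apply_sq_le (hk : IsResolventKernel κ ε k) (q f : L2 X) :
    ‖hk.op q f‖ ^ 2 ≤ 2 / κ * ‖q‖ ^ 2 * ‖f‖ ^ 2 := by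
  rw [norm_sq_L2]
  calc ∫ x, hk.op q f x ^ 2 = ∫ x, inner ℝ (hk.mulVec q x) f ^ 2 := by
        refine integral_congr_ae ?_
        filter_upwards [hk.coeFn_op q f] with x hx
        rw [hx]
    _ ≤ ∫ x, ‖hk.mulVec q x‖ ^ 2 * ‖f‖ ^ 2 := by
        refine integral_mono_of_nonneg (Eventually.of_forall fun x => sq_nonneg _)
          ((hk.integrable_norm_mulVec_sq q).mul_const _) (Eventually.of_forall fun x => ?_)
        simp only
        rw [← mul_pow, ← sq_abs]
        exact pow_le_pow_left₀ (abs_nonneg _) (abs_real_inner_le_norm _ _) 2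
    _ ≤ _ := by
        rw [integral_mul_const]
        exact mul_le_mul_of_nonneg_right (hk.integral_norm_mulVec_sq_le q) (sq_nonneg _)

theorem norm_op_le (hk : IsResolventKernel κ ε k) (q : L2 X) :
    ‖hk.op q‖ ≤ Real.sqrt (2 / κ) * ‖q‖ := by
  have hκ := hk.pos
  refine ContinuousLinearMap.opNorm_le_bound _ (by positivity) fun f => ?_
  refine (sq_le_sq₀ (norm_nonneg _) (by positivity)).1 ?_
  rw [mul_pow, mul_pow, Real.sq_sqrt (by positivity)]
  exact hk.norm_op_apply_sq_le q f

/-- `q ↦ (κ + ε ∂)⁻¹ q` as a continuous linear map. -/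
def opL (hk : IsResolventKernel κ ε k) : L2 X →L[ℝ] (L2 X →L[ℝ] L2 X) :=
  LinearMap.mkContinuous
    { toFun := hk.op
      map_add' := hk.op_add
      map_smul' := hk.op_smul } (Real.sqrt (2 / κ)) hk.norm_op_le

/-- Fubini moves the resolvent from `q f` to `w`. Multiplication by the unbounded `q` then sits
between `f` and a pointwise defined function, and no product `q f` in `L²` is required. -/
theorem inner_op (hk : IsResolventKernel κ ε k) (q w f : L2 X) :
    inner ℝ w (hk.op q f) = ∫ z, q z * inner ℝ (hk.neg.vec z) w * f z := by
  have hK := memLp_convKernel hk.memLp q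
  have e1 : inner ℝ w (hk.op q f) = ∫ x, ∫ z, (k (x - z) * q z) * (w x * f z) := by
    rw [inner_L2]
    refine integral_congr_ae ?_
    filter_upwards [hk.coeFn_op q f] with x hx
    rw [hx, hk.inner_mulVec, conv, ← integral_const_mul]
    exact integral_congr_ae (Eventually.of_forall fun z => by ring)
  have e2 : ∫ z, q z * inner ℝ (hk.neg.vec z) w * f z =
      ∫ z, ∫ x, (k (x - z) * q z) * (w x * f z) := by
    refine integral_congr_ae (Eventually.of_forall fun z => ?_)
    simp only
    rw [hk.neg.inner_vec, conv, ← integral_const_mul, ← integral_mul_const]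
    refine integral_congr_ae (Eventually.of_forall fun x => ?_)
    simp only [neg_sub]
    ring
  rw [e1, e2]
  refine integral_integral_swap ?_
  have hwf : MemLp (fun z : X × X => w z.1 * f z.2) 2 ((volume : Measure X).prod volume) := by
    refine (memLp_two_iff_integrable_sq ((Lp.aestronglyMeasurable w).comp_fst.mul
      (Lp.aestronglyMeasurable f).comp_snd)).2 ?_
    have := (Lp.memLp w).integrable_sq.mul_prod (Lp.memLp f).integrable_sq
    refine this.congr (Eventually.of_forall fun z => ?_)
    simp [mul_pow]
  exact hK.integrable_mul hwf

theorem inner_op_vec (hk : IsResolventKernel κ ε k) (q w : L2 X) (x : X) :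
    inner ℝ w (hk.op q (hk.vec x)) = inner ℝ (hk.mulVec q x) (hk.neg.res w) := by
  rw [hk.inner_op, inner_L2]
  refine integral_congr_ae ?_
  filter_upwards [hk.coeFn_vec x, hk.coeFn_mulVec q x, hk.neg.coeFn_res w] with z h1 h2 h3
  rw [h1, h2, h3]
  ring

/-- In general `q f` need not lie in `L²`, but `k` is bounded, so `q v_x` does and `P v_x = D(q
v_x)`. This gains a factor `1/κ` and makes the expression linear in `q v_x`. -/
theorem op_vec (hk : IsResolventKernel κ ε k) (q : L2 X) (x : X) :
    hk.op q (hk.vec x) = hk.res (hk.mulVec q x) := by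
  refine ext_inner_left ℝ fun w => ?_
  rw [hk.inner_op_vec, ← hk.inner_res, real_inner_comm]

theorem prim_op_vec (hk : IsResolventKernel κ ε k) (q w : L2 X) :
    Prim (fun s => inner ℝ w (hk.op q (hk.vec (Geometry.proj s))))
      (fun s => ε * (q (Geometry.proj s) * inner ℝ (hk.neg.vec (Geometry.proj s)) w -
        κ * inner ℝ w (hk.op q (hk.vec (Geometry.proj s))))) := by
  simp_rw [hk.inner_op_vec q w]
  exact hk.prim_mulVec q _ (hk.neg.continuous_vec.inner continuous_const).measurable
    (hk.neg.coeFn_res w)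

/-- `P D' = D P*` for `P = D q`. -/
theorem inner_op_res (hk : IsResolventKernel κ ε k) (q w f : L2 X) :
    inner ℝ w (hk.op q (hk.neg.res f)) = inner ℝ f (hk.op q (hk.neg.res w)) := by
  rw [hk.inner_op, hk.inner_op]
  refine integral_congr_ae ?_
  filter_upwards [hk.neg.coeFn_res w, hk.neg.coeFn_res f] with z h1 h2
  rw [h1, h2]
  ring

end IsResolventKernel
end

section
variable {X : Type} [AddCommGroup X] [TopologicalSpace X] [IsTopologicalAddGroup X]
  [T2Space X] [LocallyCompactSpace X] [SecondCountableTopology X] [MeasureSpace X] [BorelSpace X]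
  [(volume : Measure X).IsAddHaarMeasure] [Geometry X] [RegularGeometry X]

/-! ## Weak derivatives -/

theorem integrable_mul_L2 {u v : X → ℝ} (hu : MemLp u 2 volume) (hv : MemLp v 2 volume) :
    Integrable fun x => u x * v x := hu.integrable_mul hv

/-- The integral of a derivative vanishes. -/
theorem integral_eq_zero_of_prim {u v : X → ℝ} (hu : Integrable u) (hv : Integrable v)
    (hvm : Measurable v) (h : Prim (fun s => u (Geometry.proj s)) fun s => v (Geometry.proj s)) :
    ∫ x, v x = 0 := by
  -- Integrate the increment of `u` over a unit step along the covering. The left side has integral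
  -- zero by translation invariance, the right side gives `∫ v` by Fubini. No decay of `u` at
  -- infinity is used, and the circle needs no separate argument.
  have e : ∀ x : X, u (x + Geometry.proj 1) - u x =
      ∫ s in Set.Ioc (0 : ℝ) 1, v (x + Geometry.proj s) := by
    intro x
    obtain ⟨t, rfl⟩ := RegularGeometry.surjective_proj x
    have := h.sub_eq t (t + 1)
    rw [RegularGeometry.proj_add] at this
    rw [this, ← intervalIntegral.integral_of_le zero_le_one]
    have h2 := intervalIntegral.integral_comp_add_left (a := 0) (b := 1)
      (fun s => v (Geometry.proj s)) t
    rw [add_zero] at h2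
    rw [← h2]
    simp_rw [RegularGeometry.proj_add]
  have h0 : ∫ x, (u (x + Geometry.proj 1) - u x) = 0 := by
    rw [integral_sub (hu.comp_add_right _) hu, integral_add_right_eq_self, sub_self]
  simp_rw [e] at h0
  have hm : Measurable fun z : X × ℝ => v (z.1 + Geometry.proj z.2) :=
    hvm.comp (measurable_fst.add (RegularGeometry.continuous_proj.measurable.comp measurable_snd))
  have hi : Integrable (fun z : X × ℝ => v (z.1 + Geometry.proj z.2))
      ((volume : Measure X).prod (volume.restrict (Set.Ioc (0 : ℝ) 1))) := by
    refine (integrable_prod_iff' hm.aestronglyMeasurable).2 ⟨?_, ?_⟩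
    · exact Eventually.of_forall fun s => hv.comp_add_right (Geometry.proj s)
    · have : ∀ s : ℝ, ∫ x, ‖v (x + Geometry.proj s)‖ = ∫ x, ‖v x‖ := fun s =>
        integral_add_right_eq_self (fun x => ‖v x‖) _
      simp_rw [this]
      exact integrable_const _
  rw [integral_integral_swap (f := fun x s => v (x + Geometry.proj s)) hi] at h0
  have : ∀ s : ℝ, ∫ x, v (x + Geometry.proj s) = ∫ x, v x := fun s =>
    integral_add_right_eq_self v _
  simp_rw [this] at h0
  simpa using h0

theorem deriv_comp_proj (φ : X → ℝ) (s : ℝ) :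
    deriv (fun t : ℝ => φ (Geometry.proj t)) s = xDeriv φ (Geometry.proj s) := by
  rw [xDeriv]
  simp_rw [← RegularGeometry.proj_add]
  rw [deriv_comp_const_add (fun t : ℝ => φ (Geometry.proj t)) s 0, add_zero]

theorem prim_xDeriv {φ : X → ℝ} (hφ : ContDiff ℝ ∞ fun t : ℝ => φ (Geometry.proj t)) :
    Prim (fun s => φ (Geometry.proj s)) fun s => xDeriv φ (Geometry.proj s) := by
  simp_rw [← deriv_comp_proj]
  refine Prim.of_hasDerivAt (fun x => ?_) (hφ.continuous_deriv (by simp))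
  exact (hφ.differentiable (by simp) x).hasDerivAt

theorem continuous_of_contDiff {φ : X → ℝ} (hφ : ContDiff ℝ ∞ fun t : ℝ => φ (Geometry.proj t)) :
    Continuous φ := RegularGeometry.continuous_of_comp_proj φ hφ.continuous

theorem continuous_xDeriv {φ : X → ℝ} (hφ : ContDiff ℝ ∞ fun t : ℝ => φ (Geometry.proj t)) :
    Continuous (xDeriv φ) := by
  refine RegularGeometry.continuous_of_comp_proj _ ?_
  simp_rw [← deriv_comp_proj]
  exact hφ.continuous_deriv (by simp)

theorem IsTest.memLp {φ : X → ℝ} (hφ : IsTest φ) : MemLp φ 2 volume :=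
  (continuous_of_contDiff hφ.1).memLp_of_hasCompactSupport hφ.2

theorem IsTest.memLp_xDeriv {φ : X → ℝ} (hφ : IsTest φ) : MemLp (xDeriv φ) 2 volume := by
  refine (continuous_xDeriv hφ.1).memLp_of_hasCompactSupport
    (HasCompactSupport.intro hφ.2 fun x hx => ?_)
  have h0 : φ =ᶠ[𝓝 x] 0 := notMem_tsupport_iff_eventuallyEq.1 hx
  have hc : ContinuousAt (fun t : ℝ => x + (Geometry.proj t : X)) 0 :=
    (continuous_const.add RegularGeometry.continuous_proj).continuousAt
  have h1 : (fun t : ℝ => φ (x + Geometry.proj t)) =ᶠ[𝓝 0] fun _ => 0 := by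
    refine hc.eventually (p := fun y => φ y = 0) ?_
    simp only [proj_zero, add_zero]
    exact h0
  rw [xDeriv, h1.deriv_eq, deriv_const]

theorem IsTest.comp_add {φ : X → ℝ} (hφ : IsTest φ) (x : X) : IsTest fun y => φ (y + x) := by
  obtain ⟨t, rfl⟩ := RegularGeometry.surjective_proj x
  refine ⟨?_, hφ.2.comp_homeomorph (Homeomorph.addRight _)⟩
  simp_rw [← RegularGeometry.proj_add]
  exact hφ.1.comp (contDiff_id.add contDiff_const)

theorem xDeriv_comp_add (φ : X → ℝ) (x y : X) : xDeriv (fun y => φ (y + x)) y =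
    xDeriv φ (y + x) := by
  simp only [xDeriv, add_right_comm]

/-- The product of `u` with a test function has an integrable derivative, whose integral vanishes.
-/
theorem hasWeakDeriv_of_prim {u v : X → ℝ} (hu : MemLp u 2 volume) (hv : MemLp v 2 volume)
    (hvm : Measurable v) (h : Prim (fun s => u (Geometry.proj s)) fun s => v (Geometry.proj s)) :
    HasWeakDeriv u v := by
  refine ⟨hu, hv, fun φ hφ => ?_⟩
  have h1 := integrable_mul_L2 hv hφ.memLp
  have h2 := integrable_mul_L2 hφ.memLp_xDeriv hu
  have hm := (continuous_of_contDiff hφ.1).measurable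
  have hum : Measurable u := (RegularGeometry.continuous_of_comp_proj u h.continuous).measurable
  have := integral_eq_zero_of_prim (u := fun x => u x * φ x)
    (v := fun x => v x * φ x + xDeriv φ x * u x) (hu.integrable_mul hφ.memLp)
    (h1.add h2)
    ((hvm.mul hm).add ((continuous_xDeriv hφ.1).measurable.mul hum))
    (h.mul (prim_xDeriv hφ.1))
  rw [integral_add h1 h2] at this
  simp_rw [mul_comm (u _)]
  linarith

theorem HasWeakDeriv.congr {u v u' v' : X → ℝ} (h : HasWeakDeriv u v) (hu : u' =ᵐ[volume] u)
    (hv : v' =ᵐ[volume] v) : HasWeakDeriv u' v' := by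
  refine ⟨h.1.ae_eq hu.symm, h.2.1.ae_eq hv.symm, fun φ hφ => ?_⟩
  have := h.2.2 φ hφ
  have e1 : ∫ x, u' x * xDeriv φ x = ∫ x, u x * xDeriv φ x :=
    integral_congr_ae (by filter_upwards [hu] with x hx; rw [hx])
  have e2 : ∫ x, v' x * φ x = ∫ x, v x * φ x :=
    integral_congr_ae (by filter_upwards [hv] with x hx; rw [hx])
  rw [e1, e2, this]

theorem HasWeakDeriv.sub {u v u' v' : X → ℝ} (h : HasWeakDeriv u v) (h' : HasWeakDeriv u' v') :
    HasWeakDeriv (fun x => u x - u' x) fun x => v x - v' x := by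
  refine ⟨h.1.sub h'.1, h.2.1.sub h'.2.1, fun φ hφ => ?_⟩
  simp_rw [sub_mul]
  rw [integral_sub (integrable_mul_L2 h.1 hφ.memLp_xDeriv)
      (integrable_mul_L2 h'.1 hφ.memLp_xDeriv),
    integral_sub (integrable_mul_L2 h.2.1 hφ.memLp) (integrable_mul_L2 h'.2.1 hφ.memLp),
    h.2.2 φ hφ, h'.2.2 φ hφ]
  ring

theorem integral_abs_mul_le {u v : X → ℝ} (hu : MemLp u 2 volume) (hv : MemLp v 2 volume) :
    ∫ x, |u x * v x| ≤ (∫ x, u x ^ 2) + ∫ x, v x ^ 2 := by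
  rw [← integral_add hu.integrable_sq hv.integrable_sq]
  refine integral_mono (hu.integrable_mul hv).abs
    (hu.integrable_sq.add hv.integrable_sq) fun x => ?_
  simp only [abs_mul]
  rw [← sq_abs (u x), ← sq_abs (v x)]
  nlinarith [sq_nonneg (|u x| - |v x|), sq_nonneg (|u x|), sq_nonneg (|v x|)]

/-- A square integrable weak solution of `v' = c v`, `c ≠ 0`, vanishes. -/
theorem HasWeakDeriv.ae_eq_zero {v v' : X → ℝ} {c : ℝ} (h : HasWeakDeriv v v')
    (hv : v' =ᵐ[volume] fun x => c * v x) (hc : c ≠ 0) : v =ᵐ[volume] 0 := by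
  refine RegularGeometry.ae_eq_zero_of_test v h.1 fun φ hφ => ?_
  have hL2 : ∀ {ψ : X → ℝ}, MemLp ψ 2 volume → ∀ s : ℝ,
      MemLp (fun y => ψ (y + Geometry.proj s)) 2 volume := fun hψ s =>
    hψ.comp_measurePreserving (measurePreserving_add_right volume (Geometry.proj s))
  have hbound : ∀ {ψ : X → ℝ}, MemLp ψ 2 volume → ∀ s : ℝ,
      ∫ y, |v y * ψ (y + Geometry.proj s)| ≤ (∫ y, v y ^ 2) + ∫ y, ψ y ^ 2 := fun {ψ} hψ s => by
    refine (integral_abs_mul_le h.1 (hL2 hψ s)).trans (le_of_eq ?_)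
    congr 1
    exact integral_add_right_eq_self (fun y => ψ y ^ 2) _
  -- Pairing with translates of the test function turns the weak equation into `w' = -c w` on the
  -- real line. The function `w` is bounded by Cauchy–Schwarz, hence zero; its value at `0` is the
  -- integral sought.
  let w : ℝ → ℝ := fun s => ∫ y, v y * φ (y + Geometry.proj s)
  have hw' : ∀ s : ℝ, ∫ y, v y * xDeriv φ (y + Geometry.proj s) = -c * w s := by
    intro s
    have h1 := h.2.2 _ (hφ.comp_add (Geometry.proj s))
    simp_rw [xDeriv_comp_add] at h1
    rw [h1, neg_mul, ← integral_const_mul]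
    congr 1
    refine integral_congr_ae ?_
    filter_upwards [hv] with x hx
    rw [hx, mul_assoc]
  have hprim : Prim w fun s => -c * w s := by
    refine Prim.of_le fun a b hab => ?_
    have hm : AEStronglyMeasurable (fun z : X × ℝ => v z.1 * xDeriv φ (z.1 + Geometry.proj z.2))
        ((volume : Measure X).prod (volume.restrict (Set.Ioc a b))) :=
      h.1.1.comp_fst.mul ((continuous_xDeriv hφ.1).comp (continuous_fst.add
        (RegularGeometry.continuous_proj.comp continuous_snd))).aestronglyMeasurable
    have hi : Integrable (fun z : X × ℝ => v z.1 * xDeriv φ (z.1 + Geometry.proj z.2))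
        ((volume : Measure X).prod (volume.restrict (Set.Ioc a b))) := by
      refine (integrable_prod_iff' hm).2 ⟨?_, ?_⟩
      · exact Eventually.of_forall fun s => h.1.integrable_mul (hL2 hφ.memLp_xDeriv s)
      · refine Integrable.of_bound (C := (∫ y, v y ^ 2) + ∫ y, xDeriv φ y ^ 2)
          hm.norm.prod_swap.integral_prod_right' (Eventually.of_forall fun s => ?_)
        rw [Real.norm_eq_abs, abs_of_nonneg (integral_nonneg fun y => norm_nonneg _)]
        exact hbound hφ.memLp_xDeriv s
    have hswap := integral_integral_swap
      (f := fun y s => v y * xDeriv φ (y + Geometry.proj s)) hi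
    have hint := hi.integral_prod_right
    simp_rw [hw'] at hswap hint
    refine ⟨(intervalIntegrable_iff_integrableOn_Ioc_of_le hab).2 hint, ?_⟩
    rw [intervalIntegral.integral_of_le hab, ← hswap]
    simp only [w]
    rw [← integral_sub (integrable_mul_L2 h.1 (hL2 hφ.memLp b))
      (integrable_mul_L2 h.1 (hL2 hφ.memLp a))]
    refine integral_congr_ae (Eventually.of_forall fun y => ?_)
    simp only
    rw [integral_const_mul, ← mul_sub, ← intervalIntegral.integral_of_le hab]
    congr 1
    have := (prim_xDeriv (φ := fun z => φ (z + y)) (hφ.comp_add y).1).sub_eq a b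
    simp_rw [xDeriv_comp_add, add_comm _ y] at this
    exact this
  have := hprim.eq_zero_of_bounded (neg_ne_zero.2 hc) (C := (∫ y, v y ^ 2) + ∫ y, φ y ^ 2)
    (fun s => (abs_integral_le_integral_abs).trans (hbound hφ.memLp s)) 0
  simpa [w, proj_zero] using this

/-! ### Resolvents and weak derivatives -/

namespace IsResolventKernel

variable {κ ε : ℝ} {k : X → ℝ}

theorem hasWeakDeriv_res (hk : IsResolventKernel κ ε k) (f : L2 X) :
    HasWeakDeriv (hk.res f) fun x => ε * (f x - κ * hk.res f x) := by
  have hc : Continuous fun x => inner ℝ (hk.vec x) f := hk.continuous_vec.inner continuous_const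
  have h2 : MemLp (fun x => inner ℝ (hk.vec x) f) 2 volume :=
    (Lp.memLp (hk.res f)).ae_eq (hk.coeFn_res f)
  have := hasWeakDeriv_of_prim h2 (((Lp.memLp f).sub (h2.const_mul κ)).const_mul ε)
    (((Lp.stronglyMeasurable f).measurable.sub (hc.measurable.const_mul κ)).const_mul ε)
    (hk.prim_vec f)
  refine this.congr (hk.coeFn_res f) ?_
  filter_upwards [hk.coeFn_res f] with x hx
  rw [hx]
  rfl

/-- The difference of two solutions solves `v' = -εκ v`, which has no nonzero solution in `L²`. -/
theorem eq_res_of_hasWeakDeriv (hk : IsResolventKernel κ ε k) {u g : L2 X} {u' : X → ℝ}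
    (h : HasWeakDeriv u u') (hu : ∀ᵐ x, u' x = ε * (g x - κ * u x)) : u = hk.res g := by
  have h0 := (h.sub (hk.hasWeakDeriv_res g)).ae_eq_zero (c := -(ε * κ)) (by
    filter_upwards [hu] with x hx
    rw [hx]
    ring) (neg_ne_zero.2 (mul_ne_zero hk.eps_ne_zero hk.pos.ne'))
  refine Lp.ext ?_
  filter_upwards [h0] with x hx
  exact sub_eq_zero.1 hx

theorem res_toLp_mul (hk : IsResolventKernel κ ε k) (q f : L2 X)
    (h : MemLp (fun x => q x * f x) 2 volume) : hk.res (h.toLp _) = hk.op q f := by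
  refine Lp.ext ?_
  filter_upwards [hk.coeFn_res (h.toLp _), hk.coeFn_op q f] with x h1 h2
  rw [h1, h2, hk.inner_mulVec, hk.conv_eq_inner h]

theorem abs_inner_vec_le (hk : IsResolventKernel κ ε k) (x : X) (f : L2 X) :
    |inner ℝ (hk.vec x) f| ≤ Real.sqrt (2 / κ) * ‖f‖ :=
  (abs_real_inner_le_norm _ _).trans
    (mul_le_mul_of_nonneg_right (Real.le_sqrt_of_sq_le (hk.norm_vec_sq_le x)) (norm_nonneg _))

theorem abs_inner_mulVec_le (hk : IsResolventKernel κ ε k) (q : L2 X) (x : X) (f : L2 X) :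
    |inner ℝ (hk.mulVec q x) f| ≤ 2 * ‖q‖ * ‖f‖ :=
  (abs_real_inner_le_norm _ _).trans
    (mul_le_mul_of_nonneg_right (hk.norm_mulVec_le q x) (norm_nonneg _))

end IsResolventKernel
end

/-! ## Inverses of `1 + ν A B` and `1 + ν B A` -/

section Algebra

/-- `R` and `S` are the inverses of `1 + ν B A` and `1 + ν A B`. -/
structure IsInversePair {𝔸 : Type*} [Ring 𝔸] [Algebra ℝ 𝔸] (ν : ℝ) (A B R S : 𝔸) : Prop where
  left_mul : R * (1 + ν • (B * A)) = 1
  mul_left : (1 + ν • (B * A)) * R = 1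
  right_mul : S * (1 + ν • (A * B)) = 1
  mul_right : (1 + ν • (A * B)) * S = 1

namespace IsInversePair

variable {𝔸 : Type*} [Ring 𝔸] [Algebra ℝ 𝔸] {ν : ℝ} {A B R S : 𝔸}

theorem swap (h : IsInversePair ν A B R S) : IsInversePair ν B A S R :=
  ⟨h.right_mul, h.mul_right, h.left_mul, h.mul_left⟩

/-- Push-through: `A(1 + νBA) = (1 + νAB)A`, multiplied by the inverses on both sides. -/
theorem comm (h : IsInversePair ν A B R S) : A * R = S * A := by
  have e : A * (1 + ν • (B * A)) = (1 + ν • (A * B)) * A := by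
    rw [mul_add, add_mul, mul_one, one_mul, mul_smul_comm, smul_mul_assoc, mul_assoc]
  calc A * R = S * (1 + ν • (A * B)) * (A * R) := by rw [h.right_mul, one_mul]
    _ = S * ((1 + ν • (A * B)) * A * R) := by simp only [mul_assoc]
    _ = S * (A * ((1 + ν • (B * A)) * R)) := by rw [← e, mul_assoc]
    _ = S * A := by rw [h.mul_left, mul_one]

theorem eq_sub (h : IsInversePair ν A B R S) : R = 1 - ν • (B * A * R) := by
  have := h.mul_left
  rw [add_mul, one_mul, smul_mul_assoc] at this
  exact eq_sub_of_add_eq this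

/-- The correction to `1` is sandwiched between `B` and `A`. Both of its ends are thus smoothing,
which is what makes the diagonal of the correction differentiable in `prim_diagT`. -/
theorem eq_sub' (h : IsInversePair ν A B R S) : R = 1 - ν • (B * S * A) := by
  conv_lhs => rw [h.eq_sub]
  rw [mul_assoc, h.comm, mul_assoc]

/-- With `ν = 0` the identities for general `R` and `S` specialize to `R = S = 1`, the case needed
for `tr Λ²`. -/
theorem zero (A B : 𝔸) : IsInversePair 0 A B 1 1 := by constructor <;> simp

end IsInversePair

theorem exists_isInversePair {𝔸 : Type*} [NormedRing 𝔸] [NormedAlgebra ℝ 𝔸] [CompleteSpace 𝔸]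
    {ν : ℝ} {A B : 𝔸} (h1 : ‖(-ν) • (B * A)‖ < 1) (h2 : ‖(-ν) • (A * B)‖ < 1) :
    IsInversePair ν A B (∑' n : ℕ, ((-ν) • (B * A)) ^ n) (∑' n : ℕ, ((-ν) • (A * B)) ^ n) := by
  have e : ∀ T : 𝔸, 1 + ν • T = 1 - (-ν) • T := fun T => by rw [neg_smul, sub_neg_eq_add]
  refine ⟨?_, ?_, ?_, ?_⟩
  · rw [e]; exact geom_series_mul_neg _ h1
  · rw [e]; exact mul_neg_geom_series _ h1
  · rw [e]; exact geom_series_mul_neg _ h2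
  · rw [e]; exact mul_neg_geom_series _ h2

end Algebra

section
variable {X : Type} [AddCommGroup X] [TopologicalSpace X] [IsTopologicalAddGroup X]
  [T2Space X] [LocallyCompactSpace X] [SecondCountableTopology X] [MeasureSpace X] [BorelSpace X]
  [(volume : Measure X).IsAddHaarMeasure] [Geometry X] [RegularGeometry X]

/-! ## The Green's function -/

/-- A resolvent kernel together with its reflection. -/
structure ResolventPair (κ ε : ℝ) (k k' : X → ℝ) : Prop where
  fst : IsResolventKernel κ ε k
  snd : IsResolventKernel κ (-ε) k'
  apply_neg : ∀ z, k (-z) = k' z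

theorem resolventPair {κ : ℝ} (hκ : 1 ≤ κ) :
    ResolventPair κ 1 (Geometry.kerPlus κ : X → ℝ) (Geometry.kerMinus κ) where
  fst := RegularGeometry.kerPlus κ hκ
  snd := by
    rw [show (Geometry.kerMinus κ : X → ℝ) = fun z => Geometry.kerPlus κ (-z) from
      funext (RegularGeometry.kerMinus_eq κ)]
    exact (RegularGeometry.kerPlus κ hκ).neg
  apply_neg z := (RegularGeometry.kerMinus_eq κ z).symm

namespace ResolventPair

variable {κ ε : ℝ} {k k' : X → ℝ}

theorem swap (h : ResolventPair κ ε k k') : ResolventPair κ (-ε) k' k where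
  fst := h.snd
  snd := by rw [neg_neg]; exact h.fst
  apply_neg z := by rw [← h.apply_neg, neg_neg]

theorem eq_neg (h : ResolventPair κ ε k k') : k' = fun z => k (-z) :=
  funext fun z => (h.apply_neg z).symm

theorem inner_res (h : ResolventPair κ ε k k') (f g : L2 X) :
    inner ℝ (h.fst.res f) g = inner ℝ f (h.snd.res g) := by
  obtain rfl := h.eq_neg
  exact h.fst.inner_res f g

theorem inner_op (h : ResolventPair κ ε k k') (q w f : L2 X) :
    inner ℝ w (h.fst.op q f) = ∫ z, q z * inner ℝ (h.snd.vec z) w * f z := by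
  obtain rfl := h.eq_neg
  exact h.fst.inner_op q w f

theorem inner_op_vec (h : ResolventPair κ ε k k') (q w : L2 X) (x : X) :
    inner ℝ w (h.fst.op q (h.fst.vec x)) = inner ℝ (h.fst.mulVec q x) (h.snd.res w) := by
  obtain rfl := h.eq_neg
  exact h.fst.inner_op_vec q w x

theorem prim_op_vec (h : ResolventPair κ ε k k') (q w : L2 X) :
    Prim (fun s => inner ℝ w (h.fst.op q (h.fst.vec (Geometry.proj s))))
      (fun s => ε * (q (Geometry.proj s) * inner ℝ (h.snd.vec (Geometry.proj s)) w -
        κ * inner ℝ w (h.fst.op q (h.fst.vec (Geometry.proj s))))) := by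
  obtain rfl := h.eq_neg
  exact h.fst.prim_op_vec q w

theorem inner_op_res (h : ResolventPair κ ε k k') (q w f : L2 X) :
    inner ℝ w (h.fst.op q (h.snd.res f)) = inner ℝ f (h.fst.op q (h.snd.res w)) := by
  obtain rfl := h.eq_neg
  exact h.fst.inner_op_res q w f

theorem integral_inner_vec_mul (h : ResolventPair κ ε k k') (w f : L2 X) :
    Integrable (fun y => inner ℝ w (h.fst.vec y) * f y) ∧
      ∫ y, inner ℝ w (h.fst.vec y) * f y = inner ℝ w (h.snd.res f) := by
  have e : (fun y => h.fst.res w y * f y) =ᵐ[volume]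
      fun y => inner ℝ w (h.fst.vec y) * f y := by
    filter_upwards [h.fst.coeFn_res w] with y hy
    rw [hy, real_inner_comm]
  refine ⟨(integrable_mul_L2 (Lp.memLp _) (Lp.memLp f)).congr e, ?_⟩
  rw [← integral_congr_ae e, ← inner_L2, h.inner_res]

/-- The operator `T D'` has kernel `⟨w, T v_y⟩` when tested against `w`; moving `T` to `w` reduces
this to `T = 1`. The entries of the Green's function are integrated against `f` in this way. -/
theorem integral_inner_mul (h : ResolventPair κ ε k k') (T : L2 X →L[ℝ] L2 X) (w f : L2 X) :
    Integrable (fun y => inner ℝ w (T (h.fst.vec y)) * f y) ∧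
      ∫ y, inner ℝ w (T (h.fst.vec y)) * f y = inner ℝ w (T (h.snd.res f)) := by
  simpa only [ContinuousLinearMap.adjoint_inner_left] using
    h.integral_inner_vec_mul (ContinuousLinearMap.adjoint T w) f

/-- The Green's function of `L_q(κ)`. -/
def green (h : ResolventPair κ ε k k') (μ : ℝ) (q : L2 X) (R S : L2 X →L[ℝ] L2 X) (x y : X) :
    Matrix (Fin 2) (Fin 2) ℝ :=
  !![k' (x - y) - μ * inner ℝ (h.snd.mulVec q x) ((h.fst.op q * R) (h.fst.vec y)),
    -inner ℝ (h.snd.mulVec q x) (S (h.snd.vec y));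
    μ * inner ℝ (h.fst.mulVec q x) (R (h.fst.vec y)),
    k (x - y) - μ * inner ℝ (h.fst.mulVec q x) ((R * h.snd.op q) (h.snd.vec y))]

theorem continuous_inner_mulVec (h : IsResolventKernel κ ε k) {ε' : ℝ}
    (h' : IsResolventKernel κ ε' k') (q : L2 X) (T : L2 X →L[ℝ] L2 X) :
    Continuous fun z : X × X => inner ℝ (h.mulVec q z.1) (T (h'.vec z.2)) :=
  ((h.continuous_mulVec q).comp continuous_fst).inner
    (T.continuous.comp (h'.continuous_vec.comp continuous_snd))

/-- The two components of the equation `L_q(κ) u = f`. -/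
theorem laxEquation_iff {μ : ℝ} (h : ResolventPair κ 1 k k') (q : L2 X) (u f : Fin 2 → L2 X) :
    LaxEquation μ κ q u f ↔ u 0 = h.snd.res (f 0) - h.snd.op q (u 1) ∧
      u 1 = h.fst.res (f 1) + μ • h.fst.op q (u 0) := by
  constructor
  · rintro ⟨u', hu', h0, h1⟩
    -- The equation itself shows that `q u₁` is in `L²`: every other term is.
    have m0 : MemLp (fun x => q x * u 1 x) 2 volume := by
      refine MemLp.ae_eq (f := fun x => f 0 x - κ * u 0 x + u' 0 x) ?_
        (((Lp.memLp (f 0)).sub ((Lp.memLp (u 0)).const_mul κ)).add (hu' 0).2.1)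
      filter_upwards [h0] with x hx
      rw [hx]; ring
    have m1 : MemLp (fun x => q x * (μ • u 0) x) 2 volume := by
      refine MemLp.ae_eq (f := fun x => -f 1 x + κ * u 1 x + u' 1 x) ?_
        (((Lp.memLp (f 1)).neg.add ((Lp.memLp (u 1)).const_mul κ)).add (hu' 1).2.1)
      filter_upwards [h1, Lp.coeFn_smul μ (u 0)] with x hx hs
      rw [hx, hs, Pi.smul_apply, smul_eq_mul]; ring
    constructor
    · have := h.snd.eq_res_of_hasWeakDeriv (u := u 0) (g := f 0 - m0.toLp _) (hu' 0) (by
        filter_upwards [h0, Lp.coeFn_sub (f 0) (m0.toLp _), m0.coeFn_toLp] with x hx hs hm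
        rw [hs, Pi.sub_apply, hm, hx]; ring)
      rw [this, map_sub, h.snd.res_toLp_mul]
    · have := h.fst.eq_res_of_hasWeakDeriv (u := u 1) (g := f 1 + m1.toLp _) (hu' 1) (by
        filter_upwards [h1, Lp.coeFn_add (f 1) (m1.toLp _), m1.coeFn_toLp,
          Lp.coeFn_smul μ (u 0)] with x hx hs hm hμ
        rw [hs, Pi.add_apply, hm, hx, hμ, Pi.smul_apply, smul_eq_mul]; ring)
      rw [this, map_add, h.fst.res_toLp_mul, map_smul]
  · rintro ⟨h0, h1⟩
    have e0 : (u 0 : X → ℝ) =ᵐ[volume]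
        fun x => inner ℝ (h.snd.vec x) (f 0) - inner ℝ (h.snd.mulVec q x) (u 1) := by
      conv_lhs => rw [h0]
      filter_upwards [Lp.coeFn_sub (h.snd.res (f 0)) (h.snd.op q (u 1)), h.snd.coeFn_res (f 0),
        h.snd.coeFn_op q (u 1)] with x a b c
      rw [a, Pi.sub_apply, b, c]
    have e1 : (u 1 : X → ℝ) =ᵐ[volume]
        fun x => inner ℝ (h.fst.vec x) (f 1) + μ * inner ℝ (h.fst.mulVec q x) (u 0) := by
      conv_lhs => rw [h1]
      filter_upwards [Lp.coeFn_add (h.fst.res (f 1)) (μ • h.fst.op q (u 0)),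
        h.fst.coeFn_res (f 1), h.fst.coeFn_op q (u 0),
        Lp.coeFn_smul μ (h.fst.op q (u 0))] with x a b c d
      rw [a, Pi.add_apply, b, d, Pi.smul_apply, c, smul_eq_mul]
    -- Continuous representatives of `u 0` and `u 1`. They are bounded by Cauchy–Schwarz, so their
    -- products with `q` are in `L²` and may enter weak derivatives.
    set w0 : X → ℝ := fun x => inner ℝ (h.snd.vec x) (f 0) - inner ℝ (h.snd.mulVec q x) (u 1)
    set w1 : X → ℝ := fun x => inner ℝ (h.fst.vec x) (f 1) +
      μ * inner ℝ (h.fst.mulVec q x) (u 0)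
    have c0 : Continuous w0 := (h.snd.continuous_vec.inner continuous_const).sub
      ((h.snd.continuous_mulVec q).inner continuous_const)
    have c1 : Continuous w1 := (h.fst.continuous_vec.inner continuous_const).add
      (((h.fst.continuous_mulVec q).inner continuous_const).const_mul μ)
    have hqm := (Lp.stronglyMeasurable q).measurable
    have b0 : MemLp (fun x => q x * w0 x) 2 volume := by
      refine MemLp.mono ((Lp.memLp q).mul_const (Real.sqrt (2 / κ) * ‖f 0‖ + 2 * ‖q‖ * ‖u 1‖))
        (hqm.mul c0.measurable).aestronglyMeasurable (Eventually.of_forall fun x => ?_)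
      rw [norm_mul, norm_mul]
      refine mul_le_mul_of_nonneg_left ?_ (norm_nonneg _)
      refine ((abs_sub _ _).trans (add_le_add (h.snd.abs_inner_vec_le x (f 0))
        (h.snd.abs_inner_mulVec_le q x (u 1)))).trans (le_abs_self _)
    have b1 : MemLp (fun x => q x * w1 x) 2 volume := by
      refine MemLp.mono ((Lp.memLp q).mul_const
        (Real.sqrt (2 / κ) * ‖f 1‖ + |μ| * (2 * ‖q‖ * ‖u 0‖)))
        (hqm.mul c1.measurable).aestronglyMeasurable (Eventually.of_forall fun x => ?_)
      rw [norm_mul, norm_mul]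
      refine mul_le_mul_of_nonneg_left ?_ (norm_nonneg _)
      refine ((abs_add_le _ _).trans (add_le_add (h.fst.abs_inner_vec_le x (f 1)) ?_)).trans
        (le_abs_self _)
      rw [abs_mul]
      exact mul_le_mul_of_nonneg_left (h.fst.abs_inner_mulVec_le q x (u 0)) (abs_nonneg _)
    have l0 : MemLp w0 2 volume := (Lp.memLp (u 0)).ae_eq e0
    have l1 : MemLp w1 2 volume := (Lp.memLp (u 1)).ae_eq e1
    have d0 : HasWeakDeriv w0 fun x => κ * w0 x - f 0 x + q x * w1 x := by
      refine hasWeakDeriv_of_prim l0 (((l0.const_mul κ).sub (Lp.memLp (f 0))).add b1)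
        (((c0.measurable.const_mul κ).sub (Lp.stronglyMeasurable (f 0)).measurable).add
          (hqm.mul c1.measurable)) ?_
      refine ((h.snd.prim_vec (f 0)).add ((h.snd.prim_mulVec q (u 1) c1.measurable
        e1).const_mul (-1))).congr (fun s => ?_) fun s => ?_
      · simp only [w0]; ring
      · simp only [w0]; ring
    have d1 : HasWeakDeriv w1 fun x => f 1 x + μ * (q x * w0 x) - κ * w1 x := by
      refine hasWeakDeriv_of_prim l1 (((Lp.memLp (f 1)).add (b0.const_mul μ)).sub
        (l1.const_mul κ)) (((Lp.stronglyMeasurable (f 1)).measurable.add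
          ((hqm.mul c0.measurable).const_mul μ)).sub (c1.measurable.const_mul κ)) ?_
      refine ((h.fst.prim_vec (f 1)).add ((h.fst.prim_mulVec q (u 0) c0.measurable
        e0).const_mul μ)).congr (fun s => ?_) fun s => ?_
      · simp only [w1]
      · simp only [w1]; ring
    refine ⟨![fun x => κ * w0 x - f 0 x + q x * w1 x,
      fun x => f 1 x + μ * (q x * w0 x) - κ * w1 x], ?_, ?_, ?_⟩
    · intro i
      fin_cases i
      · exact d0.congr e0 (ae_eq_refl _)
      · exact d1.congr e1 (ae_eq_refl _)
    · filter_upwards [e0, e1] with x h0 h1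
      rw [h0, h1]
      simp only [Matrix.cons_val_zero]
      ring
    · filter_upwards [e0, e1] with x h0 h1
      rw [h0, h1]
      change f 1 x = -μ * q x * w0 x + κ * w1 x + (f 1 x + μ * (q x * w0 x) - κ * w1 x)
      ring

/-- Substituting `u₁ = D f₁ + μP u₀` into `u₀ = D' f₀ - P' u₁` gives `u₀ = R(D' f₀ - P'D f₁)`. Apart
from the free kernels, every entry has the form `⟨q v_x, T v_y⟩` for one of the two signs in each
slot, jointly continuous in `(x, y)`. -/
theorem isGreenFunction {μ : ℝ} (h : ResolventPair κ 1 (Geometry.kerPlus κ : X → ℝ)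
    (Geometry.kerMinus κ)) {q : L2 X} {R S : L2 X →L[ℝ] L2 X}
    (hRS : IsInversePair μ (h.fst.op q) (h.snd.op q) R S) :
    IsGreenFunction μ κ q (h.green μ q R S) where
  continuous_sub i j := by
    fin_cases i <;> fin_cases j <;> simp only [green, freeGreen, Fin.zero_eta, Fin.mk_one,
      Matrix.of_apply, Matrix.cons_val_zero, Matrix.cons_val_one, Matrix.cons_val', sub_zero,
      sub_sub_cancel_left, Fin.isValue, Matrix.cons_val_fin_one]
    · exact ((continuous_inner_mulVec h.snd h.fst q _).const_mul μ).neg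
    · exact (continuous_inner_mulVec h.snd h.snd q _).neg
    · exact (continuous_inner_mulVec h.fst h.fst q _).const_mul μ
    · exact ((continuous_inner_mulVec h.fst h.snd q _).const_mul μ).neg
  surjective f := by
    set u0 := R (h.snd.res (f 0) - h.snd.op q (h.fst.res (f 1))) with hu0
    refine ⟨![u0, h.fst.res (f 1) + μ • h.fst.op q u0], (h.laxEquation_iff q _ f).2 ⟨?_, rfl⟩⟩
    simp only [Matrix.cons_val_zero, Matrix.cons_val_one]
    have := congrArg (fun T : L2 X →L[ℝ] L2 X =>
      T (h.snd.res (f 0) - h.snd.op q (h.fst.res (f 1)))) hRS.mul_left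
    simp only [mul_apply_eq_comp, one_apply_eq_self, add_apply,
      smul_apply, ← hu0] at this
    rw [map_add, map_smul, sub_add_eq_sub_sub, ← this]
    abel
  kernel u f huf := by
    obtain ⟨h0, h1⟩ := (h.laxEquation_iff q u f).1 huf
    have hu0 : u 0 = R (h.snd.res (f 0) - h.snd.op q (h.fst.res (f 1))) := by
      have e : (1 + μ • (h.snd.op q * h.fst.op q)) (u 0) =
          h.snd.res (f 0) - h.snd.op q (h.fst.res (f 1)) := by
        simp only [add_apply, smul_apply, mul_apply_eq_comp,
          one_apply_eq_self]
        conv_lhs => enter [1]; rw [h0, h1]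
        rw [map_add, map_smul]
        abel
      rw [← e, ← mul_apply_eq_comp, hRS.left_mul, one_apply_eq_self]
    have i00 := fun x => h.integral_inner_mul (h.fst.op q * R) (h.snd.mulVec q x) (f 0)
    have i01 := fun x => h.swap.integral_inner_mul S (h.snd.mulVec q x) (f 1)
    have i10 := fun x => h.integral_inner_mul R (h.fst.mulVec q x) (f 0)
    have i11 := fun x => h.swap.integral_inner_mul (R * h.snd.op q) (h.fst.mulVec q x) (f 1)
    have j0 := fun x => h.snd.integrable_mul_of_memLp (Lp.memLp (f 0)) x
    have j1 := fun x => h.fst.integrable_mul_of_memLp (Lp.memLp (f 1)) x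
    have hM : ∀ x, (∀ i j, Integrable fun y => h.green μ q R S x y i j * f j y) ∧
        ((∫ y, h.green μ q R S x y 0 0 * f 0 y) + ∫ y, h.green μ q R S x y 0 1 * f 1 y) =
          inner ℝ (h.snd.vec x) (f 0) -
            μ * inner ℝ (h.snd.mulVec q x) ((h.fst.op q * R) (h.snd.res (f 0))) -
            inner ℝ (h.snd.mulVec q x) (S (h.fst.res (f 1))) ∧
        ((∫ y, h.green μ q R S x y 1 0 * f 0 y) + ∫ y, h.green μ q R S x y 1 1 * f 1 y) =
          μ * inner ℝ (h.fst.mulVec q x) (R (h.snd.res (f 0))) + (inner ℝ (h.fst.vec x) (f 1) -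
            μ * inner ℝ (h.fst.mulVec q x) ((R * h.snd.op q) (h.fst.res (f 1)))) := by
      intro x
      have g00 : (fun y => h.green μ q R S x y 0 0 * f 0 y) = fun y =>
          Geometry.kerMinus κ (x - y) * f 0 y - μ * (inner ℝ (h.snd.mulVec q x)
            ((h.fst.op q * R) (h.fst.vec y)) * f 0 y) := by
        funext y; simp only [green, Matrix.of_apply, Matrix.cons_val_zero]; ring
      have g01 : (fun y => h.green μ q R S x y 0 1 * f 1 y) = fun y =>
          -(inner ℝ (h.snd.mulVec q x) (S (h.snd.vec y)) * f 1 y) := by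
        funext y
        simp only [green, Matrix.of_apply, Matrix.cons_val_zero, Matrix.cons_val_one,
          Matrix.cons_val', Matrix.cons_val_fin_one]
        ring
      have g10 : (fun y => h.green μ q R S x y 1 0 * f 0 y) = fun y =>
          μ * (inner ℝ (h.fst.mulVec q x) (R (h.fst.vec y)) * f 0 y) := by
        funext y
        simp only [green, Matrix.of_apply, Matrix.cons_val_zero, Matrix.cons_val_one,
          Matrix.cons_val', Matrix.cons_val_fin_one]
        ring
      have g11 : (fun y => h.green μ q R S x y 1 1 * f 1 y) = fun y =>
          Geometry.kerPlus κ (x - y) * f 1 y - μ * (inner ℝ (h.fst.mulVec q x)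
            ((R * h.snd.op q) (h.snd.vec y)) * f 1 y) := by
        funext y
        simp only [green, Matrix.of_apply, Matrix.cons_val_one, Matrix.cons_val',
          Matrix.cons_val_fin_one]
        ring
      refine ⟨fun i j => ?_, ?_, ?_⟩
      · fin_cases i <;> fin_cases j <;> simp only [Fin.zero_eta, Fin.mk_one, Fin.isValue]
        · rw [g00]; exact (j0 x).sub ((i00 x).1.const_mul μ)
        · rw [g01]; exact (i01 x).1.neg
        · rw [g10]; exact (i10 x).1.const_mul μ
        · rw [g11]; exact (j1 x).sub ((i11 x).1.const_mul μ)
      · rw [g00, g01, integral_sub (j0 x) ((i00 x).1.const_mul μ), integral_neg,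
          integral_const_mul, (i00 x).2, (i01 x).2, h.snd.inner_vec, conv, sub_eq_add_neg _
            (inner ℝ (h.snd.mulVec q x) (S (h.fst.res (f 1))))]
        rfl
      · rw [g10, g11, integral_sub (j1 x) ((i11 x).1.const_mul μ), integral_const_mul,
          integral_const_mul, (i10 x).2, (i11 x).2, h.fst.inner_vec, conv]
        rfl
    -- `R = 1 - μP'PR` and `RP' = P'S` bring a resolvent or an operator `P'` to the left of every
    -- term, so that its value at `x` is an inner product with a kernel vector.
    have a0 : u 0 = h.snd.res (f 0) - (μ • h.snd.op q ((h.fst.op q * R) (h.snd.res (f 0))) +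
        h.snd.op q (S (h.fst.res (f 1)))) := by
      have e : R (h.snd.op q (h.fst.res (f 1))) = h.snd.op q (S (h.fst.res (f 1))) :=
        congrArg (fun T : L2 X →L[ℝ] L2 X => T (h.fst.res (f 1))) hRS.swap.comm.symm
      rw [hu0, map_sub, e, sub_add_eq_sub_sub]
      conv_lhs => enter [1]; rw [hRS.eq_sub]
      simp only [sub_apply, one_apply_eq_self, smul_apply, mul_apply_eq_comp]
    have a1 : u 1 = h.fst.res (f 1) + μ • (h.fst.op q (R (h.snd.res (f 0))) -
        h.fst.op q ((R * h.snd.op q) (h.fst.res (f 1)))) := by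
      conv_lhs => rw [h1, hu0]
      simp only [map_sub, mul_apply_eq_comp]
    intro i
    fin_cases i <;> simp only [Fin.zero_eta, Fin.mk_one, Fin.isValue, Fin.sum_univ_two]
    · set F0 := h.snd.op q ((h.fst.op q * R) (h.snd.res (f 0))) with hF0
      set F1 := h.snd.op q (S (h.fst.res (f 1))) with hF1
      filter_upwards [Lp.coeFn_sub (h.snd.res (f 0)) (μ • F0 + F1), Lp.coeFn_add (μ • F0) F1,
        Lp.coeFn_smul μ F0, h.snd.coeFn_res (f 0),
        h.snd.coeFn_op q ((h.fst.op q * R) (h.snd.res (f 0))),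
        h.snd.coeFn_op q (S (h.fst.res (f 1)))] with x b1 b2 b3 b4 b5 b6
      refine ⟨fun j => (hM x).1 0 j, ?_⟩
      rw [(hM x).2.1, a0, b1, Pi.sub_apply, b2, Pi.add_apply, b3, Pi.smul_apply, b4, hF0, b5,
        hF1, b6, smul_eq_mul]
      ring
    · set F0 := h.fst.op q (R (h.snd.res (f 0))) with hF0
      set F1 := h.fst.op q ((R * h.snd.op q) (h.fst.res (f 1))) with hF1
      filter_upwards [Lp.coeFn_add (h.fst.res (f 1)) (μ • (F0 - F1)), Lp.coeFn_sub F0 F1,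
        Lp.coeFn_smul μ (F0 - F1), h.fst.coeFn_res (f 1),
        h.fst.coeFn_op q (R (h.snd.res (f 0))),
        h.fst.coeFn_op q ((R * h.snd.op q) (h.fst.res (f 1)))] with x b1 b2 b3 b4 b5 b6
      refine ⟨fun j => (hM x).1 1 j, ?_⟩
      rw [(hM x).2.2, a1, b1, Pi.add_apply, b3, Pi.smul_apply, b2, Pi.sub_apply, b4, hF0, b5,
        hF1, b6, smul_eq_mul]
      ring

end ResolventPair
end

section
variable {X : Type} [AddCommGroup X] [TopologicalSpace X] [IsTopologicalAddGroup X]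
  [T2Space X] [LocallyCompactSpace X] [SecondCountableTopology X] [MeasureSpace X] [BorelSpace X]
  [(volume : Measure X).IsAddHaarMeasure] [Geometry X] [RegularGeometry X]

/-! ## Differential equations on the diagonal of the Green's function -/

/-- If `u = (1 + ∂)⁻¹q` then `q = u' + u`, with `u'` locally integrable and `u` continuous along the
covering. -/
theorem intervalIntegrable_comp_proj (q : L2 X) (a b : ℝ) :
    IntervalIntegrable (fun s => q (Geometry.proj s)) volume a b := by
  have hk := RegularGeometry.kerPlus (X := X) 1 le_rfl
  have h1 := (hk.prim_vec q).intervalIntegrable a b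
  have h2 : Continuous fun s : ℝ => inner ℝ (hk.vec (Geometry.proj s)) q :=
    (hk.continuous_vec.comp RegularGeometry.continuous_proj).inner continuous_const
  refine (h1.add (h2.intervalIntegrable a b)).congr (fun s _ => ?_)
  simp

namespace ResolventPair

variable {κ ε ν : ℝ} {k k' : X → ℝ}

/-- `⟨q v_x, R v_x⟩`, where `v_x = k (x - ·)`. -/
def diagT (h : ResolventPair κ ε k k') (q : L2 X) (R : L2 X →L[ℝ] L2 X) (x : X) : ℝ :=
  inner ℝ (h.fst.mulVec q x) (R (h.fst.vec x))

/-- `⟨q v'_x, P R v_x⟩`, where `v_x = k (x - ·)`, `v'_x = k' (x - ·)`. -/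
def diagU (h : ResolventPair κ ε k k') (q : L2 X) (R : L2 X →L[ℝ] L2 X) (x : X) : ℝ :=
  inner ℝ (h.snd.mulVec q x) (h.fst.op q (R (h.fst.vec x)))

theorem op_res (h : ResolventPair κ ε k k') (q f : L2 X) :
    h.fst.op q (h.snd.res f) =
      h.fst.res (ContinuousLinearMap.adjoint (h.fst.op q) f) := by
  refine ext_inner_left ℝ fun w => ?_
  rw [h.inner_op_res, ← ContinuousLinearMap.adjoint_inner_left, ← h.inner_res, real_inner_comm]

theorem swap_op_res (h : ResolventPair κ ε k k') (q f : L2 X) :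
    h.snd.op q (h.fst.res f) =
      h.snd.res (ContinuousLinearMap.adjoint (h.snd.op q) f) := h.swap.op_res q f

theorem swap_inner_op_vec (h : ResolventPair κ ε k k') (q w : L2 X) (x : X) :
    inner ℝ w (h.snd.op q (h.snd.vec x)) = inner ℝ (h.snd.mulVec q x) (h.fst.res w) :=
  h.swap.inner_op_vec q w x

theorem op_op_res (h : ResolventPair κ ε k k') (q f : L2 X) :
    h.fst.op q (h.snd.op q (h.fst.res f)) =
      h.fst.res (ContinuousLinearMap.adjoint (h.snd.op q * h.fst.op q) f) := by
  rw [h.swap_op_res, h.op_res, ContinuousLinearMap.mul_def, ContinuousLinearMap.adjoint_comp]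
  rfl

/-- Since `PP'D = D(P'P)*`, the operator `D` intertwines `(1 + νP'P)*` with `1 + νPP'`, hence also
their inverses. -/
theorem res_adjoint (h : ResolventPair κ ε k k') {q : L2 X} {R S : L2 X →L[ℝ] L2 X}
    (hRS : IsInversePair ν (h.fst.op q) (h.snd.op q) R S) (f : L2 X) :
    h.fst.res (ContinuousLinearMap.adjoint R f) = S (h.fst.res f) := by
  set g := ContinuousLinearMap.adjoint R f with hg
  have e1 : g + ν • ContinuousLinearMap.adjoint (h.snd.op q * h.fst.op q) g = f := by
    refine ext_inner_left ℝ fun w => ?_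
    have := congrArg (fun T : L2 X →L[ℝ] L2 X => T w) hRS.left_mul
    simp only [mul_apply_eq_comp, add_apply, smul_apply, one_apply_eq_self, map_add,
      map_smul] at this
    rw [inner_add_right, inner_smul_right, ContinuousLinearMap.adjoint_inner_right, hg,
      ContinuousLinearMap.adjoint_inner_right, ContinuousLinearMap.adjoint_inner_right]
    conv_rhs => rw [← this]
    rw [inner_add_left, real_inner_smul_left]
    rfl
  have e2 := congrArg (fun T : L2 X →L[ℝ] L2 X => T (h.fst.res g)) hRS.right_mul
  simp only [mul_apply_eq_comp, add_apply, smul_apply, one_apply_eq_self] at e2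
  rw [h.op_op_res, ← map_smul, ← map_add, e1] at e2
  exact e2.symm

/-- Transposition: passing `R` to the other side and applying `D R* = S D` exchanges the two signs.
It identifies `u` with its reflected counterpart and provides the derivative in the second variable.
-/
theorem inner_mulVec_symm (h : ResolventPair κ ε k k') {q : L2 X} {R S : L2 X →L[ℝ] L2 X}
    (hRS : IsInversePair ν (h.fst.op q) (h.snd.op q) R S) (x y : X) :
    inner ℝ (h.fst.mulVec q x) (R (h.snd.op q (h.snd.vec y))) =
      inner ℝ (h.snd.mulVec q y) (S (h.fst.op q (h.fst.vec x))) := by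
  rw [← ContinuousLinearMap.adjoint_inner_left, h.swap_inner_op_vec, h.res_adjoint hRS,
    h.fst.op_vec]

theorem op_apply_comm (h : ResolventPair κ ε k k') {q : L2 X} {R S : L2 X →L[ℝ] L2 X}
    (hRS : IsInversePair ν (h.fst.op q) (h.snd.op q) R S) (f : L2 X) :
    h.fst.op q (R f) = S (h.fst.op q f) :=
  congrArg (fun T : L2 X →L[ℝ] L2 X => T f) hRS.comm

/-- One function `u` thus serves both in the equation for `t` and in that for `t'`. -/
theorem diagU_swap (h : ResolventPair κ ε k k') {q : L2 X} {R S : L2 X →L[ℝ] L2 X}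
    (hRS : IsInversePair ν (h.fst.op q) (h.snd.op q) R S) (x : X) :
    h.swap.diagU q S x = h.diagU q R x := by
  rw [diagU, diagU, h.op_apply_comm hRS, h.swap.op_apply_comm hRS.swap]
  exact h.inner_mulVec_symm hRS x x

theorem continuous_inner_proj (h : IsResolventKernel κ ε k) {ε' : ℝ}
    (h' : IsResolventKernel κ ε' k') (q : L2 X) (T : L2 X →L[ℝ] L2 X) :
    Continuous fun z : ℝ × ℝ => inner ℝ (h.mulVec q (Geometry.proj z.1))
      (T (h'.vec (Geometry.proj z.2))) :=
  (continuous_inner_mulVec h h' q T).comp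
    ((RegularGeometry.continuous_proj.comp continuous_fst).prodMk
      (RegularGeometry.continuous_proj.comp continuous_snd))

/-- An operator `P` acts on `v_x` and a `P'` stands next to `q v_y`, so both partial derivatives are
continuous up to a factor `q` and the diagonal rule applies. By the transposition symmetry the two
variables contribute equally, whence the factors `2`. -/
theorem prim_inner_op_op (h : ResolventPair κ ε k k') {q : L2 X} {R S : L2 X →L[ℝ] L2 X}
    (hRS : IsInversePair ν (h.fst.op q) (h.snd.op q) R S) :
    Prim (fun s => inner ℝ (h.fst.mulVec q (Geometry.proj s))
        (h.snd.op q (S (h.fst.op q (h.fst.vec (Geometry.proj s))))))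
      (fun s => ε * (2 * q (Geometry.proj s) * h.diagU q R (Geometry.proj s) -
        2 * κ * inner ℝ (h.fst.mulVec q (Geometry.proj s))
        (h.snd.op q (S (h.fst.op q (h.fst.vec (Geometry.proj s))))))) := by
  let Φ : ℝ → ℝ → ℝ := fun y x => inner ℝ (h.fst.mulVec q (Geometry.proj y))
    ((h.snd.op q * S * h.fst.op q) (h.fst.vec (Geometry.proj x)))
  let U : ℝ → ℝ → ℝ := fun y x => inner ℝ (h.snd.mulVec q (Geometry.proj y))
    ((S * h.fst.op q) (h.fst.vec (Geometry.proj x)))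
  have hΦ : Continuous fun z : ℝ × ℝ => Φ z.1 z.2 := continuous_inner_proj h.fst h.fst q _
  have hU : Continuous fun z : ℝ × ℝ => U z.1 z.2 := continuous_inner_proj h.snd h.fst q _
  refine (Prim.diag (Φ := Φ) (c := fun s => q (Geometry.proj s))
    (c' := fun s => q (Geometry.proj s)) (A := fun y x => ε * U y x)
    (B := fun y x => -(ε * κ) * Φ y x) (A' := fun y x => ε * U x y)
    (B' := fun y x => -(ε * κ) * Φ y x) (intervalIntegrable_comp_proj q)
    (intervalIntegrable_comp_proj q) (hU.const_mul ε) (hΦ.const_mul _)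
    ((hU.comp continuous_swap).const_mul ε) (hΦ.const_mul _) ?_ ?_).congr (fun _ => rfl) fun s => ?_
  · intro x
    have hc : Continuous fun y : X => inner ℝ (h.snd.mulVec q y)
        (S (h.fst.op q (h.fst.vec (Geometry.proj x)))) :=
      (h.snd.continuous_mulVec q).inner continuous_const
    refine (h.fst.prim_mulVec q _ hc.measurable (h.snd.coeFn_op q _)).congr (fun _ => rfl)
      fun s => ?_
    simp only [U, Φ, mul_apply_eq_comp]
    ring
  · intro y
    refine (h.prim_op_vec q (ContinuousLinearMap.adjoint (h.snd.op q * S)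
      (h.fst.mulVec q (Geometry.proj y)))).congr (fun s => ?_) fun s => ?_
    · rw [ContinuousLinearMap.adjoint_inner_left]; rfl
    · rw [ContinuousLinearMap.adjoint_inner_left, ContinuousLinearMap.adjoint_inner_right,
        real_inner_comm, mul_apply_eq_comp, h.swap.op_apply_comm hRS.swap,
        h.inner_mulVec_symm hRS]
      simp only [U, Φ, mul_apply_eq_comp]
      ring
  · rw [diagU, h.op_apply_comm hRS]
    simp only [U, Φ, mul_apply_eq_comp]
    ring

/-- The two slots carry kernels of opposite sign, so the terms in `κ` cancel on the diagonal. -/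
theorem prim_diagU (h : ResolventPair κ ε k k') {q : L2 X} {R S : L2 X →L[ℝ] L2 X}
    (hRS : IsInversePair ν (h.fst.op q) (h.snd.op q) R S) :
    Prim (fun s => h.diagU q R (Geometry.proj s))
      (fun s => ε * (q (Geometry.proj s) *
        (h.swap.diagT q S (Geometry.proj s) - h.diagT q R (Geometry.proj s)))) := by
  let Φ : ℝ → ℝ → ℝ := fun y x => inner ℝ (h.snd.mulVec q (Geometry.proj y))
    ((h.fst.op q * R) (h.fst.vec (Geometry.proj x)))
  let T : ℝ → ℝ → ℝ := fun y x => inner ℝ (h.fst.mulVec q (Geometry.proj y))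
    (R (h.fst.vec (Geometry.proj x)))
  let T' : ℝ → ℝ → ℝ := fun y x => inner ℝ (h.snd.mulVec q (Geometry.proj y))
    (S (h.snd.vec (Geometry.proj x)))
  have hΦ : Continuous fun z : ℝ × ℝ => Φ z.1 z.2 := continuous_inner_proj h.snd h.fst q _
  have hT : Continuous fun z : ℝ × ℝ => T z.1 z.2 := continuous_inner_proj h.fst h.fst q _
  have hT' : Continuous fun z : ℝ × ℝ => T' z.1 z.2 := continuous_inner_proj h.snd h.snd q _
  refine (Prim.diag (Φ := Φ) (c := fun s => q (Geometry.proj s))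
    (c' := fun s => q (Geometry.proj s)) (A := fun y x => -ε * T y x)
    (B := fun y x => (ε * κ) * Φ y x) (A' := fun y x => ε * T' y x)
    (B' := fun y x => -(ε * κ) * Φ y x) (intervalIntegrable_comp_proj q)
    (intervalIntegrable_comp_proj q) (hT.const_mul _) (hΦ.const_mul _)
    (hT'.const_mul ε) (hΦ.const_mul _) ?_ ?_).congr (fun _ => rfl) fun s => ?_
  · intro x
    have hc : Continuous fun y : X => inner ℝ (h.fst.mulVec q y)
        (R (h.fst.vec (Geometry.proj x))) :=
      (h.fst.continuous_mulVec q).inner continuous_const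
    refine (h.snd.prim_mulVec q _ hc.measurable (h.fst.coeFn_op q _)).congr (fun _ => rfl)
      fun s => ?_
    simp only [T, Φ, mul_apply_eq_comp]
    ring
  · intro y
    refine (h.prim_op_vec q (ContinuousLinearMap.adjoint S
      (h.snd.mulVec q (Geometry.proj y)))).congr (fun s => ?_) fun s => ?_
    · rw [ContinuousLinearMap.adjoint_inner_left, ← h.op_apply_comm hRS]; rfl
    · rw [ContinuousLinearMap.adjoint_inner_left, ContinuousLinearMap.adjoint_inner_right,
        real_inner_comm, ← h.op_apply_comm hRS]
      simp only [T', Φ, mul_apply_eq_comp]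
      ring
  · simp only [T, T', Φ, diagT]
    ring

/-- The zeroth-order diagonal term is `∫ k(x - z)² q(z) dz`, and `ℓk²` is again a resolvent kernel,
with `2κ` in place of `κ`. -/
theorem mul_inner_mulVec_vec (hk : IsResolventKernel κ ε k) {κ₂ ℓ : ℝ} {k₂ : X → ℝ}
    (hk₂ : IsResolventKernel κ₂ ε k₂) (hℓ : ∀ z, ℓ * k z ^ 2 = k₂ z) (q : L2 X) (x : X) :
    ℓ * inner ℝ (hk.mulVec q x) (hk.vec x) = inner ℝ (hk₂.vec x) q := by
  rw [hk₂.inner_vec, conv, inner_L2, ← integral_const_mul]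
  refine integral_congr_ae ?_
  filter_upwards [hk.coeFn_vec x, hk.coeFn_mulVec q x] with z h1 h2
  rw [h1, h2, ← hℓ]
  ring

/-- The diagonal rule fails for `⟨q v_y, R v_x⟩` itself: its derivative in `y` contains `v_x(y)`,
which jumps at `y = x`. Splitting `R = 1 - νP'SP` isolates the jump in the term handled by
`mul_inner_mulVec_vec`; the remainder is covered by `prim_inner_op_op`. -/
theorem prim_diagT (h : ResolventPair κ ε k k') {q : L2 X} {R S : L2 X →L[ℝ] L2 X}
    (hRS : IsInversePair ν (h.fst.op q) (h.snd.op q) R S) {ℓ : ℝ} {k₂ : X → ℝ}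
    (hk₂ : IsResolventKernel (2 * κ) ε k₂) (hℓ : ∀ z, ℓ * k z ^ 2 = k₂ z) :
    Prim (fun s => ℓ * h.diagT q R (Geometry.proj s))
      (fun s => ε * (q (Geometry.proj s) * (1 - 2 * ν * (ℓ * h.diagU q R (Geometry.proj s))) -
        2 * κ * (ℓ * h.diagT q R (Geometry.proj s)))) := by
  have e : ∀ x, ℓ * h.diagT q R x = inner ℝ (hk₂.vec x) q + (-(ℓ * ν)) *
      inner ℝ (h.fst.mulVec q x) (h.snd.op q (S (h.fst.op q (h.fst.vec x)))) := by
    intro x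
    rw [← mul_inner_mulVec_vec h.fst hk₂ hℓ, diagT]
    conv_lhs => rw [hRS.eq_sub']
    simp only [sub_apply, one_apply_eq_self, smul_apply, mul_apply_eq_comp, inner_sub_right,
      inner_smul_right]
    ring
  refine ((hk₂.prim_vec q).add ((h.prim_inner_op_op hRS).const_mul (-(ℓ * ν)))).congr
    (fun s => e _) fun s => ?_
  rw [e]
  ring

theorem continuous_diagT (h : ResolventPair κ ε k k') (q : L2 X) (R : L2 X →L[ℝ] L2 X) :
    Continuous (h.diagT q R) :=
  (h.fst.continuous_mulVec q).inner (R.continuous.comp h.fst.continuous_vec)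

theorem continuous_diagU (h : ResolventPair κ ε k k') (q : L2 X) (R : L2 X →L[ℝ] L2 X) :
    Continuous (h.diagU q R) :=
  (h.snd.continuous_mulVec q).inner ((h.fst.op q * R).continuous.comp h.fst.continuous_vec)

theorem diagT_sq_le (h : ResolventPair κ ε k k') (q : L2 X) (R : L2 X →L[ℝ] L2 X) (x : X) :
    h.diagT q R x ^ 2 ≤ ‖R‖ ^ 2 * (2 / κ) * ‖h.fst.mulVec q x‖ ^ 2 := by
  rw [← sq_abs]
  have h1 : |h.diagT q R x| ≤ ‖h.fst.mulVec q x‖ * (‖R‖ * ‖h.fst.vec x‖) :=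
    (abs_real_inner_le_norm _ _).trans
      (mul_le_mul_of_nonneg_left (R.le_opNorm _) (norm_nonneg _))
  refine (pow_le_pow_left₀ (abs_nonneg _) h1 2).trans ?_
  have h2 := h.fst.norm_vec_sq_le x
  calc (‖h.fst.mulVec q x‖ * (‖R‖ * ‖h.fst.vec x‖)) ^ 2
      = ‖h.fst.mulVec q x‖ ^ 2 * ‖R‖ ^ 2 * ‖h.fst.vec x‖ ^ 2 := by ring
    _ ≤ ‖h.fst.mulVec q x‖ ^ 2 * ‖R‖ ^ 2 * (2 / κ) :=
        mul_le_mul_of_nonneg_left h2 (by positivity)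
    _ = _ := by ring

theorem memLp_diagT (h : ResolventPair κ ε k k') (q : L2 X) (R : L2 X →L[ℝ] L2 X) :
    MemLp (h.diagT q R) 2 volume := by
  refine (memLp_two_iff_integrable_sq (h.continuous_diagT q R).aestronglyMeasurable).2 ?_
  refine ((h.fst.integrable_norm_mulVec_sq q).const_mul (‖R‖ ^ 2 * (2 / κ))).mono'
    ((h.continuous_diagT q R).pow 2).aestronglyMeasurable (Eventually.of_forall fun x => ?_)
  rw [Real.norm_eq_abs, abs_of_nonneg (sq_nonneg _)]
  exact h.diagT_sq_le q R x

/-- From `P R v_x = S D(q v_x)` the bound is quadratic in vectors whose norms are square integrable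
in `x`. Hence `u` is integrable as well as bounded. -/
theorem abs_diagU_le (h : ResolventPair κ ε k k') {q : L2 X} {R S : L2 X →L[ℝ] L2 X}
    (hRS : IsInversePair ν (h.fst.op q) (h.snd.op q) R S) (x : X) :
    |h.diagU q R x| ≤ ‖S‖ * (1 / κ) * (‖h.snd.mulVec q x‖ * ‖h.fst.mulVec q x‖) := by
  rw [diagU, h.op_apply_comm hRS, h.fst.op_vec]
  refine (abs_real_inner_le_norm _ _).trans ?_
  have h1 : ‖S (h.fst.res (h.fst.mulVec q x))‖ ≤ ‖S‖ * (1 / κ * ‖h.fst.mulVec q x‖) :=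
    (S.le_opNorm _).trans (mul_le_mul_of_nonneg_left
      ((h.fst.res.le_opNorm _).trans
        (mul_le_mul_of_nonneg_right h.fst.norm_res_le (norm_nonneg _))) (norm_nonneg _))
  refine (mul_le_mul_of_nonneg_left h1 (norm_nonneg _)).trans (le_of_eq ?_)
  ring

theorem integrable_diagU (h : ResolventPair κ ε k k') {q : L2 X} {R S : L2 X →L[ℝ] L2 X}
    (hRS : IsInversePair ν (h.fst.op q) (h.snd.op q) R S) : Integrable (h.diagU q R) := by
  refine (((h.snd.integrable_norm_mulVec_sq q).add
    (h.fst.integrable_norm_mulVec_sq q)).const_mul (‖S‖ * (1 / κ))).mono'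
    (h.continuous_diagU q R).aestronglyMeasurable (Eventually.of_forall fun x => ?_)
  refine (h.abs_diagU_le hRS x).trans (mul_le_mul_of_nonneg_left ?_
    (mul_nonneg (norm_nonneg _) (one_div_nonneg.2 h.fst.pos.le)))
  simp only [Pi.add_apply]
  nlinarith [sq_nonneg (‖h.snd.mulVec q x‖ - ‖h.fst.mulVec q x‖),
    sq_nonneg (‖h.snd.mulVec q x‖), sq_nonneg (‖h.fst.mulVec q x‖)]

theorem exists_abs_diagU_le (h : ResolventPair κ ε k k') {q : L2 X} {R S : L2 X →L[ℝ] L2 X}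
    (hRS : IsInversePair ν (h.fst.op q) (h.snd.op q) R S) : ∃ C, ∀ x, |h.diagU q R x| ≤ C := by
  refine ⟨‖S‖ * (1 / κ) * ((2 * ‖q‖) * (2 * ‖q‖)), fun x => (h.abs_diagU_le hRS x).trans
    (mul_le_mul_of_nonneg_left ?_ (mul_nonneg (norm_nonneg _) (one_div_nonneg.2 h.fst.pos.le)))⟩
  exact mul_le_mul (h.snd.norm_mulVec_le q x) (h.fst.norm_mulVec_le q x) (norm_nonneg _)
    (by positivity)

end ResolventPair

/-! ## The Poisson bracket -/

/-- The system of differential equations for `r = g₂₁ - μ g₁₂`, `s = g₂₁ + μ g₁₂` and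
`u = -μ γ / 2`. -/
structure DiagonalSystem (μ κ : ℝ) (q : L2 X) (r s u : X → ℝ) : Prop where
  memLp_r : MemLp r 2 volume
  memLp_s : MemLp s 2 volume
  integrable_u : Integrable u
  bounded_u : ∃ C, ∀ x, |u x| ≤ C
  prim_r : Prim (fun t => r (Geometry.proj t)) fun t => -2 * κ * s (Geometry.proj t)
  prim_s : Prim (fun t => s (Geometry.proj t)) fun t =>
    2 * μ * (q (Geometry.proj t) * (1 - 2 * μ * u (Geometry.proj t))) - 2 * κ * r (Geometry.proj t)
  prim_u : Prim (fun t => u (Geometry.proj t)) fun t =>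
    -μ * (q (Geometry.proj t) * s (Geometry.proj t))

theorem Prim.measurable_of_comp_proj {u : X → ℝ} {v : ℝ → ℝ}
    (h : Prim (fun t => u (Geometry.proj t)) v) : Measurable u :=
  (RegularGeometry.continuous_of_comp_proj u h.continuous).measurable

/-- Two total derivatives that are combinations of `s r'` and `r s'` only, one from `r r'` and one
from a correction of `s s'`, give two linear relations between `∫ s r'` and `∫ r s'`. -/
theorem DiagonalSystem.integral_mul_eq_zero {μ κ ϰ : ℝ} (hκ : 0 < κ)
    (hϰ : 0 < ϰ) {q : L2 X} {r s u r' s' u' : X → ℝ} (h : DiagonalSystem μ κ q r s u)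
    (h' : DiagonalSystem μ ϰ q r' s' u') (heq : κ = ϰ → r = r' ∧ s = s') :
    ∫ x, r x * s' x = 0 := by
  have mr := h.prim_r.measurable_of_comp_proj
  have ms := h.prim_s.measurable_of_comp_proj
  have mr' := h'.prim_r.measurable_of_comp_proj
  have ms' := h'.prim_s.measurable_of_comp_proj
  have mu := h.prim_u.measurable_of_comp_proj
  have mu' := h'.prim_u.measurable_of_comp_proj
  have i1 := integrable_mul_L2 h.memLp_r h'.memLp_s
  have i2 := integrable_mul_L2 h.memLp_s h'.memLp_r
  have e1 : κ * (∫ x, s x * r' x) + ϰ * ∫ x, r x * s' x = 0 := by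
    have := integral_eq_zero_of_prim (u := fun x => r x * r' x)
      (v := fun x => -2 * κ * (s x * r' x) + -2 * ϰ * (r x * s' x))
      (integrable_mul_L2 h.memLp_r h'.memLp_r) ((i2.const_mul _).add (i1.const_mul _))
      (((ms.mul mr').const_mul _).add ((mr.mul ms').const_mul _))
      ((h.prim_r.mul h'.prim_r).congr (fun _ => rfl) fun _ => by ring)
    rw [integral_add (i2.const_mul _) (i1.const_mul _), integral_const_mul,
      integral_const_mul] at this
    linarith
  have e2 : κ * (∫ x, r x * s' x) + ϰ * ∫ x, s x * r' x = 0 := by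
    obtain ⟨C, hC⟩ := h.bounded_u
    have iuu : Integrable fun x => u x * u' x :=
      h'.integrable_u.bdd_mul mu.aestronglyMeasurable (Eventually.of_forall hC)
    -- The terms added to `s s'` cancel all terms containing `q`: the linear ones in `u` and `u'`
    -- remove `2μq(s + s')`, and the product `u u'` removes what is quadratic in the unknowns with
    -- coefficient `q`, coupled through `u`.
    have := integral_eq_zero_of_prim
      (u := fun x => s x * s' x + (2 * u x + (2 * u' x + -4 * μ * (u x * u' x))))
      (v := fun x => -2 * κ * (r x * s' x) + -2 * ϰ * (s x * r' x))
      ((integrable_mul_L2 h.memLp_s h'.memLp_s).add ((h.integrable_u.const_mul 2).add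
        ((h'.integrable_u.const_mul 2).add (iuu.const_mul _))))
      ((i1.const_mul _).add (i2.const_mul _))
      (((mr.mul ms').const_mul _).add ((ms.mul mr').const_mul _))
      (((h.prim_s.mul h'.prim_s).add ((h.prim_u.const_mul 2).add ((h'.prim_u.const_mul 2).add
        ((h.prim_u.mul h'.prim_u).const_mul (-4 * μ))))).congr (fun _ => rfl) fun t => by ring)
    rw [integral_add (i1.const_mul _) (i2.const_mul _), integral_const_mul,
      integral_const_mul] at this
    linarith
  rcases eq_or_ne κ ϰ with hk | hk
  · obtain ⟨rfl, rfl⟩ := heq hk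
    subst hk
    have : ∫ x, s x * r x = ∫ x, r x * s x := by simp_rw [mul_comm]
    rw [this] at e1
    have : 2 * κ * ∫ x, r x * s x = 0 := by linarith
    simpa [hκ.ne'] using this
  -- Eliminating `∫ s r'` leaves the determinant `κ² - ϰ²`.
  · have h0 : (κ - ϰ) * (κ + ϰ) * ∫ x, r x * s' x = 0 := by linear_combination κ * e2 - ϰ * e1
    have h1 : κ - ϰ ≠ 0 := sub_ne_zero.2 hk
    have h2 : κ + ϰ ≠ 0 := by positivity
    simpa [h1, h2] using h0

theorem ell_mul_sq_minus {κ : ℝ} (hκ : 1 ≤ κ) (z : X) :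
    Geometry.ell X κ * Geometry.kerMinus κ z ^ 2 = Geometry.kerMinus (2 * κ) z := by
  rw [RegularGeometry.kerMinus_eq, RegularGeometry.kerMinus_eq, RegularGeometry.ell_mul_sq κ hκ]

theorem rVar_green {κ μ : ℝ} (h : ResolventPair κ 1 (Geometry.kerPlus κ : X → ℝ)
    (Geometry.kerMinus κ)) (q : L2 X) (R S : L2 X →L[ℝ] L2 X) (x : X) :
    rVar μ κ (h.green μ q R S) x = μ * (Geometry.ell X κ * h.diagT q R x +
      Geometry.ell X κ * h.swap.diagT q S x) := by
  simp only [rVar, ResolventPair.green, ResolventPair.diagT, Matrix.of_apply, Matrix.cons_val_zero,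
    Matrix.cons_val_one, Matrix.cons_val', Matrix.cons_val_fin_one]
  ring

/-- Sum and difference of the equations for `t` and `t'`, which share `u` by `diagU_swap`; `μ² = 1`
is used to rewrite `∂u` in terms of `s`. -/
theorem diagonalSystem {κ μ : ℝ} (hμ : μ * μ = 1) (hκ : 1 ≤ κ)
    (h : ResolventPair κ 1 (Geometry.kerPlus κ : X → ℝ) (Geometry.kerMinus κ)) {q : L2 X}
    {R S : L2 X →L[ℝ] L2 X} (hRS : IsInversePair μ (h.fst.op q) (h.snd.op q) R S) :
    DiagonalSystem μ κ q (rVar μ κ (h.green μ q R S))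
      (fun x => μ * (Geometry.ell X κ * h.diagT q R x - Geometry.ell X κ * h.swap.diagT q S x))
      (fun x => Geometry.ell X κ * h.diagU q R x) := by
  set ℓ := Geometry.ell X κ with hℓ
  have h2 := resolventPair (X := X) (κ := 2 * κ) (by linarith)
  have p1 := h.prim_diagT hRS h2.fst (RegularGeometry.ell_mul_sq κ hκ)
  have p2 := h.swap.prim_diagT hRS.swap h2.snd (ell_mul_sq_minus hκ)
  have p3 := (h.prim_diagU hRS).const_mul ℓ
  simp_rw [h.diagU_swap hRS] at p2
  have er : rVar μ κ (h.green μ q R S) =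
      fun x => μ * (ℓ * h.diagT q R x + ℓ * h.swap.diagT q S x) :=
    funext fun x => rVar_green h q R S x
  rw [er]
  have m1 := (h.memLp_diagT q R).const_mul ℓ
  have m2 := (h.swap.memLp_diagT q S).const_mul ℓ
  refine ⟨(m1.add m2).const_mul μ, (m1.sub m2).const_mul μ, (h.integrable_diagU hRS).const_mul ℓ,
    ?_, ?_, ?_, ?_⟩
  · obtain ⟨C, hC⟩ := h.exists_abs_diagU_le hRS
    exact ⟨|ℓ| * C, fun x => by
      rw [abs_mul]; exact mul_le_mul_of_nonneg_left (hC x) (abs_nonneg _)⟩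
  · exact ((p1.add p2).const_mul μ).congr (fun _ => rfl) fun _ => by ring
  · exact ((p1.add (p2.const_mul (-1))).const_mul μ).congr (fun _ => by ring) fun _ => by ring
  · refine p3.congr (fun _ => rfl) fun t => ?_
    linear_combination (-(q (Geometry.proj t) * (ℓ * h.diagT q R (Geometry.proj t) -
      ℓ * h.swap.diagT q S (Geometry.proj t)))) * hμ

end

/-! ## The trace -/

section Trace

variable {H : Type} [NormedAddCommGroup H] [InnerProductSpace ℝ H] [CompleteSpace H]

theorem _root_.HilbertBasis.hasSum_inner_sq {ι : Type*} (e : HilbertBasis ι ℝ H) (x : H) :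
    HasSum (fun i => inner ℝ (e i) x ^ 2) (‖x‖ ^ 2) := by
  have := e.hasSum_inner_mul_inner x x
  rw [real_inner_self_eq_norm_sq] at this
  refine this.congr_fun fun i => ?_
  rw [real_inner_comm, sq]

theorem IsHilbertSchmidt.mul_left {A : H →L[ℝ] H} (hA : IsHilbertSchmidt A) (S : H →L[ℝ] H) :
    IsHilbertSchmidt (S * A) := fun ι e => by
  refine Summable.of_nonneg_of_le (fun i => sq_nonneg _) (fun i => ?_)
    ((hA ι e).mul_left (‖S‖ ^ 2))
  rw [← mul_pow]
  exact pow_le_pow_left₀ (norm_nonneg _) (S.le_opNorm _) 2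

theorem IsHilbertSchmidt.summable_inner_sq {A : H →L[ℝ] H} (hA : IsHilbertSchmidt A) {ι : Type}
    (e : HilbertBasis ι ℝ H) :
    Summable fun p : ι × ι => inner ℝ (e p.2) (A (e p.1)) ^ 2 := by
  refine (summable_prod_of_nonneg fun p => sq_nonneg _).2 ⟨fun j => ?_, ?_⟩
  · exact (e.hasSum_inner_sq (A (e j))).summable
  · refine (hA ι e).congr fun j => ?_
    exact (e.hasSum_inner_sq (A (e j))).tsum_eq.symm

theorem IsHilbertSchmidt.add {A B : H →L[ℝ] H} (hA : IsHilbertSchmidt A)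
    (hB : IsHilbertSchmidt B) : IsHilbertSchmidt (A + B) := fun ι e => by
  refine Summable.of_nonneg_of_le (fun i => sq_nonneg _) (fun i => ?_)
    (((hA ι e).add (hB ι e)).mul_left 2)
  have := norm_add_le (A (e i)) (B (e i))
  rw [add_apply]
  nlinarith [sq_nonneg (‖A (e i)‖ - ‖B (e i)‖), norm_nonneg (A (e i) + B (e i))]

theorem IsHilbertSchmidt.summable_inner_mul_inner {A B : H →L[ℝ] H} (hA : IsHilbertSchmidt A)
    (hB : IsHilbertSchmidt B) {ι : Type} (e : HilbertBasis ι ℝ H) :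
    Summable fun p : ι × ι => inner ℝ (e p.1) (A (e p.2)) * inner ℝ (e p.2) (B (e p.1)) := by
  have h1 : Summable fun p : ι × ι => inner ℝ (e p.1) (A (e p.2)) ^ 2 :=
    (Equiv.prodComm _ _).summable_iff.1 (hA.summable_inner_sq e)
  refine Summable.of_norm_bounded (h1.add (hB.summable_inner_sq e)) fun p => ?_
  rw [norm_mul, Real.norm_eq_abs, Real.norm_eq_abs,
    ← sq_abs (inner ℝ (e p.1) (A (e p.2))), ← sq_abs (inner ℝ (e p.2) (B (e p.1)))]
  nlinarith [sq_nonneg (|inner ℝ (e p.1) (A (e p.2))| - |inner ℝ (e p.2) (B (e p.1))|),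
    sq_nonneg |inner ℝ (e p.1) (A (e p.2))|, sq_nonneg |inner ℝ (e p.2) (B (e p.1))|]

theorem tsum_inner_mul_inner (A B : H →L[ℝ] H) {ι : Type} (e : HilbertBasis ι ℝ H) (i : ι) :
    ∑' j, inner ℝ (e i) (A (e j)) * inner ℝ (e j) (B (e i)) = inner ℝ (e i) ((A * B) (e i)) := by
  have := (e.hasSum_inner_mul_inner (ContinuousLinearMap.adjoint A (e i)) (B (e i))).tsum_eq
  simp_rw [ContinuousLinearMap.adjoint_inner_left] at this
  exact this

theorem IsHilbertSchmidt.summable_inner {A B : H →L[ℝ] H} (hA : IsHilbertSchmidt A)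
    (hB : IsHilbertSchmidt B) {ι : Type} (e : HilbertBasis ι ℝ H) :
    Summable fun i => inner ℝ (e i) ((A * B) (e i)) := by
  have := (hA.summable_inner_mul_inner hB e).prod
  exact this.congr fun i => tsum_inner_mul_inner A B e i

/-- The trace is cyclic. -/
theorem opTrace_mul_comm {A B : H →L[ℝ] H} (hA : IsHilbertSchmidt A) (hB : IsHilbertSchmidt B) :
    opTrace (A * B) = opTrace (B * A) := by
  have hs := hA.summable_inner_mul_inner hB (basis H)
  simp_rw [opTrace, ← tsum_inner_mul_inner]
  refine (Summable.tsum_comm (f := fun i j => inner ℝ (basis H i) (A (basis H j)) *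
    inner ℝ (basis H j) (B (basis H i))) hs).symm.trans ?_
  exact tsum_congr fun j => tsum_congr fun i => mul_comm _ _

theorem opTrace_add {A B C D : H →L[ℝ] H} (hA : IsHilbertSchmidt A) (hB : IsHilbertSchmidt B)
    (hC : IsHilbertSchmidt C) (hD : IsHilbertSchmidt D) :
    opTrace (A * B + C * D) = opTrace (A * B) + opTrace (C * D) := by
  rw [opTrace, opTrace, opTrace,
    ← (hA.summable_inner hB (basis H)).tsum_add (hC.summable_inner hD (basis H))]
  exact tsum_congr fun i => inner_add_right _ _ _

/-- The exponent `0` is separate: the identity has norm at most `1`, possibly `0` on a trivial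
space. -/
theorem norm_pow_le_pow_norm {H : Type*} [NormedAddCommGroup H] [NormedSpace ℝ H]
    (A : H →L[ℝ] H) (n : ℕ) : ‖A ^ n‖ ≤ ‖A‖ ^ n := by
  rcases n.eq_zero_or_pos with rfl | hn
  · rw [pow_zero, pow_zero]; exact ContinuousLinearMap.norm_id_le
  · exact norm_pow_le' _ hn

/-- Distinct basis vectors are at distance `√2`, so balls of radius `1/2` about them are disjoint.
Countability permits exchanging the sum over the basis with the integral. -/
theorem _root_.HilbertBasis.countable [SecondCountableTopology H] {ι : Type*}
    (e : HilbertBasis ι ℝ H) : Countable ι := by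
  refine Pairwise.countable_of_isOpen_disjoint (s := fun i => Metric.ball (e i) (1 / 2))
    (fun i j hij => ?_) (fun i => Metric.isOpen_ball)
    fun i => ⟨e i, Metric.mem_ball_self (by norm_num)⟩
  refine Metric.ball_disjoint_ball ?_
  have h1 : ‖e i - e j‖ ^ 2 = 2 := by
    rw [norm_sub_sq_real, e.orthonormal.2 hij, e.orthonormal.1 i, e.orthonormal.1 j]
    norm_num
  rw [dist_eq_norm]
  nlinarith [norm_nonneg (e i - e j)]

end Trace

section
variable {X : Type} [AddCommGroup X] [TopologicalSpace X] [IsTopologicalAddGroup X]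
  [T2Space X] [LocallyCompactSpace X] [SecondCountableTopology X] [MeasureSpace X] [BorelSpace X]
  [(volume : Measure X).IsAddHaarMeasure] [Geometry X] [RegularGeometry X]

theorem secondCountable_L2 : SecondCountableTopology (L2 X) := by
  have : Fact ((2 : ℝ≥0∞) ≠ ⊤) := ⟨by norm_num⟩
  infer_instance

/-- Bessel's inequality under the integral: pointwise in `x` the sum over the basis is at most
`‖S*(q v_x)‖²`, which is integrable. -/
theorem isHilbertSchmidt_op_mul {κ ε : ℝ} {k : X → ℝ} (hk : IsResolventKernel κ ε k) (q : L2 X)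
    (S : L2 X →L[ℝ] L2 X) : IsHilbertSchmidt (hk.op q * S) := by
  intro ι e
  refine summable_of_sum_le (c := ∫ x, ‖S‖ ^ 2 * ‖hk.mulVec q x‖ ^ 2) (fun i => sq_nonneg _)
    fun s => ?_
  have h1 : ∀ i, (fun x => (hk.op q * S) (e i) x ^ 2) =ᵐ[volume]
      fun x => inner ℝ (hk.mulVec q x) (S (e i)) ^ 2 := fun i => by
    filter_upwards [hk.coeFn_op q (S (e i))] with x hx
    rw [mul_apply_eq_comp, hx]
  have h2 : ∀ i, Integrable fun x => inner ℝ (hk.mulVec q x) (S (e i)) ^ 2 := fun i =>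
    ((Lp.memLp ((hk.op q * S) (e i))).integrable_sq).congr (h1 i)
  simp_rw [fun i => IsResolventKernel.norm_sq_L2 ((hk.op q * S) (e i))]
  rw [Finset.sum_congr rfl fun i _ => integral_congr_ae (h1 i),
    ← integral_finsetSum _ fun i _ => h2 i]
  refine integral_mono (integrable_finsetSum _ fun i _ => h2 i)
    ((hk.integrable_norm_mulVec_sq q).const_mul _) fun x => ?_
  have := e.orthonormal.sum_inner_products_le (s := s)
    (ContinuousLinearMap.adjoint S (hk.mulVec q x))
  simp only
  calc ∑ i ∈ s, inner ℝ (hk.mulVec q x) (S (e i)) ^ 2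
      = ∑ i ∈ s, ‖inner ℝ (e i) (ContinuousLinearMap.adjoint S (hk.mulVec q x))‖ ^ 2 := by
        refine Finset.sum_congr rfl fun i _ => ?_
        rw [ContinuousLinearMap.adjoint_inner_right, real_inner_comm, Real.norm_eq_abs, sq_abs]
    _ ≤ ‖ContinuousLinearMap.adjoint S (hk.mulVec q x)‖ ^ 2 := this
    _ ≤ ‖S‖ ^ 2 * ‖hk.mulVec q x‖ ^ 2 := by
        rw [← mul_pow]
        refine pow_le_pow_left₀ (norm_nonneg _) ?_ 2
        refine (ContinuousLinearMap.le_opNorm _ _).trans (le_of_eq ?_)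
        rw [LinearIsometryEquiv.norm_map]

/-! ### Traces as pairings in `L²`, and their derivatives -/

namespace ResolventPair

variable {κ ε ν : ℝ} {k k' : X → ℝ}

/-- Each diagonal matrix element is `∫ q₁(x) ⟨v_x, eᵢ⟩⟨q₂ v_x, S eᵢ⟩ dx`; summing over `i` inside
the integral is Parseval's identity. -/
theorem opTrace_eq (h : ResolventPair κ ε k k') (q₁ q₂ : L2 X) (S : L2 X →L[ℝ] L2 X) :
    opTrace (h.snd.op q₁ * (h.fst.op q₂ * S)) = ∫ x, q₁ x * h.diagT q₂ S x := by
  set e := basis (L2 X)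
  have := secondCountable_L2 (X := X)
  have := e.countable
  let w : X → L2 X := fun x => ContinuousLinearMap.adjoint S (h.fst.mulVec q₂ x)
  have hw : Continuous w :=
    (ContinuousLinearMap.adjoint S).continuous.comp (h.fst.continuous_mulVec q₂)
  have hterm : ∀ i, inner ℝ (e i) ((h.snd.op q₁ * (h.fst.op q₂ * S)) (e i)) =
      ∫ x, q₁ x * (inner ℝ (h.fst.vec x) (e i) * inner ℝ (e i) (w x)) := by
    intro i
    rw [mul_apply_eq_comp, h.swap.inner_op]
    refine integral_congr_ae ?_
    filter_upwards [h.fst.coeFn_op q₂ (S (e i))] with x hx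
    rw [mul_apply_eq_comp, hx, mul_assoc, ContinuousLinearMap.adjoint_inner_right,
      real_inner_comm (S (e i))]
    rfl
  have hb : ∀ x, ‖w x‖ ^ 2 ≤ ‖S‖ ^ 2 * ‖h.fst.mulVec q₂ x‖ ^ 2 := fun x => by
    rw [← mul_pow]
    refine pow_le_pow_left₀ (norm_nonneg _) ?_ 2
    refine (ContinuousLinearMap.le_opNorm _ _).trans (le_of_eq ?_)
    rw [LinearIsometryEquiv.norm_map]
  -- The majorant comes from `|ab| ≤ a² + b²`. Its sum over the basis is explicit by Parseval, and
  -- integrable because `‖v_x‖²` is bounded and `‖q₂ v_x‖²` is integrable.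
  have hsum : ∀ x, HasSum (fun i => q₁ x ^ 2 * inner ℝ (e i) (h.fst.vec x) ^ 2 +
      inner ℝ (e i) (w x) ^ 2) (q₁ x ^ 2 * ‖h.fst.vec x‖ ^ 2 + ‖w x‖ ^ 2) := fun x =>
    ((e.hasSum_inner_sq _).mul_left _).add (e.hasSum_inner_sq _)
  have hq := (Lp.stronglyMeasurable q₁).measurable
  have main := hasSum_integral_of_dominated_convergence (μ := (volume : Measure X))
    (F := fun i x => q₁ x * (inner ℝ (h.fst.vec x) (e i) * inner ℝ (e i) (w x)))
    (f := fun x => q₁ x * h.diagT q₂ S x)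
    (fun i x => q₁ x ^ 2 * inner ℝ (e i) (h.fst.vec x) ^ 2 + inner ℝ (e i) (w x) ^ 2)
    (fun i => ?_) (fun i => Eventually.of_forall fun x => ?_)
    (Eventually.of_forall fun x => (hsum x).summable) ?_ (Eventually.of_forall fun x => ?_)
  · rw [opTrace, ← main.tsum_eq]
    exact tsum_congr hterm
  · exact (hq.mul ((h.fst.continuous_vec.inner continuous_const).mul
      (continuous_const.inner hw)).measurable).aestronglyMeasurable
  · rw [real_inner_comm (e i) (h.fst.vec x), Real.norm_eq_abs, ← mul_assoc, abs_mul, ← mul_pow,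
      ← sq_abs (q₁ x * _), ← sq_abs (inner ℝ (e i) (w x))]
    nlinarith [sq_nonneg (|q₁ x * inner ℝ (e i) (h.fst.vec x)| - |inner ℝ (e i) (w x)|),
      sq_nonneg |q₁ x * inner ℝ (e i) (h.fst.vec x)|, sq_nonneg |inner ℝ (e i) (w x)|]
  · simp_rw [fun x => (hsum x).tsum_eq]
    refine Integrable.add ?_ ?_
    · refine ((Lp.memLp q₁).integrable_sq.mul_const (2 / κ)).mono'
        ((hq.pow_const 2).mul (h.fst.continuous_vec.norm.pow 2).measurable).aestronglyMeasurable
        (Eventually.of_forall fun x => ?_)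
      rw [Real.norm_eq_abs, abs_of_nonneg (by positivity)]
      exact mul_le_mul_of_nonneg_left (h.fst.norm_vec_sq_le x) (sq_nonneg _)
    · refine ((h.fst.integrable_norm_mulVec_sq q₂).const_mul (‖S‖ ^ 2)).mono'
        (hw.norm.pow 2).aestronglyMeasurable (Eventually.of_forall fun x => ?_)
      rw [Real.norm_eq_abs, abs_of_nonneg (by positivity)]
      exact hb x
  · have := (e.hasSum_inner_mul_inner (h.fst.vec x) (w x)).mul_left (q₁ x)
    rwa [ContinuousLinearMap.adjoint_inner_right, real_inner_comm] at this

/-- The function `diagT q S` as a bilinear map into `L²`. -/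
def diagTL (h : ResolventPair κ ε k k') : L2 X →L[ℝ] (L2 X →L[ℝ] L2 X) →L[ℝ] L2 X :=
  LinearMap.mkContinuous₂
    (LinearMap.mk₂ ℝ (fun q S => (h.memLp_diagT q S).toLp _)
      (fun q q' S => by
        rw [← MemLp.toLp_add]
        refine MemLp.toLp_congr _ _ (Eventually.of_forall fun x => ?_)
        rw [Pi.add_apply, diagT, diagT, diagT, h.fst.mulVec_add, inner_add_left])
      (fun c q S => by
        rw [← MemLp.toLp_const_smul]
        refine MemLp.toLp_congr _ _ (Eventually.of_forall fun x => ?_)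
        rw [Pi.smul_apply, diagT, diagT, h.fst.mulVec_smul, real_inner_smul_left, smul_eq_mul])
      (fun q S S' => by
        rw [← MemLp.toLp_add]
        refine MemLp.toLp_congr _ _ (Eventually.of_forall fun x => ?_)
        rw [Pi.add_apply, diagT, diagT, diagT, add_apply, inner_add_right])
      (fun c q S => by
        rw [← MemLp.toLp_const_smul]
        refine MemLp.toLp_congr _ _ (Eventually.of_forall fun x => ?_)
        rw [Pi.smul_apply, diagT, diagT, smul_apply, real_inner_smul_right, smul_eq_mul]))
    (2 / κ) (by
      intro q S
      have hκ := h.fst.pos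
      refine (sq_le_sq₀ (norm_nonneg _) (by positivity)).1 ?_
      rw [LinearMap.mk₂_apply, IsResolventKernel.norm_sq_L2]
      calc ∫ x, (h.memLp_diagT q S).toLp _ x ^ 2 = ∫ x, h.diagT q S x ^ 2 := by
            refine integral_congr_ae ?_
            filter_upwards [(h.memLp_diagT q S).coeFn_toLp] with x hx
            rw [hx]
        _ ≤ ∫ x, ‖S‖ ^ 2 * (2 / κ) * ‖h.fst.mulVec q x‖ ^ 2 :=
            integral_mono (h.memLp_diagT q S).integrable_sq
              ((h.fst.integrable_norm_mulVec_sq q).const_mul _) fun x => h.diagT_sq_le q S x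
        _ ≤ ‖S‖ ^ 2 * (2 / κ) * (2 / κ * ‖q‖ ^ 2) := by
            rw [integral_const_mul]
            exact mul_le_mul_of_nonneg_left (h.fst.integral_norm_mulVec_sq_le q) (by positivity)
        _ = _ := by ring)

theorem norm_diagTL_le (h : ResolventPair κ ε k k') (q : L2 X) (S : L2 X →L[ℝ] L2 X) :
    ‖h.diagTL q S‖ ≤ 2 / κ * ‖q‖ * ‖S‖ := by
  have hκ := h.fst.pos
  refine (ContinuousLinearMap.le_opNorm₂ _ _ _).trans ?_
  gcongr
  exact LinearMap.mkContinuous₂_norm_le _ (by positivity) _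

theorem inner_diagTL (h : ResolventPair κ ε k k') (q₁ q₂ : L2 X) (S : L2 X →L[ℝ] L2 X) :
    inner ℝ q₁ (h.diagTL q₂ S) = ∫ x, q₁ x * h.diagT q₂ S x := by
  rw [inner_L2]
  refine integral_congr_ae ?_
  filter_upwards [(h.memLp_diagT q₂ S).coeFn_toLp] with x hx
  rw [← hx]
  rfl

/-- The trace becomes a bounded trilinear form in `(q₁, q₂, S)` with `S` measured in operator norm.
Derivatives of traces thus need no topology on the trace class. -/
theorem opTrace_eq_inner (h : ResolventPair κ ε k k') (q₁ q₂ : L2 X) (S : L2 X →L[ℝ] L2 X) :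
    opTrace (h.snd.op q₁ * (h.fst.op q₂ * S)) = inner ℝ q₁ (h.diagTL q₂ S) := by
  rw [h.opTrace_eq, h.inner_diagTL]

/-- The trace in `opTrace_eq` in terms of the reflected kernel. -/
theorem inner_diagTL_swap (h : ResolventPair κ ε k k') {q : L2 X} {R S : L2 X →L[ℝ] L2 X}
    (hRS : IsInversePair ν (h.fst.op q) (h.snd.op q) R S) (f : L2 X) :
    inner ℝ q (h.diagTL f R) = ∫ x, f x * h.swap.diagT q S x := by
  -- Cyclicity puts `R` in front of `P'`, and `R P' = P' S` brings the trace to the form for the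
  -- opposite sign.
  rw [← h.opTrace_eq_inner, ← h.swap.opTrace_eq, opTrace_mul_comm]
  · rw [mul_assoc, ← hRS.swap.comm]
    rfl
  · have := isHilbertSchmidt_op_mul h.snd q 1
    rwa [mul_one] at this
  · exact isHilbertSchmidt_op_mul h.fst f R

/-! ### The powers of `Λ` -/

/-- The operator `Λ = P' P`. -/
def lam (h : ResolventPair κ ε k k') (q : L2 X) : L2 X →L[ℝ] L2 X := h.snd.op q * h.fst.op q

theorem op_mul_op (h : ResolventPair κ ε k k') (q : L2 X) :
    h.snd.op q * h.fst.op q = h.lam q := rfl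

theorem norm_op_mul_op_le (h : ResolventPair κ ε k k') (q : L2 X) :
    ‖h.snd.op q * h.fst.op q‖ ≤ 2 / κ * ‖q‖ ^ 2 := by
  have hκ := h.fst.pos
  refine (norm_mul_le _ _).trans ?_
  refine (mul_le_mul (h.snd.norm_op_le q) (h.fst.norm_op_le q) (norm_nonneg _)
    (by positivity)).trans (le_of_eq ?_)
  rw [mul_mul_mul_comm, Real.mul_self_sqrt (by positivity), sq]

theorem isHilbertSchmidt_lam_pow (h : ResolventPair κ ε k k') (q : L2 X) (n : ℕ) :
    IsHilbertSchmidt (h.lam q ^ (n + 1)) := by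
  have := (isHilbertSchmidt_op_mul h.fst q 1).mul_left (h.lam q ^ n * h.snd.op q)
  rwa [mul_one, mul_assoc, h.op_mul_op q, ← pow_succ] at this

theorem isTraceClass_lam_pow (h : ResolventPair κ ε k k') (q : L2 X) (n : ℕ) :
    IsTraceClass (h.lam q ^ (n + 1)) := by
  refine ⟨h.lam q ^ n * h.snd.op q, h.fst.op q, ?_, ?_, ?_⟩
  · have := (isHilbertSchmidt_op_mul h.snd q 1).mul_left (h.lam q ^ n)
    rwa [mul_one] at this
  · have := isHilbertSchmidt_op_mul h.fst q 1
    rwa [mul_one] at this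
  · change _ = h.lam q ^ n * h.snd.op q * h.fst.op q
    rw [mul_assoc, h.op_mul_op q, ← pow_succ]

theorem opTrace_lam_pow (h : ResolventPair κ ε k k') (q : L2 X) (n : ℕ) :
    opTrace (h.lam q ^ (n + 1)) = inner ℝ q (h.diagTL q (h.lam q ^ n)) := by
  rw [← h.opTrace_eq_inner, ← mul_assoc, h.op_mul_op q, ← pow_succ']

theorem abs_opTrace_lam_pow_le (h : ResolventPair κ ε k k') (q : L2 X) (n : ℕ) :
    |opTrace (h.lam q ^ (n + 1))| ≤ 2 / κ * ‖q‖ ^ 2 * ‖h.lam q‖ ^ n := by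
  have hκ := h.fst.pos
  rw [h.opTrace_lam_pow]
  refine (abs_real_inner_le_norm _ _).trans ?_
  have h1 := norm_pow_le_pow_norm (h.lam q) n
  calc ‖q‖ * ‖h.diagTL q (h.lam q ^ n)‖ ≤ ‖q‖ * (2 / κ * ‖q‖ * ‖h.lam q‖ ^ n) := by
        refine mul_le_mul_of_nonneg_left ((h.norm_diagTL_le _ _).trans ?_) (norm_nonneg _)
        exact mul_le_mul_of_nonneg_left h1 (by positivity)
    _ = _ := by ring

/-- The derivative of `(n + 1)⁻¹ tr Λ ^ (n + 1)`. -/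
def dTrace (h : ResolventPair κ ε k k') (q : L2 X) (S : L2 X →L[ℝ] L2 X) : L2 X →L[ℝ] ℝ :=
  innerSL ℝ (h.diagTL q S) + (innerSL ℝ q).comp (h.diagTL.flip S)

theorem dTrace_apply (h : ResolventPair κ ε k k') (q f : L2 X) (S : L2 X →L[ℝ] L2 X) :
    h.dTrace q S f = inner ℝ f (h.diagTL q S) + inner ℝ q (h.diagTL f S) := by
  simp [dTrace, real_inner_comm]

/-- The derivative of `Λ`. -/
def dLam (h : ResolventPair κ ε k k') (q : L2 X) : L2 X →L[ℝ] (L2 X →L[ℝ] L2 X) :=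
  h.snd.op q • h.fst.opL + MulOpposite.op (h.fst.op q) • h.snd.opL

theorem dLam_apply (h : ResolventPair κ ε k k') (q f : L2 X) :
    h.dLam q f = h.snd.op q * h.fst.op f + h.snd.op f * h.fst.op q := rfl

theorem hasFDerivAt_lam (h : ResolventPair κ ε k k') (q : L2 X) :
    HasFDerivAt h.lam (h.dLam q) q :=
  (h.snd.opL.hasFDerivAt (x := q)).mul' (h.fst.opL.hasFDerivAt (x := q))

theorem isHilbertSchmidt_dLam_mul (h : ResolventPair κ ε k k') (q f : L2 X)
    (S : L2 X →L[ℝ] L2 X) : IsHilbertSchmidt (h.dLam q f * S) := by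
  rw [dLam_apply, add_mul, mul_assoc, mul_assoc]
  exact ((isHilbertSchmidt_op_mul h.fst f S).mul_left _).add
    ((isHilbertSchmidt_op_mul h.fst q S).mul_left _)

theorem opTrace_dLam_mul (h : ResolventPair κ ε k k') (q f : L2 X) (S : L2 X →L[ℝ] L2 X) :
    opTrace (h.dLam q f * S) = h.dTrace q S f := by
  have hs : ∀ q, IsHilbertSchmidt (h.snd.op q) := fun q => by
    have := isHilbertSchmidt_op_mul h.snd q 1
    rwa [mul_one] at this
  rw [dLam_apply, add_mul, mul_assoc, mul_assoc, opTrace_add (hs _)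
    (isHilbertSchmidt_op_mul h.fst f S) (hs _) (isHilbertSchmidt_op_mul h.fst q S),
    h.opTrace_eq_inner, h.opTrace_eq_inner, dTrace_apply, add_comm]

theorem hasFDerivAt_lam_pow (h : ResolventPair κ ε k k') (q : L2 X) (n : ℕ) :
    HasFDerivAt (fun q => h.lam q ^ n)
      (∑ i ∈ Finset.range n, (h.lam q ^ (n.pred - i)) •
        (MulOpposite.op (h.lam q ^ i)) • h.dLam q) q :=
  (h.hasFDerivAt_lam q).pow' n

/-- By cyclicity the place where `dΛ` stands among the powers of `Λ` does not matter. -/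
theorem inner_diagTL_dLam (h : ResolventPair κ ε k k') (q f : L2 X) (a b : ℕ) :
    inner ℝ q (h.diagTL q (h.lam q ^ a * (h.dLam q f * h.lam q ^ b))) =
      h.dTrace q (h.lam q ^ (a + b + 1)) f := by
  rw [← h.opTrace_eq_inner, ← mul_assoc, h.op_mul_op, ← mul_assoc, ← pow_succ', opTrace_mul_comm,
    mul_assoc, ← pow_add, opTrace_dLam_mul]
  · rw [add_comm b, add_right_comm]
  · exact h.isHilbertSchmidt_lam_pow q a
  · exact h.isHilbertSchmidt_dLam_mul q f _

/-- Differentiating `Λ^n` gives `n` equal contributions; the two explicit arguments `q` of the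
pairing together give one more. -/
theorem hasFDerivAt_opTrace (h : ResolventPair κ ε k k') (q : L2 X) (n : ℕ) :
    HasFDerivAt (fun q => opTrace (h.lam q ^ (n + 1)))
      ((n + 1 : ℝ) • h.dTrace q (h.lam q ^ n)) q := by
  have hin := (hasFDerivAt_id q).inner ℝ
    ((h.diagTL.hasFDerivAt (x := q)).clm_apply (h.hasFDerivAt_lam_pow q n))
  have e : (fun q => opTrace (h.lam q ^ (n + 1))) =
      fun q => inner ℝ (id q) (h.diagTL q (h.lam q ^ n)) := funext fun q => h.opTrace_lam_pow q n
  rw [e]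
  refine hin.congr_fderiv ?_
  ext f
  have e2 : ∀ i ∈ Finset.range n, inner ℝ q (h.diagTL q
      (h.lam q ^ (n.pred - i) * (h.dLam q f * h.lam q ^ i))) = h.dTrace q (h.lam q ^ n) f := by
    intro i hi
    rw [h.inner_diagTL_dLam]
    congr 3
    have := Finset.mem_range.1 hi
    rw [Nat.pred_eq_sub_one]
    omega
  have e3 := Finset.sum_congr rfl e2
  rw [Finset.sum_const, Finset.card_range, ← inner_sum, ← map_sum] at e3
  trans inner ℝ q (h.diagTL q (∑ i ∈ Finset.range n,
      (h.lam q ^ (n.pred - i) * (h.dLam q f * h.lam q ^ i))) + h.diagTL f (h.lam q ^ n)) +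
      inner ℝ f (h.diagTL q (h.lam q ^ n))
  · simp only [ContinuousLinearMap.comp_apply, ContinuousLinearMap.prod_apply, fderivInnerCLM_apply,
      ContinuousLinearMap.id_apply, id, sum_apply, add_apply,
      ContinuousLinearMap.flip_apply]
    rfl
  · rw [inner_add_right, e3, nsmul_eq_mul, smul_apply, smul_eq_mul, dTrace_apply]
    ring

end ResolventPair
end

/-! ## The series `A(κ, q)` -/

section
variable {X : Type} [AddCommGroup X] [TopologicalSpace X] [IsTopologicalAddGroup X]
  [T2Space X] [LocallyCompactSpace X] [SecondCountableTopology X] [MeasureSpace X] [BorelSpace X]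
  [(volume : Measure X).IsAddHaarMeasure] [Geometry X] [RegularGeometry X]

variable {μ κ : ℝ}

theorem seriesTerm_eq (hκ : 1 ≤ κ) (q : L2 X) (n : ℕ) :
    seriesTerm μ κ q n = μ * Geometry.ell X κ *
      ((-μ) ^ n / (n + 1) * opTrace ((resolventPair hκ).lam q ^ (n + 1))) := rfl

theorem abs_coeff_le (hμ : |μ| = 1) (hκ : 1 ≤ κ) (n : ℕ) :
    |μ * Geometry.ell X κ * (-μ) ^ n| ≤ 1 := by
  have := RegularGeometry.ell_mem (X := X) κ hκ
  rw [abs_mul, abs_mul, abs_pow, abs_neg, hμ, one_pow, one_mul, mul_one, abs_of_nonneg]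
  · exact this.2
  · linarith [this.1]

theorem abs_seriesTerm_le (hμ : |μ| = 1) (hκ : 1 ≤ κ) (q : L2 X) (n : ℕ) :
    |seriesTerm μ κ q n| ≤ 2 / κ * ‖q‖ ^ 2 * ‖(resolventPair hκ).lam q‖ ^ n := by
  have h1 := (resolventPair (X := X) hκ).abs_opTrace_lam_pow_le q n
  have e : seriesTerm μ κ q n = μ * Geometry.ell X κ * (-μ) ^ n *
      ((1 / (n + 1 : ℝ)) * opTrace ((resolventPair hκ).lam q ^ (n + 1))) := by
    rw [seriesTerm_eq hκ]; ring
  rw [e, abs_mul, abs_mul (1 / (n + 1 : ℝ))]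
  refine (mul_le_of_le_one_left (by positivity) (abs_coeff_le hμ hκ n)).trans ?_
  refine (mul_le_of_le_one_left (abs_nonneg _) ?_).trans h1
  rw [abs_of_nonneg (by positivity), div_le_one (by positivity)]
  linarith [n.cast_nonneg (α := ℝ)]

/-- The radius `1/4` enters only here, through `2 · (1/4)² = 1/8`. The later arguments need values
below `1` for the inverses and below `1/2` for the derivative. -/
theorem two_div_mul_norm_sq_le (hκ : 1 ≤ κ) {q : L2 X} (hq : q ∈ smallBall X (1 / 4) κ) :
    2 / κ * ‖q‖ ^ 2 ≤ 1 / 8 := by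
  have hκ0 : 0 < κ := by linarith
  have h1 : κ ^ (-(1 / 2) : ℝ) * ‖q‖ ≤ 1 / 4 := hq
  have h2 := pow_le_pow_left₀ (by positivity) h1 2
  have h3 : (κ ^ (-(1 / 2) : ℝ)) ^ 2 = κ⁻¹ := by
    rw [← Real.rpow_natCast, ← Real.rpow_mul hκ0.le, ← Real.rpow_neg_one]
    norm_num
  rw [mul_pow, h3] at h2
  rw [div_eq_mul_inv]
  linarith

theorem norm_lam_le (hκ : 1 ≤ κ) (q : L2 X) :
    ‖(resolventPair hκ).lam q‖ ≤ 2 / κ * ‖q‖ ^ 2 :=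
  (resolventPair hκ).norm_op_mul_op_le q

theorem abs_seriesTerm_le_geometric (hμ : |μ| = 1) (hκ : 1 ≤ κ) {q : L2 X} {a : ℝ}
    (hq : 2 / κ * ‖q‖ ^ 2 ≤ a) (n : ℕ) : |seriesTerm μ κ q n| ≤ a * a ^ n := by
  have h0 : 0 ≤ 2 / κ * ‖q‖ ^ 2 := by positivity
  refine (abs_seriesTerm_le hμ hκ q n).trans (mul_le_mul hq (pow_le_pow_left₀ (norm_nonneg _)
    ((norm_lam_le hκ q).trans hq) n) (by positivity) (h0.trans hq))

theorem summable_mul_pow {a c : ℝ} (ha : 0 ≤ a) (ha' : a < 1) : Summable fun n : ℕ => c * a ^ n :=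
  (summable_geometric_of_lt_one ha ha').mul_left c

theorem summable_seriesTerm (hμ : |μ| = 1) (hκ : 1 ≤ κ) {q : L2 X}
    (hq : 2 / κ * ‖q‖ ^ 2 < 1) : Summable fun n => |seriesTerm μ κ q n| :=
  Summable.of_nonneg_of_le (fun n => abs_nonneg _) (abs_seriesTerm_le_geometric hμ hκ le_rfl)
    (summable_mul_pow (by positivity) hq)

theorem tendstoUniformlyOn_seriesTerm (hμ : |μ| = 1) :
    TendstoUniformlyOn
      (fun (N : ℕ) (z : ℝ × L2 X) => ∑ n ∈ Finset.range N, seriesTerm μ z.1 z.2 n)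
      (fun z => logDet μ z.1 z.2) atTop
      {z : ℝ × L2 X | 1 ≤ z.1 ∧ z.2 ∈ smallBall X (1 / 4) z.1} :=
  tendstoUniformlyOn_tsum_nat (f := fun n (z : ℝ × L2 X) => seriesTerm μ z.1 z.2 n)
    (summable_mul_pow (a := 1 / 8) (c := 1 / 8) (by norm_num) (by norm_num)) fun n z hz =>
      abs_seriesTerm_le_geometric hμ hz.1 (two_div_mul_norm_sq_le hz.1 hz.2) n

/-! ### The derivative of `A(κ, ·)` -/

theorem hasFDerivAt_seriesTerm (hκ : 1 ≤ κ) (q : L2 X) (n : ℕ) :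
    HasFDerivAt (fun q => seriesTerm μ κ q n)
      ((μ * Geometry.ell X κ * (-μ) ^ n) •
        (resolventPair hκ).dTrace q ((resolventPair hκ).lam q ^ n)) q := by
  have h1 := ((resolventPair (X := X) hκ).hasFDerivAt_opTrace q n).const_mul
    (μ * Geometry.ell X κ * ((-μ) ^ n / (n + 1)))
  simp_rw [seriesTerm_eq hκ, ← mul_assoc]
  refine h1.congr_fderiv ?_
  rw [smul_smul]
  congr 1
  have : (n + 1 : ℝ) ≠ 0 := by positivity
  field_simp

theorem ResolventPair.norm_dTrace_le {ε : ℝ} {k k' : X → ℝ} (h : ResolventPair κ ε k k') (q : L2 X)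
    (S : L2 X →L[ℝ] L2 X) : ‖h.dTrace q S‖ ≤ 2 * (2 / κ * ‖q‖ * ‖S‖) := by
  have hκ := h.fst.pos
  refine ContinuousLinearMap.opNorm_le_bound _ (by positivity) fun f => ?_
  rw [h.dTrace_apply]
  refine (norm_add_le _ _).trans ?_
  have h1 := (norm_inner_le_norm (𝕜 := ℝ) f (h.diagTL q S)).trans
    (mul_le_mul_of_nonneg_left (h.norm_diagTL_le q S) (norm_nonneg _))
  have h2 := (norm_inner_le_norm (𝕜 := ℝ) q (h.diagTL f S)).trans
    (mul_le_mul_of_nonneg_left (h.norm_diagTL_le f S) (norm_nonneg _))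
  calc _ ≤ _ := add_le_add h1 h2
    _ = _ := by ring

/-- The map `S ↦ dTrace q S` as a continuous linear map. -/
def ResolventPair.dTraceL {ε : ℝ} {k k' : X → ℝ} (h : ResolventPair κ ε k k') (q : L2 X) :
    (L2 X →L[ℝ] L2 X) →L[ℝ] (L2 X →L[ℝ] ℝ) :=
  LinearMap.mkContinuous
    { toFun := h.dTrace q
      map_add' := fun S T => by
        ext f
        simp only [h.dTrace_apply, map_add, add_apply, inner_add_right]
        ring
      map_smul' := fun c T => by
        ext f
        simp only [h.dTrace_apply, map_smul, smul_apply, inner_smul_right, smul_eq_mul, mul_add,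
          RingHom.id_apply] } (2 * (2 / κ * ‖q‖)) fun S =>
    (h.norm_dTrace_le q S).trans (le_of_eq (by ring))

theorem hasFDerivAt_logDet_tsum (hμ : |μ| = 1) (hκ : 1 ≤ κ) {q : L2 X}
    (hq : 2 / κ * ‖q‖ ^ 2 < 1 / 2) :
    HasFDerivAt (logDet μ κ) (∑' n, (μ * Geometry.ell X κ * (-μ) ^ n) •
        (resolventPair hκ).dTrace q ((resolventPair hκ).lam q ^ n)) q := by
  have hκ0 : 0 < κ := by linarith
  -- On the ball of radius `√(κ/4)` one has `(2/κ)‖q‖² ≤ 1/2`, so `(1/2)^n` dominates the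
  -- differentiated terms; the ball is open and connected, and convergence at its centre starts the
  -- termwise differentiation.
  have hball : ∀ q ∈ Metric.ball (0 : L2 X) (Real.sqrt (κ / 4)), 2 / κ * ‖q‖ ^ 2 ≤ 1 / 2 := by
    intro q hq
    rw [mem_ball_zero_iff, Real.lt_sqrt (norm_nonneg _)] at hq
    rw [div_mul_eq_mul_div, div_le_iff₀ hκ0]
    linarith
  refine hasFDerivAt_tsum_of_isPreconnected
    (u := fun n : ℕ => 2 * (2 / κ * Real.sqrt (κ / 4)) * (1 / 2 : ℝ) ^ n)
    (f := fun n q => seriesTerm μ κ q n) (s := Metric.ball 0 (Real.sqrt (κ / 4))) (x₀ := 0)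
    (f' := fun n q => (μ * Geometry.ell X κ * (-μ) ^ n) •
        (resolventPair hκ).dTrace q ((resolventPair hκ).lam q ^ n))
    (summable_mul_pow (by norm_num) (by norm_num)) Metric.isOpen_ball
    (convex_ball _ _).isPreconnected (fun n q _ => hasFDerivAt_seriesTerm hκ q n)
    (fun n q hq => ?_) (Metric.mem_ball_self (Real.sqrt_pos.2 (by positivity)))
    (summable_seriesTerm hμ hκ (by rw [norm_zero]; norm_num)).of_abs ?_
  · rw [norm_smul]
    refine (mul_le_of_le_one_left (norm_nonneg _) (abs_coeff_le hμ hκ n)).trans ?_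
    refine ((resolventPair hκ).norm_dTrace_le q _).trans ?_
    have h1 := (norm_pow_le_pow_norm ((resolventPair hκ).lam q) n).trans
      (pow_le_pow_left₀ (norm_nonneg _) ((norm_lam_le hκ q).trans (hball q hq)) n)
    rw [mem_ball_zero_iff] at hq
    rw [mul_assoc 2 (2 / κ * Real.sqrt (κ / 4))]
    gcongr
  · rw [mem_ball_zero_iff, Real.lt_sqrt (norm_nonneg _)]
    rw [div_mul_eq_mul_div, div_lt_iff₀ hκ0] at hq
    linarith

theorem exists_isInversePair_lam (hμ : |μ| = 1) (hκ : 1 ≤ κ) {q : L2 X}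
    (hq : 2 / κ * ‖q‖ ^ 2 < 1) : ∃ R S, IsInversePair μ ((resolventPair hκ).fst.op q)
      ((resolventPair hκ).snd.op q) R S ∧
      HasSum (fun n : ℕ => (-μ) ^ n • (resolventPair hκ).lam q ^ n) R := by
  set h := resolventPair (X := X) hκ
  have h1 : ‖(-μ) • (h.snd.op q * h.fst.op q)‖ < 1 := by
    rw [norm_smul, Real.norm_eq_abs, abs_neg, hμ, one_mul]
    exact (h.norm_op_mul_op_le q).trans_lt hq
  have h2 : ‖(-μ) • (h.fst.op q * h.snd.op q)‖ < 1 := by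
    rw [norm_smul, Real.norm_eq_abs, abs_neg, hμ, one_mul]
    exact (h.swap.norm_op_mul_op_le q).trans_lt hq
  refine ⟨_, _, exists_isInversePair h1 h2, ?_⟩
  have := (summable_geometric_of_norm_lt_one h1).hasSum
  simp_rw [smul_pow] at this ⊢
  exact this

/-- The factor `1/m` has been cancelled by the derivative, and what remains is the Neumann series of
`R` inside a continuous linear map. -/
theorem hasFDerivAt_logDet (hμ : |μ| = 1) (hκ : 1 ≤ κ) {q : L2 X}
    (hq : 2 / κ * ‖q‖ ^ 2 < 1 / 2) {R : L2 X →L[ℝ] L2 X}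
    (hsum : HasSum (fun n : ℕ => (-μ) ^ n • (resolventPair hκ).lam q ^ n) R) :
    HasFDerivAt (logDet μ κ) ((μ * Geometry.ell X κ) • (resolventPair hκ).dTrace q R) q := by
  refine (hasFDerivAt_logDet_tsum hμ hκ hq).congr_fderiv ?_
  have h1 := ((hsum.const_smul (μ * Geometry.ell X κ)).mapL
    ((resolventPair hκ).dTraceL q)).tsum_eq
  rw [map_smul] at h1
  refine Eq.trans (tsum_congr fun n => ?_) h1
  rw [map_smul, map_smul, smul_smul]
  rfl

/-- Varying the factor `q` in `P'` produces `⟨q v_x, R v_x⟩`. Varying the one in `P` produces `⟨q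
v'_x, S v'_x⟩`, by `inner_diagTL_swap`. These are the off-diagonal Green's function entries up to
sign and `μ`. -/
theorem hasFunctionalDeriv_logDet (hμ : |μ| = 1) (hκ : 1 ≤ κ) {q : L2 X}
    (hq : 2 / κ * ‖q‖ ^ 2 < 1 / 2) {R S : L2 X →L[ℝ] L2 X}
    (hRS : IsInversePair μ ((resolventPair hκ).fst.op q) ((resolventPair hκ).snd.op q) R S)
    (hsum : HasSum (fun n : ℕ => (-μ) ^ n • (resolventPair hκ).lam q ^ n) R) :
    HasFunctionalDeriv (logDet μ κ) (rVar μ κ ((resolventPair hκ).green μ q R S)) q := by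
  set h := resolventPair (X := X) hκ
  have hμ' : μ * μ = 1 := by rw [← abs_mul_abs_self, hμ, one_mul]
  refine ⟨(diagonalSystem hμ' hκ _ hRS).memLp_r, _, hasFDerivAt_logDet hμ hκ hq hsum, fun f => ?_⟩
  have i1 := integrable_mul_L2 (Lp.memLp f) (h.memLp_diagT q R)
  have i2 := integrable_mul_L2 (Lp.memLp f) (h.swap.memLp_diagT q S)
  rw [smul_apply, h.dTrace_apply, h.inner_diagTL, h.inner_diagTL_swap hRS, ← integral_add i1 i2,
    smul_eq_mul, ← integral_const_mul]
  refine integral_congr_ae (Eventually.of_forall fun x => ?_)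
  simp only
  rw [rVar_green]
  ring

theorem exists_isGreenFunction (hμ : |μ| = 1) (hκ : 1 ≤ κ) {q : L2 X}
    (hq : 2 / κ * ‖q‖ ^ 2 < 1 / 2) :
    ∃ G, IsGreenFunction μ κ q G ∧ HasFunctionalDeriv (logDet μ κ) (rVar μ κ G) q := by
  obtain ⟨R, S, hRS, hsum⟩ := exists_isInversePair_lam hμ hκ (hq.trans (by norm_num))
  exact ⟨_, (resolventPair hκ).isGreenFunction hRS, hasFunctionalDeriv_logDet hμ hκ hq hRS hsum⟩

theorem hasPoissonBracket_logDet (hμ : |μ| = 1) {ϰ : ℝ} (hκ : 1 ≤ κ) (hϰ : 1 ≤ ϰ) {q : L2 X}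
    (hq : 2 / κ * ‖q‖ ^ 2 < 1 / 2) (hq' : 2 / ϰ * ‖q‖ ^ 2 < 1 / 2) :
    HasPoissonBracket (logDet μ κ) (logDet μ ϰ) q 0 := by
  have hμ' : μ * μ = 1 := by rw [← abs_mul_abs_self, hμ, one_mul]
  obtain ⟨R, S, hRS, hsum⟩ := exists_isInversePair_lam hμ hκ (hq.trans (by norm_num))
  obtain ⟨R', S', hRS', hsum'⟩ := exists_isInversePair_lam hμ hϰ (hq'.trans (by norm_num))
  have d := diagonalSystem hμ' hκ (resolventPair hκ) hRS
  have d' := diagonalSystem hμ' hϰ (resolventPair hϰ) hRS'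
  refine ⟨_, _, _, hasFunctionalDeriv_logDet hμ hκ hq hRS hsum,
    hasFunctionalDeriv_logDet hμ hϰ hq' hRS' hsum',
    hasWeakDeriv_of_prim d'.memLp_r (d'.memLp_s.const_mul (-2 * ϰ))
      (d'.prim_s.measurable_of_comp_proj.const_mul (-2 * ϰ)) d'.prim_r, ?_⟩
  have e := d.integral_mul_eq_zero (by linarith) (by linarith) d' (fun hh => ?_)
  · simp_rw [mul_left_comm _ (-2 * ϰ)]
    rw [integral_const_mul, e, mul_zero]
  -- For equal parameters the two choices of inverses coincide: `R` as the limit of the same series,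
  -- `S` by uniqueness of inverses.
  · subst hh
    have hR : R = R' := hsum.unique hsum'
    have hS : S = S' := left_inv_eq_right_inv hRS.right_mul hRS'.mul_right
    rw [hR, hS]
    exact ⟨rfl, rfl⟩


end

/-! ## Expansion for large `κ` -/

section
variable {X : Type} [AddCommGroup X] [TopologicalSpace X] [IsTopologicalAddGroup X]
  [T2Space X] [LocallyCompactSpace X] [SecondCountableTopology X] [MeasureSpace X] [BorelSpace X]
  [(volume : Measure X).IsAddHaarMeasure] [Geometry X] [RegularGeometry X]

/-! ### Calculus with Schwartz functions -/

section Schwartz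

variable {φ ψ : X → ℝ}

theorem continuous_of_isSchwartz (hφ : Geometry.IsSchwartz φ) : Continuous φ :=
  continuous_of_contDiff (RegularGeometry.contDiff_of_isSchwartz φ hφ)

theorem memLp_of_isSchwartz (hφ : Geometry.IsSchwartz φ) : MemLp φ 2 volume := by
  refine (memLp_two_iff_integrable_sq (continuous_of_isSchwartz hφ).aestronglyMeasurable).2 ?_
  simp_rw [sq]
  exact RegularGeometry.integrable_of_isSchwartz _ (RegularGeometry.isSchwartz_mul _ _ hφ hφ)

theorem prim_of_isSchwartz (hφ : Geometry.IsSchwartz φ) :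
    Prim (fun s => φ (Geometry.proj s)) fun s => xDeriv φ (Geometry.proj s) :=
  prim_xDeriv (RegularGeometry.contDiff_of_isSchwartz φ hφ)

theorem integrable_mul_of_isSchwartz (hφ : Geometry.IsSchwartz φ) (hψ : Geometry.IsSchwartz ψ) :
    Integrable fun x => φ x * ψ x :=
  RegularGeometry.integrable_of_isSchwartz _ (RegularGeometry.isSchwartz_mul _ _ hφ hψ)

/-- Integration by parts. -/
theorem integral_xDeriv_mul (hφ : Geometry.IsSchwartz φ) (hψ : Geometry.IsSchwartz ψ) :
    ∫ x, xDeriv φ x * ψ x = -∫ x, φ x * xDeriv ψ x := by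
  have hφ' := RegularGeometry.isSchwartz_xDeriv _ hφ
  have hψ' := RegularGeometry.isSchwartz_xDeriv _ hψ
  have i1 := integrable_mul_of_isSchwartz hφ' hψ
  have i2 := integrable_mul_of_isSchwartz hψ' hφ
  have := integral_eq_zero_of_prim (integrable_mul_of_isSchwartz hφ hψ) (i1.add i2)
    (((continuous_of_isSchwartz hφ').mul (continuous_of_isSchwartz hψ)).add
      ((continuous_of_isSchwartz hψ').mul (continuous_of_isSchwartz hφ))).measurable
    ((prim_of_isSchwartz hφ).mul (prim_of_isSchwartz hψ))
  rw [integral_add' i1 i2] at this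
  simp_rw [mul_comm (φ _)]
  linarith

theorem integral_mul_xDeriv_self (hφ : Geometry.IsSchwartz φ) : ∫ x, φ x * xDeriv φ x = 0 := by
  have := integral_xDeriv_mul hφ hφ
  simp_rw [mul_comm (xDeriv φ _)] at this
  linarith

theorem xDeriv_mul (hφ : Geometry.IsSchwartz φ) (hψ : Geometry.IsSchwartz ψ) (x : X) :
    xDeriv (fun x => φ x * ψ x) x = xDeriv φ x * ψ x + φ x * xDeriv ψ x := by
  obtain ⟨t, rfl⟩ := RegularGeometry.surjective_proj x
  rw [← deriv_comp_proj, ← deriv_comp_proj, ← deriv_comp_proj]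
  exact deriv_fun_mul ((RegularGeometry.contDiff_of_isSchwartz φ hφ).differentiable (by simp) t)
    ((RegularGeometry.contDiff_of_isSchwartz ψ hψ).differentiable (by simp) t)

theorem integral_cube_mul_xDeriv (hφ : Geometry.IsSchwartz φ) :
    ∫ x, φ x ^ 3 * xDeriv φ x = 0 := by
  have h2 := RegularGeometry.isSchwartz_mul _ _ hφ hφ
  have := integral_mul_xDeriv_self h2
  simp_rw [xDeriv_mul hφ hφ] at this
  have e : ∀ x, φ x * φ x * (xDeriv φ x * φ x + φ x * xDeriv φ x) = 2 * (φ x ^ 3 * xDeriv φ x) :=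
    fun x => by ring
  simp_rw [e] at this
  rw [integral_const_mul] at this
  linarith

end Schwartz

theorem integral_add₅ {f g h u v : X → ℝ} (hf : Integrable f) (hg : Integrable g)
    (hh : Integrable h) (hu : Integrable u) (hv : Integrable v) :
    ∫ x, f x + g x + h x + u x + v x =
      (∫ x, f x) + (∫ x, g x) + (∫ x, h x) + (∫ x, u x) + ∫ x, v x := by
  have i1 : Integrable fun x => f x + g x := hf.add hg
  have i2 : Integrable fun x => f x + g x + h x := i1.add hh
  have i3 : Integrable fun x => f x + g x + h x + u x := i2.add hu
  rw [integral_add i3 hv, integral_add i2 hu, integral_add i1 hh, integral_add hf hg]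

namespace IsResolventKernel

variable {κ ε : ℝ} {k : X → ℝ} {φ : X → ℝ}

/-- The defect `κ k*φ - φ + ε k*φ'` is bounded and satisfies `w' = -εκ w`, so it vanishes. Each
application gains one power of `1/κ`. -/
theorem conv_eq_sub (hk : IsResolventKernel κ ε k) (hφ : Geometry.IsSchwartz φ) (x : X) :
    conv k φ x = φ x / κ - ε * conv k (xDeriv φ) x / κ := by
  have hφ' := RegularGeometry.isSchwartz_xDeriv _ hφ
  obtain ⟨C, hC⟩ := RegularGeometry.bounded_of_isSchwartz _ hφ
  obtain ⟨C', hC'⟩ := RegularGeometry.bounded_of_isSchwartz _ hφ'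
  have p0 := hk.prim_conv (continuous_of_isSchwartz hφ).measurable
    (hk.integrable_mul_of_memLp (memLp_of_isSchwartz hφ))
  have p1 := hk.prim_conv (continuous_of_isSchwartz hφ').measurable
    (hk.integrable_mul_of_memLp (memLp_of_isSchwartz hφ'))
  obtain ⟨t, rfl⟩ := RegularGeometry.surjective_proj x
  have hκ := hk.pos
  have hε := hk.eps_sq
  have := Prim.eq_zero_of_bounded (c := -(ε * κ)) (C := κ * (C / κ) + C + C' / κ)
    (((p0.const_mul κ).add ((prim_of_isSchwartz hφ).const_mul (-1))).add (p1.const_mul ε) |>.congr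
      (u' := fun s => κ * conv k φ (Geometry.proj s) - φ (Geometry.proj s) +
        ε * conv k (xDeriv φ) (Geometry.proj s)) (fun s => by ring) (fun s => ?_))
    (neg_ne_zero.2 (mul_ne_zero hk.eps_ne_zero hκ.ne')) (fun s => ?_) t
  · field_simp
    linarith
  · linear_combination (-xDeriv φ (Geometry.proj s)) * hε
  · have h1 := hk.abs_conv_le hC (Geometry.proj s)
    have h2 := hk.abs_conv_le hC' (Geometry.proj s)
    have h3 := hC (Geometry.proj s)
    have h4 : |ε| = 1 := by rcases hk.eps with h | h <;> simp [h]
    refine (abs_add_le _ _).trans (add_le_add ((abs_sub _ _).trans (add_le_add ?_ h3)) ?_)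
    · rw [abs_mul, abs_of_pos hκ]
      exact mul_le_mul_of_nonneg_left h1 hκ.le
    · rwa [abs_mul, h4, one_mul]

/-- The expansion of the quadratic form of a resolvent. -/
theorem exists_integral_mul_conv_le (hφ : Geometry.IsSchwartz φ) : ∃ C : ℝ, ∀ (κ ε : ℝ) (k : X → ℝ),
    IsResolventKernel κ ε k → |(∫ x, φ x * conv k φ x) -
      ((∫ x, φ x ^ 2) / κ - (∫ x, xDeriv φ x ^ 2) / κ ^ 3)| ≤ C / κ ^ 5 := by
  have h1 := RegularGeometry.isSchwartz_xDeriv _ hφ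
  have h2 := RegularGeometry.isSchwartz_xDeriv _ h1
  have h3 := RegularGeometry.isSchwartz_xDeriv _ h2
  have h4 := RegularGeometry.isSchwartz_xDeriv _ h3
  obtain ⟨C, hC⟩ := RegularGeometry.bounded_of_isSchwartz _ h4
  have hi := RegularGeometry.integrable_of_isSchwartz _ hφ
  refine ⟨C * ∫ x, |φ x|, fun κ ε k hk => ?_⟩
  have hκ := hk.pos
  have hε := hk.eps_sq
  -- Four iterations. The terms of orders `κ⁻²` and `κ⁻⁴` integrate to zero because `φφ'` and
  -- `φφ'''` do; the remainder carries `κ⁻⁴` and a further `1/κ` from the convolution.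
  have e : ∀ x, φ x * conv k φ x = (φ x * φ x) * (1 / κ) + (φ x * xDeriv φ x) * (-ε / κ ^ 2) +
      (φ x * xDeriv (xDeriv φ) x) * (1 / κ ^ 3) +
      (φ x * xDeriv (xDeriv (xDeriv φ)) x) * (-ε / κ ^ 4) +
      (φ x * conv k (xDeriv (xDeriv (xDeriv (xDeriv φ)))) x) * (1 / κ ^ 4) := fun x => by
    rw [hk.conv_eq_sub hφ, hk.conv_eq_sub h1, hk.conv_eq_sub h2, hk.conv_eq_sub h3]
    have : ε ^ 2 = 1 := by rw [sq, hε]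
    have h3 : ε ^ 3 = ε := by rw [pow_succ, this, one_mul]
    have h4 : ε ^ 4 = 1 := by rw [pow_succ, h3, hε]
    field_simp
    ring_nf
    rw [this, h3, h4]
    ring
  have i0 := (integrable_mul_of_isSchwartz hφ hφ).mul_const (1 / κ)
  have i1 := (integrable_mul_of_isSchwartz hφ h1).mul_const (-ε / κ ^ 2)
  have i2 := (integrable_mul_of_isSchwartz hφ h2).mul_const (1 / κ ^ 3)
  have i3 := (integrable_mul_of_isSchwartz hφ h3).mul_const (-ε / κ ^ 4)
  have i4 := (integrable_mul_L2 (memLp_of_isSchwartz hφ)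
    (hk.memLp_conv (memLp_of_isSchwartz h4))).mul_const (1 / κ ^ 4)
  have z2 : ∫ x, φ x * xDeriv (xDeriv φ) x = -∫ x, xDeriv φ x * xDeriv φ x := by
    rw [integral_xDeriv_mul hφ h1, neg_neg]
  have z3 : ∫ x, φ x * xDeriv (xDeriv (xDeriv φ)) x = 0 := by
    have := integral_xDeriv_mul hφ h2
    rw [integral_mul_xDeriv_self h1] at this
    linarith
  have b4 : |∫ x, φ x * conv k (xDeriv (xDeriv (xDeriv (xDeriv φ)))) x| ≤
      C / κ * ∫ x, |φ x| := by
    rw [← integral_const_mul, ← Real.norm_eq_abs]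
    refine norm_integral_le_of_norm_le (hi.abs.const_mul _) (Eventually.of_forall fun x => ?_)
    rw [norm_mul, mul_comm]
    exact mul_le_mul_of_nonneg_right (hk.abs_conv_le hC x) (abs_nonneg _)
  simp_rw [e]
  rw [integral_add₅ i0 i1 i2 i3 i4]
  simp_rw [integral_mul_const]
  rw [integral_mul_xDeriv_self hφ, z2, z3]
  simp_rw [← sq]
  calc _ = |(∫ x, φ x * conv k (xDeriv (xDeriv (xDeriv (xDeriv φ)))) x) * (1 / κ ^ 4)| := by
        congr 1; ring
    _ ≤ C / κ * (∫ x, |φ x|) * (1 / κ ^ 4) := by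
        rw [abs_mul, abs_of_pos (show 0 < 1 / κ ^ 4 by positivity)]
        gcongr
    _ = _ := by field_simp

theorem conv_eq_expansion (hk : IsResolventKernel κ ε k) (hφ : Geometry.IsSchwartz φ) (x : X) :
    κ * conv k φ x = φ x - 1 / κ * (ε * xDeriv φ x) +
      (1 / κ) ^ 2 * (κ * conv k (xDeriv (xDeriv φ)) x) := by
  have hκ := hk.pos
  rw [hk.conv_eq_sub hφ, hk.conv_eq_sub (RegularGeometry.isSchwartz_xDeriv _ hφ)]
  have : ε ^ 2 = 1 := by rw [sq, hk.eps_sq]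
  field_simp
  rw [← sub_eq_zero]
  ring_nf
  rw [this]
  ring

end IsResolventKernel

/-- Here `t = 1/κ`. The first-order part is `-p²d + 2p²d = p²d`. The four groups of second-order
terms are bounded by `3 + 4 + 8 + 8 = 23` times `B³`. -/
theorem abs_cubic_sub_le {p d e f t B : ℝ} (hp : |p| ≤ B) (hd : |d| ≤ B) (he : |e| ≤ B)
    (hf : |f| ≤ B) (ht : 0 ≤ t) (ht' : t ≤ 1) :
    |(p - t * d + t ^ 2 * e) * (p + t * d + t ^ 2 * f) ^ 2 - (p ^ 3 + t * (p ^ 2 * d))| ≤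
      23 * B ^ 3 * t ^ 2 := by
  have hB : 0 ≤ B := (abs_nonneg p).trans hp
  have hm : ∀ {x y a b : ℝ}, |x| ≤ a → |y| ≤ b → |x * y| ≤ a * b := fun hx hy => by
    rw [abs_mul]; exact mul_le_mul hx hy (abs_nonneg _) ((abs_nonneg _).trans hx)
  have ha : ∀ {x y a b : ℝ}, |x| ≤ a → |y| ≤ b → |x + y| ≤ a + b := fun hx hy =>
    (abs_add_le _ _).trans (add_le_add hx hy)
  have h1 : |t| ≤ 1 := by rwa [abs_of_nonneg ht]
  have hα : |d + t * f| ≤ B + 1 * B := ha hd (hm h1 hf)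
  have hβ : |-d + t * e| ≤ B + 1 * B := ha (by rwa [abs_neg]) (hm h1 he)
  have e1 : (p - t * d + t ^ 2 * e) * (p + t * d + t ^ 2 * f) ^ 2 - (p ^ 3 + t * (p ^ 2 * d)) =
      (p * p * (f + f + e) + p * ((d + t * f) * (d + t * f)) +
        (p + p) * ((d + t * f) * (-d + t * e)) +
        t * ((d + t * f) * (d + t * f) * (-d + t * e))) * t ^ 2 := by ring
  rw [e1, abs_mul, abs_of_nonneg (sq_nonneg t)]
  refine mul_le_mul_of_nonneg_right ((ha (ha (ha (hm (hm hp hp) (ha (ha hf hf) he))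
    (hm hp (hm hα hα))) (hm (ha hp hp) (hm hα hβ))) (hm h1 (hm (hm hα hα) hβ))).trans
    (le_of_eq (by ring))) (sq_nonneg t)

theorem integrable_quartic {φ : X → ℝ} (hφ : Geometry.IsSchwartz φ) {κ ε ε' : ℝ} {k k' : X → ℝ}
    (hk : IsResolventKernel κ ε k) (hk' : IsResolventKernel κ ε' k') :
    Integrable fun x => φ x * (conv k φ x * conv k' φ x ^ 2) := by
  obtain ⟨B, hB⟩ := RegularGeometry.bounded_of_isSchwartz _ hφ
  have hm := memLp_of_isSchwartz hφ
  have h := integrable_mul_L2 (hk.memLp_conv hm) (hk'.memLp_conv hm)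
  refine (h.bdd_mul (f := fun x => φ x * conv k' φ x) (c := B * (B / κ))
    ((continuous_of_isSchwartz hφ).mul (hk'.continuous_conv hm)).aestronglyMeasurable
    (Eventually.of_forall fun x => ?_)).congr (Eventually.of_forall fun x => by simp only; ring)
  rw [norm_mul]
  exact mul_le_mul (hB x) (hk'.abs_conv_le hB x) (norm_nonneg _) ((abs_nonneg _).trans (hB x))

/-- The correction of order `κ⁻⁴` is a multiple of `∫ φ³φ' = 0`, so the error is two orders below
the leading term. -/
theorem exists_integral_quartic_le {φ : X → ℝ} (hφ : Geometry.IsSchwartz φ) :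
    ∃ C : ℝ, ∀ (κ ε : ℝ) (k k' : X → ℝ), IsResolventKernel κ ε k → IsResolventKernel κ (-ε) k' →
      |(∫ x, φ x * (conv k φ x * conv k' φ x ^ 2)) - (∫ x, φ x ^ 4) / κ ^ 3| ≤ C / κ ^ 5 := by
  have h1 := RegularGeometry.isSchwartz_xDeriv _ hφ
  have h2 := RegularGeometry.isSchwartz_xDeriv _ h1
  obtain ⟨C₀, hC₀⟩ := RegularGeometry.bounded_of_isSchwartz _ hφ
  obtain ⟨C₁, hC₁⟩ := RegularGeometry.bounded_of_isSchwartz _ h1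
  obtain ⟨C₂, hC₂⟩ := RegularGeometry.bounded_of_isSchwartz _ h2
  have hi := RegularGeometry.integrable_of_isSchwartz _ hφ
  set B := max C₀ (max C₁ C₂) with hB
  have hB0 : C₀ ≤ B := le_max_left _ _
  have hB1 : C₁ ≤ B := (le_max_left _ _).trans (le_max_right _ _)
  have hB2 : C₂ ≤ B := (le_max_right _ _).trans (le_max_right _ _)
  refine ⟨23 * B ^ 3 * ∫ x, |φ x|, fun κ ε k k' hk hk' => ?_⟩
  have hκ := hk.pos
  have hε : |ε| = 1 := by rcases hk.eps with h | h <;> simp [h]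
  have hc : ∀ {ε' : ℝ} {k : X → ℝ}, IsResolventKernel κ ε' k → ∀ x,
      |κ * conv k (xDeriv (xDeriv φ)) x| ≤ B := fun hk x => by
    rw [abs_mul, abs_of_pos hκ]
    refine (mul_le_mul_of_nonneg_left (hk.abs_conv_le hC₂ x) hκ.le).trans ?_
    rwa [mul_div_cancel₀ _ hκ.ne']
  have hpt : ∀ x, |φ x * (conv k φ x * conv k' φ x ^ 2) -
      (φ x ^ 4 * (1 / κ ^ 3) + φ x ^ 3 * xDeriv φ x * (ε / κ ^ 4))| ≤
      23 * B ^ 3 * (1 / κ ^ 5) * |φ x| := fun x => by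
    have e1 := hk.conv_eq_expansion hφ x
    have e2 := hk'.conv_eq_expansion hφ x
    rw [neg_mul, mul_neg, sub_neg_eq_add] at e2
    have := abs_cubic_sub_le ((hC₀ x).trans hB0)
      (show |ε * xDeriv φ x| ≤ B by rw [abs_mul, hε, one_mul]; exact (hC₁ x).trans hB1)
      (hc hk x) (hc hk' x) (one_div_nonneg.2 hκ.le) ((div_le_one hκ).2 hk.one_le)
    rw [← e1, ← e2] at this
    have e3 : φ x * (conv k φ x * conv k' φ x ^ 2) -
        (φ x ^ 4 * (1 / κ ^ 3) + φ x ^ 3 * xDeriv φ x * (ε / κ ^ 4)) =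
        (κ * conv k φ x * (κ * conv k' φ x) ^ 2 -
          (φ x ^ 3 + 1 / κ * (φ x ^ 2 * (ε * xDeriv φ x)))) * (1 / κ ^ 3) * φ x := by
      field_simp
    rw [e3, abs_mul, abs_mul, abs_of_pos (show 0 < 1 / κ ^ 3 by positivity)]
    refine mul_le_mul_of_nonneg_right ?_ (abs_nonneg _)
    refine (mul_le_mul_of_nonneg_right this (by positivity)).trans (le_of_eq ?_)
    field_simp
  have i4 : Integrable fun x => φ x ^ 4 * (1 / κ ^ 3) := by
    have h := RegularGeometry.isSchwartz_mul _ _ hφ hφ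
    exact ((integrable_mul_of_isSchwartz h h).congr
      (Eventually.of_forall fun x => by ring)).mul_const _
  have i3 : Integrable fun x => φ x ^ 3 * xDeriv φ x * (ε / κ ^ 4) := by
    have h := RegularGeometry.isSchwartz_mul _ _ hφ hφ
    exact ((integrable_mul_of_isSchwartz h (RegularGeometry.isSchwartz_mul _ _ hφ h1)).congr
      (Eventually.of_forall fun x => by ring)).mul_const _
  have key := norm_integral_le_of_norm_le (f := fun x => φ x * (conv k φ x * conv k' φ x ^ 2) -
    (φ x ^ 4 * (1 / κ ^ 3) + φ x ^ 3 * xDeriv φ x * (ε / κ ^ 4)))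
    (hi.abs.const_mul (23 * B ^ 3 * (1 / κ ^ 5)))
    (Eventually.of_forall hpt)
  have i5 := i4.add i3
  simp only [Pi.add_def] at i5
  rw [integral_sub (integrable_quartic hφ hk hk') i5, integral_add i4 i3,
    integral_mul_const, integral_mul_const, integral_cube_mul_xDeriv hφ, zero_mul, add_zero,
    integral_const_mul, mul_one_div,
    Real.norm_eq_abs] at key
  refine key.trans (le_of_eq ?_)
  ring

end

/-! ### The first two traces and the tail of the series -/

section
variable {X : Type} [AddCommGroup X] [TopologicalSpace X] [IsTopologicalAddGroup X]
  [T2Space X] [LocallyCompactSpace X] [SecondCountableTopology X] [MeasureSpace X] [BorelSpace X]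
  [(volume : Measure X).IsAddHaarMeasure] [Geometry X] [RegularGeometry X]

variable {κ : ℝ}

theorem ResolventPair.diagU_one_eq {ε : ℝ} {k k' : X → ℝ} (h : ResolventPair κ ε k k') (q : L2 X)
    (x : X) : Integrable (fun y => q y * k' (x - y) * ∫ z, k (y - z) * (q z * k (x - z))) ∧
      h.diagU q 1 x = ∫ y, q y * k' (x - y) * ∫ z, k (y - z) * (q z * k (x - z)) := by
  have e1 : ∀ y, inner ℝ (h.fst.mulVec q y) (h.fst.vec x) =
      ∫ z, k (y - z) * (q z * k (x - z)) := fun y => by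
    rw [h.fst.inner_mulVec]
    refine integral_congr_ae ?_
    filter_upwards [h.fst.coeFn_vec x] with z hz
    rw [hz]
  have e2 : (fun y => h.snd.mulVec q x y * h.fst.op q (h.fst.vec x) y) =ᵐ[volume]
      fun y => q y * k' (x - y) * ∫ z, k (y - z) * (q z * k (x - z)) := by
    filter_upwards [h.snd.coeFn_mulVec q x, h.fst.coeFn_op q (h.fst.vec x)] with y h1 h2
    rw [h1, h2, e1]
  refine ⟨(integrable_mul_L2 (Lp.memLp _) (Lp.memLp _)).congr e2, ?_⟩
  rw [← integral_congr_ae e2, ← inner_L2]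
  rfl

variable (X) in
-- For `R = 1` the function is a double integral of `q(y)q(z)` against `k(y - x) k(y - z) k(x - z)`.
-- Since `y - z = (y - x) + (x - z)`, `kerPlus_add` replaces the middle factor by `ℓ` times the
-- product of the outer ones. With `ℓk²` the kernel at `2κ`, the double integral factors into two
-- convolutions.
theorem exists_abs_diagU_sub_le : ∃ C : ℝ, 0 ≤ C ∧ ∀ (κ : ℝ) (hκ : 1 ≤ κ) (q : L2 X), Integrable q →
    ∀ x, |Geometry.ell X κ * (resolventPair hκ).diagU q 1 x -
      conv (Geometry.kerMinus (2 * κ)) q x * conv (Geometry.kerPlus (2 * κ)) q x| ≤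
        C / κ ^ 4 * (∫ y, |q y|) ^ 2 := by
  obtain ⟨C, hC⟩ := RegularGeometry.kerPlus_add (X := X)
  have hC0 : 0 ≤ C := by
    have := (abs_nonneg _).trans (hC 1 le_rfl 0 0)
    simpa using this
  refine ⟨C, hC0, fun κ hκ q hq x => ?_⟩
  have hκ0 : 0 < κ := by linarith
  have h := resolventPair (X := X) hκ
  have h2 := resolventPair (X := X) (κ := 2 * κ) (by linarith)
  obtain ⟨iD, eD⟩ := h.diagU_one_eq q x
  have hℓ := RegularGeometry.ell_mem (X := X) κ hκ
  set ℓ := Geometry.ell X κ with hℓd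
  have iE : Integrable fun y => Geometry.kerMinus (2 * κ) (x - y) * q y *
      conv (Geometry.kerPlus (2 * κ)) q x :=
    (h2.snd.integrable_mul_of_integrable hq x).mul_const _
  change |ℓ * h.diagU q 1 x - _| ≤ _
  rw [eD, ← integral_const_mul, show conv (Geometry.kerMinus (2 * κ)) q x *
    conv (Geometry.kerPlus (2 * κ)) q x = ∫ y, Geometry.kerMinus (2 * κ) (x - y) * q y *
      conv (Geometry.kerPlus (2 * κ)) q x from (integral_mul_const _ _).symm,
    ← integral_sub (iD.const_mul ℓ) iE, ← Real.norm_eq_abs]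
  refine (norm_integral_le_of_norm_le (hq.abs.const_mul (C / κ ^ 4 * ∫ y, |q y|))
    (Eventually.of_forall fun y => ?_)).trans (le_of_eq ?_)
  · have i1 : Integrable fun z => ℓ * (q y * Geometry.kerMinus κ (x - y)) *
        (Geometry.kerPlus κ (y - z) * (q z * Geometry.kerPlus κ (x - z))) := by
      refine (h.fst.integrable_mul_of_integrable ?_ y).const_mul _
      refine (h.fst.integrable_mul_of_integrable hq x).congr (Eventually.of_forall fun z => ?_)
      simp only [mul_comm]
    have i2 : Integrable fun z => Geometry.kerMinus (2 * κ) (x - y) * q y *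
        (Geometry.kerPlus (2 * κ) (x - z) * q z) :=
      (h2.fst.integrable_mul_of_integrable hq x).const_mul _
    rw [conv, ← mul_assoc, ← integral_const_mul, ← integral_const_mul, ← integral_sub i1 i2]
    refine (norm_integral_le_of_norm_le (hq.abs.const_mul (C / κ ^ 4 * |q y|))
      (Eventually.of_forall fun z => ?_)).trans (le_of_eq ?_)
    · have := hC κ hκ (y - x) (x - z)
      rw [sub_add_sub_cancel] at this
      have e : ℓ * (q y * Geometry.kerMinus κ (x - y)) *
          (Geometry.kerPlus κ (y - z) * (q z * Geometry.kerPlus κ (x - z))) -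
          Geometry.kerMinus (2 * κ) (x - y) * q y * (Geometry.kerPlus (2 * κ) (x - z) * q z) =
          Geometry.kerPlus κ (y - x) * Geometry.kerPlus κ (x - z) * (Geometry.kerPlus κ (y - z) -
            ℓ * Geometry.kerPlus κ (y - x) * Geometry.kerPlus κ (x - z)) * ℓ * q y * q z := by
        rw [RegularGeometry.kerMinus_eq, RegularGeometry.kerMinus_eq, neg_sub,
          ← RegularGeometry.ell_mul_sq κ hκ, ← RegularGeometry.ell_mul_sq κ hκ]
        ring
      rw [e, norm_mul, norm_mul, norm_mul, Real.norm_eq_abs, Real.norm_eq_abs, Real.norm_eq_abs,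
        Real.norm_eq_abs]
      have h1 : |ℓ| ≤ 1 := by rw [abs_of_nonneg (by linarith [hℓ.1])]; exact hℓ.2
      have := mul_le_mul this h1 (abs_nonneg _) (by positivity)
      rw [mul_one] at this
      gcongr
    · rw [integral_const_mul]; ring
  · rw [integral_const_mul]; ring

/-- Let `Θ = ⟨q v_x, Λ v_x⟩`, so that `tr Λ² = ∫ qΘ`. In the derivative of `w · ℓΘ` the terms in `κ`
cancel, because `w' = 2κw - q` and `Θ' = 2qU - 2κΘ`. Integration trades `∫ qΘ` for `2∫ w q U`, with
one operator fewer. -/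
theorem ell_mul_opTrace_lam_sq (hκ : 1 ≤ κ) (q : L2 X) :
    Integrable (fun x => conv (Geometry.kerMinus (2 * κ)) q x * q x *
        (Geometry.ell X κ * (resolventPair hκ).diagU q 1 x)) ∧
      Geometry.ell X κ * opTrace ((resolventPair hκ).lam q ^ 2) =
      2 * ∫ x, conv (Geometry.kerMinus (2 * κ)) q x * q x *
        (Geometry.ell X κ * (resolventPair hκ).diagU q 1 x) := by
  have hκ0 : 0 < κ := by linarith
  set h := resolventPair (X := X) hκ
  have h2 := resolventPair (X := X) (κ := 2 * κ) (by linarith)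
  set ℓ := Geometry.ell X κ
  have h0 : IsInversePair (0 : ℝ) (h.fst.op q) (h.snd.op q) 1 1 := IsInversePair.zero _ _
  set w := conv (Geometry.kerMinus (2 * κ)) q with hw
  have hq := (Lp.stronglyMeasurable q).measurable
  have hwm : MemLp w 2 volume := h2.snd.memLp_conv (Lp.memLp q)
  have hwc : Continuous w := h2.snd.continuous_conv (Lp.memLp q)
  have hΘm := h.memLp_diagT q (h.lam q)
  have hΘc := h.continuous_diagT q (h.lam q)
  have pw := h2.snd.prim_conv hq (h2.snd.integrable_mul_of_memLp (Lp.memLp q))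
  have pΘ := (h.prim_inner_op_op h0).const_mul ℓ
  have p := pw.mul pΘ
  obtain ⟨C, hC⟩ := h.exists_abs_diagU_le h0
  have i1 : Integrable fun x => w x * q x * (ℓ * h.diagU q 1 x) := by
    refine (integrable_mul_L2 hwm (Lp.memLp q)).mul_bdd (c := |ℓ| * C)
      (continuous_const.mul (h.continuous_diagU q 1)).aestronglyMeasurable
      (Eventually.of_forall fun x => ?_)
    rw [norm_mul]
    exact mul_le_mul_of_nonneg_left (hC x) (abs_nonneg _)
  refine ⟨i1, ?_⟩
  have i2 := (integrable_mul_L2 (Lp.memLp q) hΘm).const_mul ℓ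
  have := integral_eq_zero_of_prim (u := fun x => w x * (ℓ * h.diagT q (h.lam q) x))
    (v := fun x => 2 * (w x * q x * (ℓ * h.diagU q 1 x)) - ℓ * (q x * h.diagT q (h.lam q) x))
    (integrable_mul_L2 hwm (hΘm.const_mul ℓ)) ((i1.const_mul 2).sub i2)
    ((((hwc.measurable.mul hq).mul ((h.continuous_diagU q 1).measurable.const_mul ℓ)).const_mul
      2).sub ((hq.mul hΘc.measurable).const_mul ℓ))
    (p.congr (fun s => rfl) fun s => ?_)
  · rw [integral_sub (i1.const_mul 2) i2, integral_const_mul, integral_const_mul,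
      sub_eq_zero] at this
    rw [this, h.opTrace_lam_pow, h.inner_diagTL, pow_one]
  · have e : h.diagT q (h.lam q) (Geometry.proj s) = inner ℝ (h.fst.mulVec q (Geometry.proj s))
      (h.snd.op q ((1 : L2 X →L[ℝ] L2 X) (h.fst.op q (h.fst.vec (Geometry.proj s))))) := rfl
    rw [e]
    ring

theorem ell_mul_opTrace_lam (hκ : 1 ≤ κ) (q : L2 X) :
    Geometry.ell X κ * opTrace ((resolventPair hκ).lam q) =
      ∫ x, q x * conv (Geometry.kerPlus (2 * κ)) q x := by
  have h2 := resolventPair (X := X) (κ := 2 * κ) (by linarith)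
  have := (resolventPair hκ).opTrace_lam_pow q 0
  rw [zero_add, pow_one, pow_zero, ResolventPair.inner_diagTL] at this
  rw [this, ← integral_const_mul]
  refine integral_congr_ae (Eventually.of_forall fun x => ?_)
  simp only
  rw [← h2.fst.inner_vec, ← ResolventPair.mul_inner_mulVec_vec (resolventPair hκ).fst h2.fst
    (RegularGeometry.ell_mul_sq κ hκ), mul_left_comm]
  rfl

/-- For bounded `q` the operator is a resolvent after a bounded multiplication, which gives decay
`1/κ` in place of `κ^{-1/2}`. The tail of the series needs this to reach `κ⁻⁵`. -/
theorem IsResolventKernel.norm_op_le_of_bounded {ε : ℝ} {k : X → ℝ} (hk : IsResolventKernel κ ε k)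
    {q : L2 X} {B : ℝ} (hB : ∀ᵐ x, |q x| ≤ B) (hB0 : 0 ≤ B) : ‖hk.op q‖ ≤ B / κ := by
  have hκ := hk.pos
  refine ContinuousLinearMap.opNorm_le_bound _ (by positivity) fun f => ?_
  have hm : MemLp (fun x => q x * f x) 2 volume := by
    refine ((Lp.memLp f).const_mul B).mono ((Lp.stronglyMeasurable q).mul
      (Lp.stronglyMeasurable f)).aestronglyMeasurable ?_
    filter_upwards [hB] with x hx
    rw [norm_mul, norm_mul, Real.norm_eq_abs B, abs_of_nonneg hB0]
    exact mul_le_mul_of_nonneg_right hx (norm_nonneg _)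
  rw [← hk.res_toLp_mul q f hm]
  refine (hk.res.le_opNorm _).trans ?_
  have : ‖hm.toLp _‖ ≤ B * ‖f‖ := by
    refine Lp.norm_le_mul_norm_of_ae_le_mul ?_
    filter_upwards [hB, hm.coeFn_toLp] with x hx h1
    rw [h1, norm_mul]
    exact mul_le_mul_of_nonneg_right hx (norm_nonneg _)
  calc _ ≤ 1 / κ * (B * ‖f‖) := mul_le_mul hk.norm_res_le this (norm_nonneg _) (by positivity)
    _ = _ := by ring

theorem conv_congr_ae (k : X → ℝ) {f g : X → ℝ} (h : f =ᵐ[volume] g) : conv k f = conv k g := by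
  funext x
  refine integral_congr_ae ?_
  filter_upwards [h] with z hz
  rw [hz]

/-- In the terms with `m ≥ 3`, two factors `‖Λ‖` are bounded by `b` and the others by `1/2`, whence
the factor `2`. -/
theorem abs_logDet_sub_le {μ : ℝ} (hμ : |μ| = 1) (hκ : 1 ≤ κ) {q : L2 X} {b : ℝ}
    (hq : 2 / κ * ‖q‖ ^ 2 ≤ 1 / 2) (hb : ‖(resolventPair hκ).lam q‖ ≤ b) :
    |logDet μ κ q - (μ * (Geometry.ell X κ * opTrace ((resolventPair hκ).lam q)) -
      1 / 2 * (Geometry.ell X κ * opTrace ((resolventPair hκ).lam q ^ 2)))| ≤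
      2 * (2 / κ * ‖q‖ ^ 2 * b ^ 2) := by
  have hκ0 : 0 < κ := by linarith
  have hμ' : μ ^ 2 = 1 := by rw [← sq_abs, hμ, one_pow]
  have hs := (summable_seriesTerm hμ hκ (hq.trans_lt (by norm_num))).of_abs
  have e0 : logDet μ κ q - (μ * (Geometry.ell X κ * opTrace ((resolventPair hκ).lam q)) -
      1 / 2 * (Geometry.ell X κ * opTrace ((resolventPair hκ).lam q ^ 2))) =
      ∑' n, seriesTerm μ κ q (n + 2) := by
    rw [logDet, ← hs.sum_add_tsum_nat_add 2, Finset.sum_range_succ, Finset.sum_range_one,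
      seriesTerm_eq hκ, seriesTerm_eq hκ]
    norm_num
    linear_combination (-1 / 2 * (Geometry.ell X κ * opTrace ((resolventPair hκ).lam q ^ 2))) * hμ'
  rw [e0, ← Real.norm_eq_abs]
  have h2 : 2 * (2 / κ * ‖q‖ ^ 2 * b ^ 2) =
      ∑' n : ℕ, 2 / κ * ‖q‖ ^ 2 * b ^ 2 * (1 / 2 : ℝ) ^ n := by
    rw [tsum_mul_left, tsum_geometric_two, mul_comm]
  rw [h2]
  refine tsum_of_norm_bounded (summable_mul_pow (by norm_num) (by norm_num)).hasSum fun n => ?_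
  refine (abs_seriesTerm_le hμ hκ q (n + 2)).trans ?_
  rw [mul_assoc, mul_assoc, mul_assoc, pow_add, mul_comm (_ ^ n)]
  have h3 := (norm_lam_le hκ q).trans hq
  have := norm_nonneg ((resolventPair hκ).lam q)
  gcongr

theorem exists_abs_logDet_sub_le {μ : ℝ} (hμ : |μ| = 1) {φ : X → ℝ} (hφ : Geometry.IsSchwartz φ)
    {q : L2 X} (hq : q =ᵐ[volume] φ) : ∃ C : ℝ, ∀ κ : ℝ, 1 ≤ κ → q ∈ smallBall X (1 / 4) κ →
      |logDet μ κ q - (μ / κ * mass φ - μ / (4 * κ ^ 3) * energy μ φ)| ≤ C / κ ^ 5 := by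
  have h1 := RegularGeometry.isSchwartz_xDeriv _ hφ
  have hi := RegularGeometry.integrable_of_isSchwartz _ hφ
  have hqi : Integrable q := hi.congr hq.symm
  obtain ⟨C₁, hC₁⟩ := IsResolventKernel.exists_integral_mul_conv_le hφ
  obtain ⟨C₂, hC₂⟩ := exists_integral_quartic_le hφ
  obtain ⟨C₃, hC₃0, hC₃⟩ := exists_abs_diagU_sub_le X
  obtain ⟨B, hB⟩ := RegularGeometry.bounded_of_isSchwartz _ hφ
  have hB0 : 0 ≤ B := (abs_nonneg _).trans (hB 0)
  set I := ∫ x, |φ x| with hI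
  have hI0 : 0 ≤ I := integral_nonneg fun x => abs_nonneg _
  have hIq : ∫ x, |q x| = I := integral_congr_ae (hq.mono fun x hx => by simp only [hx])
  -- The `32` is `2⁵`, as both expansions are used at `2κ`. The third summand is the factorization
  -- error in `tr Λ²`, the last the tail with `b = B²/κ²`.
  refine ⟨C₁ / 32 + C₂ / 32 + C₃ * I ^ 2 * (B / 2) * I + 4 * ‖q‖ ^ 2 * B ^ 4,
    fun κ hκ hball => ?_⟩
  have hκ0 : 0 < κ := by linarith
  have hsmall := two_div_mul_norm_sq_le hκ hball
  have h := resolventPair (X := X) hκ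
  have h2 := resolventPair (X := X) (κ := 2 * κ) (by linarith)
  have hBq : ∀ᵐ x, |q x| ≤ B := hq.mono fun x hx => by rw [hx]; exact hB x
  have hlam : ‖(resolventPair hκ).lam q‖ ≤ B / κ * (B / κ) :=
    (norm_mul_le _ _).trans (mul_le_mul (h.snd.norm_op_le_of_bounded hBq hB0)
      (h.fst.norm_op_le_of_bounded hBq hB0) (norm_nonneg _) (by positivity))
  have b0 := abs_logDet_sub_le hμ hκ (hsmall.trans (by norm_num)) hlam
  have b1 := hC₁ _ _ _ h2.fst
  have b2 := hC₂ _ _ _ _ h2.fst h2.snd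
  obtain ⟨i3, e3⟩ := ell_mul_opTrace_lam_sq hκ q
  have e1 := ell_mul_opTrace_lam hκ q
  have cq := fun k : X → ℝ => conv_congr_ae k hq
  simp_rw [cq] at i3 e3 e1
  rw [integral_congr_ae (hq.mono fun x hx => by simp only [hx] :
    (fun x => q x * conv (Geometry.kerPlus (2 * κ)) φ x) =ᵐ[volume]
    fun x => φ x * conv (Geometry.kerPlus (2 * κ)) φ x)] at e1
  set S₀ := Geometry.ell X κ * opTrace ((resolventPair hκ).lam q)
  set S₁ := Geometry.ell X κ * opTrace ((resolventPair hκ).lam q ^ 2)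
  set w := conv (Geometry.kerMinus (2 * κ)) φ
  set v := conv (Geometry.kerPlus (2 * κ)) φ
  have iQ := integrable_quartic hφ h2.fst h2.snd
  have b3 : |1 / 2 * S₁ - ∫ x, φ x * (v x * w x ^ 2)| ≤ C₃ * I ^ 2 * (B / 2) * I / κ ^ 5 := by
    rw [e3, ← mul_assoc, one_div_mul_cancel two_ne_zero, one_mul, ← integral_sub i3 iQ,
      ← Real.norm_eq_abs]
    refine (norm_integral_le_of_norm_le
      (hi.abs.const_mul (B / (2 * κ) * (C₃ / κ ^ 4 * I ^ 2))) ?_).trans (le_of_eq ?_)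
    · filter_upwards [hq] with x hx
      have hU := hC₃ κ hκ q hqi x
      rw [cq, cq, hIq] at hU
      have hw := h2.snd.abs_conv_le hB x
      rw [hx, show w x * φ x * (Geometry.ell X κ * (resolventPair hκ).diagU q 1 x) -
        φ x * (v x * w x ^ 2) = w x * (Geometry.ell X κ * (resolventPair hκ).diagU q 1 x -
        w x * v x) * φ x by ring, norm_mul, norm_mul]
      exact mul_le_mul_of_nonneg_right (mul_le_mul hw hU (norm_nonneg _) (by positivity))
        (norm_nonneg _)
    · rw [integral_const_mul, ← hI]
      field_simp
  have i4 : Integrable fun x => μ * φ x ^ 4 := by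
    have h := RegularGeometry.isSchwartz_mul _ _ hφ hφ
    exact ((integrable_mul_of_isSchwartz h h).congr
      (Eventually.of_forall fun x => by simp only; ring)).const_mul μ
  have i1 : Integrable fun x => xDeriv φ x ^ 2 := (memLp_of_isSchwartz h1).integrable_sq
  rw [← e1] at b1
  rw [mass, energy, integral_add i1 i4, integral_const_mul]
  set M := ∫ x, φ x ^ 2
  set D := ∫ x, xDeriv φ x ^ 2
  set F := ∫ x, φ x ^ 4
  set Q := ∫ x, φ x * (v x * w x ^ 2)
  have hμ2 : μ * μ = 1 := by rw [← abs_mul_abs_self, hμ, one_mul]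
  have e : logDet μ κ q - (μ / κ * (1 / 2 * M) - μ / (4 * κ ^ 3) * (1 / 2 * (D + μ * F))) =
      (logDet μ κ q - (μ * S₀ - 1 / 2 * S₁)) + μ * (S₀ - (M / (2 * κ) - D / (2 * κ) ^ 3)) -
      (1 / 2 * S₁ - Q) - (Q - F / (2 * κ) ^ 3) := by
    have : μ / (4 * κ ^ 3) * (1 / 2 * (D + μ * F)) = μ * D / (2 * κ) ^ 3 + F / (2 * κ) ^ 3 := by
      field_simp
      linear_combination (4 * F) * hμ2
    rw [this]
    field_simp
    ring
  rw [e]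
  have b1' : |μ * (S₀ - (M / (2 * κ) - D / (2 * κ) ^ 3))| ≤ C₁ / (2 * κ) ^ 5 := by
    rwa [abs_mul, hμ, one_mul]
  refine ((abs_sub _ _).trans (add_le_add ((abs_sub _ _).trans (add_le_add
    ((abs_add_le _ _).trans (add_le_add b0 b1')) b3)) b2)).trans (le_of_eq ?_)
  field_simp
  ring

end

/-! ## The line -/

theorem kerPlus_line (κ z : ℝ) :
    (Geometry.kerPlus κ z : ℝ) = if 0 < z then Real.exp (-κ * z) else 0 := by
  change (if 0 < z then Real.exp (-κ * |z|) else 0) = _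
  split_ifs with h
  · rw [abs_of_pos h]
  · rfl

theorem isResolventKernel_line {κ : ℝ} (hκ : 1 ≤ κ) :
    IsResolventKernel κ 1 (Geometry.kerPlus κ : ℝ → ℝ) where
  one_le := hκ
  eps := Or.inl rfl
  measurable := by
    simp_rw [funext (kerPlus_line κ)]
    exact Measurable.ite measurableSet_Ioi (by fun_prop) measurable_const
  nonneg z := by
    rw [kerPlus_line]; split_ifs <;> positivity
  le_two z := by
    rw [kerPlus_line]
    split_ifs with h
    · have : Real.exp (-κ * z) ≤ 1 := Real.exp_le_one_iff.2 (by nlinarith)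
      linarith
    · norm_num
  continuousAt z hz := by
    simp_rw [funext (kerPlus_line κ)]
    rcases lt_or_gt_of_ne hz with h | h
    · refine (continuousAt_const (y := (0 : ℝ))).congr ?_
      filter_upwards [Iio_mem_nhds h] with w hw
      rw [if_neg (not_lt.2 (le_of_lt hw))]
    · refine (show ContinuousAt (fun w : ℝ => Real.exp (-κ * w)) z by fun_prop).congr ?_
      filter_upwards [Ioi_mem_nhds h] with w hw
      rw [if_pos (show 0 < w from hw)]
  lintegral_mul h hh := by
    rw [← lintegral_indicator measurableSet_Ioi]
    refine lintegral_congr fun z => ?_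
    rw [kerPlus_line, Set.indicator_apply]
    simp only [Set.mem_Ioi, one_mul]
    split_ifs
    · rfl
    · simp

theorem isSchwartz_line_xDeriv {φ : ℝ → ℝ} (hφ : Geometry.IsSchwartz φ) :
    Geometry.IsSchwartz (xDeriv φ) := by
  obtain ⟨f, hf⟩ := hφ
  refine ⟨SchwartzMap.derivCLM ℝ ℝ f, fun x => ?_⟩
  rw [SchwartzMap.derivCLM_apply, xDeriv, funext hf]
  change deriv (fun t => f (x + t)) 0 = _
  rw [deriv_comp_const_add, add_zero]

instance : RegularGeometry ℝ where
  proj_add s t := rfl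
  continuous_proj := continuous_id
  continuous_of_comp_proj φ h := h
  surjective_proj := Function.surjective_id
  volume_zero := Real.volume_singleton
  kerMinus_eq κ z := by
    change (if z < 0 then Real.exp (-κ * |z|) else 0) =
      if 0 < -z then Real.exp (-κ * |-z|) else 0
    simp only [Left.neg_pos_iff, abs_neg]
  kerPlus κ hκ := isResolventKernel_line hκ
  ell_mul_sq κ hκ z := by
    change 1 * _ = _
    rw [kerPlus_line, kerPlus_line]
    split_ifs
    · rw [one_mul, ← Real.exp_nat_mul]
      congr 1
      push_cast
      ring
    · norm_num
  ell_mem κ hκ := by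
    change (1 : ℝ) ∈ _
    norm_num
  kerPlus_add := by
    -- On the line the constant is `0`: the exponential is multiplicative for positive arguments,
    -- and otherwise the prefactor vanishes.
    refine ⟨0, fun κ hκ u v => ?_⟩
    change |_ * (_ - 1 * _ * _)| ≤ _
    rw [kerPlus_line, kerPlus_line, kerPlus_line, zero_div, abs_nonpos_iff]
    by_cases hu : 0 < u
    · by_cases hv : 0 < v
      · rw [if_pos hu, if_pos hv, if_pos (add_pos hu hv), mul_add, Real.exp_add]
        ring
      · rw [if_neg hv]; ring
    · rw [if_neg hu]; ring
  ae_eq_zero_of_test v hv h :=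
    ae_eq_zero_of_integral_contDiff_smul_eq_zero (hv.locallyIntegrable (by norm_num))
      fun g hg hg' => by
        simp_rw [smul_eq_mul, mul_comm (g _)]
        exact h g ⟨hg, hg'⟩
  contDiff_of_isSchwartz φ := by
    rintro ⟨f, hf⟩
    rw [funext hf]
    exact f.smooth ⊤
  integrable_of_isSchwartz φ := by
    rintro ⟨f, hf⟩
    rw [funext hf]
    exact f.integrable
  bounded_of_isSchwartz φ := by
    rintro ⟨f, hf⟩
    exact ⟨_, fun x => (hf x).symm ▸ SchwartzMap.norm_le_seminorm ℝ f x⟩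
  isSchwartz_xDeriv φ := isSchwartz_line_xDeriv
  isSchwartz_mul φ ψ := by
    rintro ⟨f, hf⟩ ⟨g, hg⟩
    refine ⟨SchwartzMap.smulLeftCLM ℝ f g, fun x => ?_⟩
    change φ x * ψ x = _
    rw [SchwartzMap.smulLeftCLM_apply_apply f.hasTemperateGrowth, hf, hg, smul_eq_mul]

/-! ## The circle -/

theorem kerPlus_circle (κ t : ℝ) : (Geometry.kerPlus κ (t : UnitAddCircle) : ℝ) =
    Real.exp (-κ * Int.fract t) / (1 - Real.exp (-κ)) := rfl

/-- With `x = e^{-κ}` this gives `ℓ/(1 - x)² = 1/(1 - x²)`, the normalization of the kernel at `2κ`.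
-/
theorem ell_circle (κ : ℝ) : Geometry.ell UnitAddCircle κ =
    (1 - Real.exp (-κ)) / (1 + Real.exp (-κ)) := by
  change Real.tanh (κ / 2) = _
  have h : Real.exp (-(κ / 2)) = Real.exp (κ / 2) * Real.exp (-κ) := by
    rw [← Real.exp_add]; ring_nf
  rw [Real.tanh_eq, h]
  have := Real.exp_pos (κ / 2)
  field_simp

theorem exp_neg_le_half {κ : ℝ} (hκ : 1 ≤ κ) : Real.exp (-κ) ≤ 1 / 2 := by
  have h := Real.add_one_le_exp κ
  rw [Real.exp_neg, one_div]
  exact inv_anti₀ two_pos (by linarith)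

theorem exists_fract_rep (x : UnitAddCircle) :
    ∃ t : ℝ, 0 ≤ t ∧ t < 1 ∧ (t : UnitAddCircle) = x := by
  refine ⟨AddCircle.equivIco 1 0 x, ?_, ?_, (AddCircle.equivIco 1 0).symm_apply_apply x⟩
  · exact (AddCircle.equivIco 1 0 x).2.1
  · simpa using (AddCircle.equivIco 1 0 x).2.2

theorem measurable_of_comp_coe {f : UnitAddCircle → ℝ}
    (hf : Measurable fun t : ℝ => f (t : UnitAddCircle)) : Measurable f := by
  have : f = fun x => (fun t : ℝ => f (t : UnitAddCircle))
      (AddCircle.measurableEquivIco 1 0 x : ℝ) := by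
    funext x
    exact congrArg f ((AddCircle.equivIco 1 0).symm_apply_apply x).symm
  rw [this]
  exact hf.comp (measurable_subtype_coe.comp (AddCircle.measurableEquivIco 1 0).measurable)

theorem kerPlus_circle_of_mem {κ t : ℝ} (h0 : 0 ≤ t) (h1 : t < 1) :
    (Geometry.kerPlus κ (t : UnitAddCircle) : ℝ) = Real.exp (-κ * t) / (1 - Real.exp (-κ)) := by
  rw [kerPlus_circle, Int.fract_eq_self.2 ⟨h0, h1⟩]

theorem volume_zero_circle : (volume : Measure UnitAddCircle) {0} = 0 := by
  have := AddCircle.volume_closedBall (T := 1) (x := 0) 0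
  rw [Metric.closedBall_zero] at this
  rw [this]
  simp

/-- Cutting the half-line into unit intervals and translating them to `(0, 1]` sums over the
windings around the circle. -/
theorem lintegral_Ioi_eq {g : ℝ → ℝ≥0∞} (hg : Measurable g) :
    ∫⁻ t in Set.Ioi (0 : ℝ), g t = ∫⁻ t in Set.Ioc (0 : ℝ) 1, ∑' n : ℕ, g (t + n) := by
  have hmono : Monotone fun n : ℕ => (n : ℝ) := Nat.mono_cast
  have hU : ⋃ n : ℕ, Set.Ioc (n : ℝ) ((n : ℝ) + 1) = Set.Ioi 0 := by
    ext t
    simp only [Set.mem_iUnion, Set.mem_Ioc, Set.mem_Ioi]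
    refine ⟨fun ⟨n, hn, _⟩ => n.cast_nonneg.trans_lt hn, fun ht => ?_⟩
    have h1 : 0 < ⌈t⌉₊ := Nat.ceil_pos.2 ht
    refine ⟨⌈t⌉₊ - 1, ?_, ?_⟩
    · rw [Nat.cast_pred h1]
      linarith [Nat.ceil_lt_add_one ht.le]
    · rw [Nat.cast_pred h1]
      linarith [Nat.le_ceil t]
  have hd := hmono.pairwise_disjoint_on_Ioc_succ
  simp only [Nat.succ_eq_succ, Nat.succ_eq_add_one, Nat.cast_add, Nat.cast_one] at hd
  rw [← hU, lintegral_iUnion (fun n => measurableSet_Ioc) hd, lintegral_tsum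
    (f := fun (n : ℕ) t => g (t + n)) fun n => (hg.comp (measurable_id.add_const _)).aemeasurable]
  refine tsum_congr fun n => ?_
  have := (measurePreserving_add_right (volume : Measure ℝ) (n : ℝ)).setLIntegral_comp_preimage
    (s := Set.Ioc (n : ℝ) (n + 1)) measurableSet_Ioc hg
  rw [← this, Set.preimage_add_const_Ioc, sub_self, add_sub_cancel_left]

theorem coe_add_natCast (t : ℝ) (n : ℕ) : ((t + n : ℝ) : UnitAddCircle) = t := by
  rw [AddCircle.coe_add, add_eq_left]
  exact AddCircle.coe_eq_zero_iff _ |>.2 ⟨n, by simp⟩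

theorem isResolventKernel_circle {κ : ℝ} (hκ : 1 ≤ κ) :
    IsResolventKernel κ 1 (Geometry.kerPlus κ : UnitAddCircle → ℝ) where
  one_le := hκ
  eps := Or.inl rfl
  measurable := by
    refine measurable_of_comp_coe ?_
    simp_rw [kerPlus_circle]
    fun_prop
  nonneg z := by
    obtain ⟨t, h0, h1, rfl⟩ := exists_fract_rep z
    rw [kerPlus_circle_of_mem h0 h1]
    have := exp_neg_le_half hκ
    exact div_nonneg (Real.exp_pos _).le (by linarith)
  le_two z := by
    obtain ⟨t, h0, h1, rfl⟩ := exists_fract_rep z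
    have h2 := exp_neg_le_half hκ
    rw [kerPlus_circle_of_mem h0 h1, div_le_iff₀ (by linarith)]
    have : Real.exp (-κ * t) ≤ 1 := Real.exp_le_one_iff.2 (by nlinarith)
    linarith
  continuousAt z hz := by
    obtain ⟨t, h0, h1, rfl⟩ := exists_fract_rep z
    have h0' : 0 < t := lt_of_le_of_ne h0 fun h => hz (by rw [← h]; rfl)
    refine (QuotientAddGroup.isOpenQuotientMap_mk (N := AddSubgroup.zmultiples (1 : ℝ))
      |>.continuousAt_comp_iff).1 ?_
    refine (show ContinuousAt (fun w : ℝ => Real.exp (-κ * w) / (1 - Real.exp (-κ))) t by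
      fun_prop).congr ?_
    filter_upwards [Ioo_mem_nhds h0' h1] with w hw
    exact (kerPlus_circle_of_mem hw.1.le hw.2).symm
  lintegral_mul h hh := by
    have hm : Measurable fun t : ℝ => h (t : UnitAddCircle) :=
      hh.comp AddCircle.measurable_mk'
    rw [← UnitAddCircle.lintegral_preimage 0, zero_add, lintegral_Ioi_eq (by
      simp only [one_mul]
      exact Measurable.mul (by fun_prop) hm)]
    refine lintegral_congr_ae ?_
    -- At `t = 1` the kernel takes its value at `0`, not the left limit; this point is null.
    have h1 : ∀ᵐ t : ℝ ∂volume.restrict (Set.Ioc 0 1), t ≠ 1 :=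
      ae_restrict_of_ae (Measure.ae_ne volume 1)
    filter_upwards [h1, ae_restrict_mem measurableSet_Ioc] with t ht ht'
    have h2 := exp_neg_le_half hκ
    have h3 : ∀ n : ℕ, Real.exp (-κ * (t + n)) =
        Real.exp (-κ * t) * Real.exp (-κ) ^ n := fun n => by
      rw [← Real.exp_nat_mul, ← Real.exp_add]; ring_nf
    have h4 : ∀ n : ℕ, (Geometry.proj (1 * (t + n)) : UnitAddCircle) = (t : UnitAddCircle) :=
      fun n => by rw [one_mul]; exact coe_add_natCast t n
    simp_rw [h3, h4]
    rw [ENNReal.tsum_mul_right, ← ENNReal.ofReal_tsum_of_nonneg (fun n => by positivity)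
      ((summable_geometric_of_lt_one (Real.exp_pos _).le (by linarith)).mul_left _), tsum_mul_left,
      tsum_geometric_of_lt_one (Real.exp_pos _).le (by linarith),
      kerPlus_circle_of_mem ht'.1.le (lt_of_le_of_ne ht'.2 ht), div_eq_mul_inv]

/-- Take representatives in `[0, 1)` and `x = e^{-κ}`. If their sum stays below `1`, the difference
in brackets is `O(x)`. If it wraps around, that difference is not small, but the product of the
first two kernels contains a factor `x`. Both cases reduce to the same expression in `y`. -/
theorem abs_kerPlus_circle_le {κ : ℝ} (hκ : 1 ≤ κ) (u v : UnitAddCircle) :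
    |Geometry.kerPlus κ u * Geometry.kerPlus κ v * (Geometry.kerPlus κ (u + v) -
      Geometry.ell UnitAddCircle κ * Geometry.kerPlus κ u * Geometry.kerPlus κ v)| ≤
      16 * Real.exp (-κ) := by
  obtain ⟨t, t0, t1, rfl⟩ := exists_fract_rep u
  obtain ⟨s, s0, s1, rfl⟩ := exists_fract_rep v
  have h2 := exp_neg_le_half hκ
  have h3 := Real.exp_pos (-κ)
  rw [← AddCircle.coe_add, kerPlus_circle_of_mem t0 t1, kerPlus_circle_of_mem s0 s1, ell_circle]
  have ea : Real.exp (-κ * (t + s)) = Real.exp (-κ * t) * Real.exp (-κ * s) := by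
    rw [← Real.exp_add]; ring_nf
  have ha : Real.exp (-κ * t) ≤ 1 := Real.exp_le_one_iff.2 (by nlinarith)
  have hb : Real.exp (-κ * s) ≤ 1 := Real.exp_le_one_iff.2 (by nlinarith)
  have ha0 := Real.exp_pos (-κ * t)
  have hb0 := Real.exp_pos (-κ * s)
  set a := Real.exp (-κ * t)
  set b := Real.exp (-κ * s)
  set x := Real.exp (-κ)
  have hx : 0 < 1 - x := by linarith
  have hx' : 0 < 1 + x := by linarith
  have hc : 1 / (1 - x) ≤ 2 := by rw [div_le_iff₀ hx]; linarith
  have hc0 : 0 < 1 / (1 - x) := by positivity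
  have key : ∀ y : ℝ, 0 < y → y ≤ 1 →
      |y ^ 2 * (1 / (1 - x)) ^ 3 * (1 / (1 + x)) * x| ≤ 16 * x := fun y hy hy1 => by
    rw [abs_of_nonneg (by positivity)]
    refine mul_le_mul_of_nonneg_right ?_ h3.le
    calc y ^ 2 * (1 / (1 - x)) ^ 3 * (1 / (1 + x)) ≤ 1 ^ 2 * 2 ^ 3 * 1 := by
          gcongr
          rw [div_le_one hx']
          linarith
      _ ≤ 16 := by norm_num
  rcases lt_or_ge (t + s) 1 with h | h
  · rw [kerPlus_circle_of_mem (by linarith) h, ea, show Real.exp (-κ) = x from rfl]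
    refine le_trans (le_of_eq ?_) (key (a * b) (mul_pos ha0 hb0) (mul_le_one₀ ha hb0.le hb))
    congr 1
    field_simp
    ring
  · have e1 : ((t + s : ℝ) : UnitAddCircle) = ((t + s - 1 : ℝ) : UnitAddCircle) := by
      have := coe_add_natCast (t + s - 1) 1
      rw [Nat.cast_one, sub_add_cancel] at this
      exact this
    have e2 : a * b = Real.exp (-κ * (t + s - 1)) * x := by
      rw [← ea, ← Real.exp_add]; ring_nf
    have he : Real.exp (-κ * (t + s - 1)) ≤ 1 := Real.exp_le_one_iff.2 (by nlinarith)
    rw [e1, kerPlus_circle_of_mem (by linarith) (by linarith), show Real.exp (-κ) = x from rfl]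
    refine le_trans (le_of_eq ?_) (key _ (Real.exp_pos _) he)
    congr 1
    rw [show ∀ ℓ E : ℝ, a / (1 - x) * (b / (1 - x)) * (E - ℓ * (a / (1 - x)) * (b / (1 - x))) =
      a * b / (1 - x) ^ 2 * (E - ℓ * (a * b) / (1 - x) ^ 2) from fun ℓ E => by
        field_simp, e2]
    field_simp
    ring

/-- Real and imaginary parts of the exponentials are test functions on the compact circle, so all
Fourier coefficients of `v` vanish. -/
theorem ae_eq_zero_circle {v : UnitAddCircle → ℝ} (hv : MemLp v 2 volume)
    (h : ∀ φ, IsTest φ → ∫ x, v x * φ x = 0) : v =ᵐ[volume] 0 := by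
  have htest : ∀ (L : ℂ →L[ℝ] ℝ) (n : ℤ), IsTest fun x : UnitAddCircle => L (fourier n x) := by
    intro L n
    refine ⟨?_, HasCompactSupport.of_compactSpace _⟩
    change ContDiff ℝ ∞ fun t : ℝ => L (fourier n (t : UnitAddCircle))
    refine L.contDiff.comp ?_
    simp_rw [fourier_coe_apply]
    refine ContDiff.cexp ((contDiff_const.mul ?_).div_const _)
    exact Complex.ofRealCLM.contDiff
  have hvol : (volume : Measure UnitAddCircle) = AddCircle.haarAddCircle := by
    rw [AddCircle.volume_eq_smul_haarAddCircle, ENNReal.ofReal_one, one_smul]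
  have hv' : MemLp (fun x => (v x : ℂ)) 2 (AddCircle.haarAddCircle (T := 1)) := by
    rw [← hvol]; exact hv.ofReal
  have hL : ∀ (L : ℂ →L[ℝ] ℝ) (n : ℤ), ∫ x, L (fourier n x * (v x : ℂ)) = 0 := fun L n => by
    have e : ∀ x : UnitAddCircle, L (fourier n x * (v x : ℂ)) = v x * L (fourier n x) := fun x => by
      rw [mul_comm, ← smul_eq_mul, Complex.coe_smul, map_smul, smul_eq_mul]
    simp_rw [e]
    exact h _ (htest L n)
  have hi : ∀ n : ℤ, Integrable fun x : UnitAddCircle => fourier n x * (v x : ℂ) := fun n => by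
    have : Integrable fun x : UnitAddCircle => (v x : ℂ) := (hv.integrable (by norm_num)).ofReal
    refine this.bdd_mul (c := ‖fourier (T := 1) n‖) (map_continuous _).aestronglyMeasurable
      (Eventually.of_forall fun x => ContinuousMap.norm_coe_le_norm _ x)
  have h0 : ∀ n : ℤ, ∫ x : UnitAddCircle, fourier n x * (v x : ℂ) = 0 := fun n => by
    refine Complex.ext ?_ ?_
    · exact (Complex.reCLM.integral_comp_comm (hi n)).symm.trans (hL _ n)
    · exact (Complex.imCLM.integral_comp_comm (hi n)).symm.trans (hL _ n)
  have hz : hv'.toLp _ = 0 := by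
    refine (fourierBasis (T := 1)).repr.injective (lp.ext (funext fun n => ?_))
    refine Eq.trans ?_ (show (0 : ℂ) = _ by rw [map_zero]; rfl)
    rw [fourierBasis_repr, fourierCoeff, ← h0 (-n), hvol]
    refine integral_congr_ae ?_
    filter_upwards [hv'.coeFn_toLp] with x hx
    rw [hx, smul_eq_mul]
  have := hv'.coeFn_toLp
  rw [hz, ← hvol] at this
  filter_upwards [this, hvol ▸ Lp.coeFn_zero ℂ 2 (AddCircle.haarAddCircle (T := 1))] with x h1 h2
  rw [h2] at h1
  exact Complex.ofReal_eq_zero.1 h1.symm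

instance : RegularGeometry UnitAddCircle where
  proj_add s t := rfl
  continuous_proj := AddCircle.continuous_mk' 1
  continuous_of_comp_proj φ h :=
    QuotientAddGroup.isOpenQuotientMap_mk.isQuotientMap.continuous_iff.2 h
  surjective_proj := QuotientAddGroup.mk_surjective
  volume_zero := volume_zero_circle
  kerMinus_eq κ z := by
    induction z using QuotientAddGroup.induction_on with
    | H t =>
      change Real.exp (κ * (t - ⌈t⌉)) / (1 - Real.exp (-κ)) =
        Real.exp (-κ * (-t - ⌊-t⌋)) / (1 - Real.exp (-κ))
      rw [Int.floor_neg]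
      push_cast
      ring_nf
  kerPlus κ hκ := isResolventKernel_circle hκ
  ell_mul_sq κ hκ z := by
    obtain ⟨t, h0, h1, rfl⟩ := exists_fract_rep z
    have h2 := exp_neg_le_half hκ
    have h3 := Real.exp_pos (-κ)
    rw [kerPlus_circle_of_mem h0 h1, kerPlus_circle_of_mem h0 h1, ell_circle,
      show -(2 * κ) * t = -κ * t + -κ * t by ring, show -(2 * κ) = -κ + -κ by ring, Real.exp_add,
      Real.exp_add]
    have h4 : 1 - Real.exp (-κ) ≠ 0 := by linarith
    have h5 : 1 + Real.exp (-κ) ≠ 0 := by linarith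
    rw [show 1 - Real.exp (-κ) * Real.exp (-κ) = (1 - Real.exp (-κ)) * (1 + Real.exp (-κ)) by ring]
    field_simp
  ell_mem κ hκ := by
    have h2 := exp_neg_le_half hκ
    have h3 := Real.exp_pos (-κ)
    rw [ell_circle]
    constructor
    · rw [le_div_iff₀ (by linarith)]; linarith
    · rw [div_le_one (by linarith)]; linarith
  kerPlus_add := by
    -- The `24` is `4!`, from `κ⁴/4! ≤ e^κ`.
    refine ⟨16 * 24, fun κ hκ u v => (abs_kerPlus_circle_le hκ u v).trans ?_⟩
    have h1 := Real.pow_div_factorial_le_exp κ (by linarith) 4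
    have hκ0 : 0 < κ ^ 4 := by positivity
    rw [Real.exp_neg, mul_div_assoc]
    refine mul_le_mul_of_nonneg_left ?_ (by norm_num)
    rw [inv_le_comm₀ (Real.exp_pos _) (by positivity), inv_div]
    exact (le_of_eq (by norm_num [Nat.factorial])).trans h1
  ae_eq_zero_of_test v hv h := ae_eq_zero_circle hv h
  contDiff_of_isSchwartz φ h := h
  integrable_of_isSchwartz φ h := by
    have hc : Continuous φ := QuotientAddGroup.isOpenQuotientMap_mk.isQuotientMap.continuous_iff.2
      (ContDiff.continuous (𝕜 := ℝ) h)
    exact hc.integrable_of_hasCompactSupport (HasCompactSupport.of_compactSpace _)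
  bounded_of_isSchwartz φ h := by
    have hc : Continuous φ := QuotientAddGroup.isOpenQuotientMap_mk.isQuotientMap.continuous_iff.2
      (ContDiff.continuous (𝕜 := ℝ) h)
    obtain ⟨C, hC⟩ := isCompact_univ.exists_bound_of_continuousOn hc.continuousOn
    exact ⟨C, fun x => hC x (Set.mem_univ x)⟩
  isSchwartz_xDeriv φ h := by
    change ContDiff ℝ ∞ _
    have e : (fun t : ℝ => xDeriv φ (t : UnitAddCircle)) =
        deriv fun t : ℝ => φ (t : UnitAddCircle) := by
      funext s
      change deriv (fun t : ℝ => φ ((s + t : ℝ) : UnitAddCircle)) 0 = _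
      rw [deriv_comp_const_add (fun t : ℝ => φ (t : UnitAddCircle)) s 0, add_zero]
    rw [e]
    exact (contDiff_infty_iff_deriv.1 h).2
  isSchwartz_mul φ ψ h h' := ContDiff.mul (𝕜 := ℝ) h h'

variable (X : Type) [AddCommGroup X] [TopologicalSpace X] [IsTopologicalAddGroup X]
  [T2Space X] [LocallyCompactSpace X] [SecondCountableTopology X] [MeasureSpace X] [BorelSpace X]
  [(volume : Measure X).IsAddHaarMeasure] [Geometry X] [RegularGeometry X]

/-! ## The main theorem for a regular geometry -/

theorem exists_radius_logDet {μ : ℝ} (hμ : |μ| = 1) : ∃ δ : ℝ, 0 < δ ∧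
    (∀ κ : ℝ, 1 ≤ κ → ∀ q ∈ smallBall X δ κ, ∀ m : ℕ, 1 ≤ m → IsTraceClass (lambdaOp κ q ^ m)) ∧
    (∀ κ : ℝ, 1 ≤ κ → ∀ q ∈ smallBall X δ κ, Summable fun n => |seriesTerm μ κ q n|) ∧
    TendstoUniformlyOn
      (fun (N : ℕ) (z : ℝ × L2 X) => ∑ n ∈ Finset.range N, seriesTerm μ z.1 z.2 n)
      (fun z => logDet μ z.1 z.2) atTop
      {z : ℝ × L2 X | 1 ≤ z.1 ∧ z.2 ∈ smallBall X δ z.1} ∧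
    (∀ κ : ℝ, 1 ≤ κ → ∀ q ∈ smallBall X δ κ,
      ∃ G, IsGreenFunction μ κ q G ∧ HasFunctionalDeriv (logDet μ κ) (rVar μ κ G) q) ∧
    (∀ φ : X → ℝ, Geometry.IsSchwartz φ → ∀ q : L2 X, (∀ᵐ x, q x = φ x) →
      ∃ C : ℝ, ∀ κ : ℝ, 1 ≤ κ → q ∈ smallBall X δ κ →
        |logDet μ κ q - (μ / κ * mass φ - μ / (4 * κ ^ 3) * energy μ φ)| ≤ C / κ ^ 5) ∧
    (∀ κ ϰ : ℝ, 1 ≤ κ → 1 ≤ ϰ → ∀ q ∈ smallBall X δ κ, q ∈ smallBall X δ ϰ →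
      HasPoissonBracket (logDet μ κ) (logDet μ ϰ) q 0) := by
  have small : ∀ {κ : ℝ}, 1 ≤ κ → ∀ {q : L2 X}, q ∈ smallBall X (1 / 4) κ →
      2 / κ * ‖q‖ ^ 2 < 1 / 2 := fun hκ q hq =>
    (two_div_mul_norm_sq_le hκ hq).trans_lt (by norm_num)
  refine ⟨1 / 4, by norm_num, fun κ hκ q _ m hm => ?_,
    fun κ hκ q hq => summable_seriesTerm hμ hκ ((small hκ hq).trans (by norm_num)),
    tendstoUniformlyOn_seriesTerm hμ, fun κ hκ q hq => exists_isGreenFunction hμ hκ (small hκ hq),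
    fun φ hφ q hq => exists_abs_logDet_sub_le hμ hφ hq,
    fun κ ϰ hκ hϰ q hq hq' => hasPoissonBracket_logDet hμ hκ hϰ (small hκ hq) (small hϰ hq')⟩
  obtain ⟨n, rfl⟩ : ∃ n, m = n + 1 := ⟨m - 1, by omega⟩
  exact (resolventPair hκ).isTraceClass_lam_pow q n

end MKdV

end

theorem proposition3p1 (μ : ℝ) (hμ : μ = 1 ∨ μ = -1) :
    -- on the line
    (∃ δ : ℝ, 0 < δ ∧
      -- the traces make sense
      (∀ κ : ℝ, 1 ≤ κ → ∀ q ∈ smallBall ℝ δ κ, ∀ m : ℕ, 1 ≤ m →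
        IsTraceClass (lambdaOp κ q ^ m)) ∧
      -- the series converges absolutely, and uniformly in `κ ≥ 1` and `q ∈ B_(δ,κ)`
      (∀ κ : ℝ, 1 ≤ κ → ∀ q ∈ smallBall ℝ δ κ, Summable fun n => |seriesTerm μ κ q n|) ∧
      TendstoUniformlyOn
        (fun (N : ℕ) (z : ℝ × L2 ℝ) => ∑ n ∈ Finset.range N, seriesTerm μ z.1 z.2 n)
        (fun z => logDet μ z.1 z.2) atTop
        {z : ℝ × L2 ℝ | 1 ≤ z.1 ∧ z.2 ∈ smallBall ℝ δ z.1} ∧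
      -- `δA/δq = r(κ)`
      (∀ κ : ℝ, 1 ≤ κ → ∀ q ∈ smallBall ℝ δ κ,
        ∃ G, IsGreenFunction μ κ q G ∧ HasFunctionalDeriv (logDet μ κ) (rVar μ κ G) q) ∧
      -- the asymptotic expansion
      (∀ φ : ℝ → ℝ, Geometry.IsSchwartz φ → ∀ q : L2 ℝ, (∀ᵐ x, q x = φ x) →
        ∃ C : ℝ, ∀ κ : ℝ, 1 ≤ κ → q ∈ smallBall ℝ δ κ →
          |logDet μ κ q - (μ / κ * mass φ - μ / (4 * κ ^ 3) * energy μ φ)| ≤ C / κ ^ 5) ∧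
      -- Poisson commutation
      (∀ κ ϰ : ℝ, 1 ≤ κ → 1 ≤ ϰ → ∀ q ∈ smallBall ℝ δ κ, q ∈ smallBall ℝ δ ϰ →
        HasPoissonBracket (logDet μ κ) (logDet μ ϰ) q 0)) ∧
    -- on the circle
    (∃ δ : ℝ, 0 < δ ∧
      -- the traces make sense
      (∀ κ : ℝ, 1 ≤ κ → ∀ q ∈ smallBall UnitAddCircle δ κ, ∀ m : ℕ, 1 ≤ m →
        IsTraceClass (lambdaOp κ q ^ m)) ∧
      -- the series converges absolutely, and uniformly in `κ ≥ 1` and `q ∈ B_(δ,κ)`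
      (∀ κ : ℝ, 1 ≤ κ → ∀ q ∈ smallBall UnitAddCircle δ κ, Summable fun n => |seriesTerm μ κ q n|) ∧
      TendstoUniformlyOn
        (fun (N : ℕ) (z : ℝ × L2 UnitAddCircle) => ∑ n ∈ Finset.range N, seriesTerm μ z.1 z.2 n)
        (fun z => logDet μ z.1 z.2) atTop
        {z : ℝ × L2 UnitAddCircle | 1 ≤ z.1 ∧ z.2 ∈ smallBall UnitAddCircle δ z.1} ∧
      -- `δA/δq = r(κ)`
      (∀ κ : ℝ, 1 ≤ κ → ∀ q ∈ smallBall UnitAddCircle δ κ,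
        ∃ G, IsGreenFunction μ κ q G ∧ HasFunctionalDeriv (logDet μ κ) (rVar μ κ G) q) ∧
      -- the asymptotic expansion
      (∀ φ : UnitAddCircle → ℝ, Geometry.IsSchwartz φ → ∀ q : L2 UnitAddCircle, (∀ᵐ x, q x = φ x) →
        ∃ C : ℝ, ∀ κ : ℝ, 1 ≤ κ → q ∈ smallBall UnitAddCircle δ κ →
          |logDet μ κ q - (μ / κ * mass φ - μ / (4 * κ ^ 3) * energy μ φ)| ≤ C / κ ^ 5) ∧
      -- Poisson commutation
      (∀ κ ϰ : ℝ, 1 ≤ κ → 1 ≤ ϰ → ∀ q ∈ smallBall UnitAddCircle δ κ, q ∈ smallBall UnitAddCircle δ ϰ →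
        HasPoissonBracket (logDet μ κ) (logDet μ ϰ) q 0)) := by
  have h : |μ| = 1 := by rcases hμ with rfl | rfl <;> simp
  exact ⟨MKdV.exists_radius_logDet ℝ h, MKdV.exists_radius_logDet UnitAddCircle h⟩
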